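/- Let $\Omega=(a,b)$ be a bounded open interval, $0<\alpha<1$, $1<p<\infty$ and $\alpha p>1$. All functions are real valued. For $\varphi\in C_0^\infty(\Omega)$ (smooth with compact support in $\Omega$, extended by zero to $\mathbb R$) let $${}^{-}D^\alpha\varphi(x)=\frac{1}{\Gamma(1-\alpha)}\frac{d}{dx}\int_{-\infty}^x\frac{\varphi(y)}{(x-y)^{\alpha}}\,dy,\qquad {}^{+}D^\alpha\varphi(x)=-\frac{1}{\Gamma(1-\alpha)}\frac{d}{dx}\int_x^{\infty}\frac{\varphi(y)}{(y-x)^{\alpha}}\,dy .$$ For $u\in L^1(\Omega)$, a function $v\in L^1_{loc}(\Omega)$ is the weak derivative ${}^{\pm}\mathcal D^\alpha u$ if $\int_\Omega v\varphi\,dx=\int_\Omega u\;{}^{\mp}D^\alpha\varphi\,dx$ for all $\varphi\in C_0^\infty(\Omega)$. Let $${}^{\pm}W^{\alpha,p}(\Omega)=\{u\in L^p(\Omega):{}^{\pm}\mathcal D^\alpha u\in L^p(\Omega)\},\qquad \|u\|_{{}^{\pm}W^{\alpha,p}}=\bigl(\|u\|_{L^p}^p+\|{}^{\pm}\mathcal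 D^\alpha u\|_{L^p}^p\bigr)^{1/p},$$ and $W^{\alpha,p}(\Omega)={}^{-}W^{\alpha,p}(\Omega)\cap{}^{+}W^{\alpha,p}(\Omega)$ with norm $\bigl(\|u\|_{{}^{-}W^{\alpha,p}}^p+\|u\|_{{}^{+}W^{\alpha,p}}^p\bigr)^{1/p}$. Functions in ${}^{-}W^{\alpha,p}(\Omega)$ (resp. ${}^{+}W^{\alpha,p}(\Omega)$) have a representative that is continuous on $(a,b]$ (resp. $[a,b)$); the one-sided traces ${}^{-}Tu=u(b)$ and ${}^{+}Tu=u(a)$ are the endpoint values of this representative. Put $${}^{\pm}W^{\alpha,p}_0(\Omega)=\{u\in{}^{\pm}W^{\alpha,p}(\Omega):{}^{\pm}Tu=0\},\qquad W^{\alpha,p}_0(\Omega)=\{u\in W^{\alpha,p}(\Omega):{}^{-}Tu={}^{+}Tu=0\}.$$ Let ${}^{-}C_0^\infty(\Omega)$ (resp. ${}^{+}C_0^\infty(\Omega)$) be the set of $\varphi\in C^\infty(\Omega)$ for which there is $c\in(a,b)$ with $\varphi(x)=0$ for all $x\in\Omega$ with $x>c$ (resp. $x<c$). Then: (i) for each of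 the two signs, the completion of ${}^{\pm}C_0^\infty(\Omega)\cap{}^{\pm}W^{\alpha,p}(\Omega)$ in the norm of ${}^{\pm}W^{\alpha,p}(\Omega)$ equals ${}^{\pm}W_0^{\alpha,p}(\Omega)$; (ii) the completion of $C_0^\infty(\Omega)$ in the norm of $W^{\alpha,p}(\Omega)$ equals $W_0^{\alpha,p}(\Omega)$. Here "the completion of $V$ equals $W$" means that $W$ is the closure of $V$ in the ambient Sobolev space and that the inclusion of $V$ into $W$ extends to an isometric linear isomorphism of the abstract completion of $V$ onto $W$ (in particular, $W$ is complete). -/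

import Mathlib

open MeasureTheory Set Filter
open scoped ENNReal ContDiff

noncomputable section

namespace FracSob

/-- The direction of a fractional operator: `left` stands for the superscript `-`,
`right` for the superscript `+`. -/
inductive Side
  | left
  | right

/-- The opposite direction. -/
def Side.opp : Side → Side
  | .left => .right
  | .right => .left

/-- The Riemann-Liouville fractional integral of order `β > 0` on the real line,
`(1 / Γ(β)) ∫_{-∞}^x (x - y)^(β - 1) f(y) dy` (left) and
`(1 / Γ(β)) ∫_x^∞ (y - x)^(β - 1) f(y) dy` (right). -/
def fracIntegral : Side → ℝ → (ℝ → ℝ) → ℝ → ℝ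
  | .left, β, f, x => (1 / Real.Gamma β) * ∫ y in Iio x, (x - y) ^ (β - 1) * f y
  | .right, β, f, x => (1 / Real.Gamma β) * ∫ y in Ioi x, (y - x) ^ (β - 1) * f y

/-- The classical Riemann-Liouville fractional derivative of order `0 < α < 1` on the real line,
`d/dx` (left) and `- d/dx` (right) of the fractional integral of order `1 - α`. -/
def rlDeriv : Side → ℝ → (ℝ → ℝ) → ℝ → ℝ
  | .left, α, f, x => deriv (fracIntegral .left (1 - α) f) x
  | .right, α, f, x => -deriv (fracIntegral .right (1 - α) f) x

/-- `φ ∈ C₀^∞((a,b))`, identified with its extension by zero to the real line. -/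
structure IsTest (a b : ℝ) (φ : ℝ → ℝ) : Prop where
  smooth : ContDiff ℝ ∞ φ
  compact : HasCompactSupport φ
  supp : tsupport φ ⊆ Ioo a b

/-- `v` is the weak fractional derivative, in the direction `s` and of order `0 < α < 1`,
of `u` on `(a,b)`. -/
structure IsWeakDeriv (s : Side) (α a b : ℝ) (u v : ℝ → ℝ) : Prop where
  integrable : IntegrableOn u (Ioo a b)
  locInt : LocallyIntegrableOn v (Ioo a b)
  integral_eq : ∀ φ : ℝ → ℝ, IsTest a b φ →
    ∫ x in Ioo a b, v x * φ x = ∫ x in Ioo a b, u x * rlDeriv s.opp α φ x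

/-! ### Helper facts: linearity and uniqueness of the weak fractional derivative -/

theorem contDiff_fracIntegral (s : Side) {β : ℝ} (hβ : 0 < β) {φ : ℝ → ℝ}
    (h1 : ContDiff ℝ ∞ φ) (h2 : HasCompactSupport φ) : ContDiff ℝ ∞ (fracIntegral s β φ) := by
  have key : ∀ k : ℝ → ℝ, Measurable k → (∀ x, ‖k x‖ ≤ 1 * ‖x‖ ^ (-(1 - β))) →
      ContDiff ℝ ∞ (fun x => ∫ t, k t * φ (x - t)) := by
    intro k hk hb
    have hl : LocallyIntegrable k volume :=
      locallyIntegrable_of_norm_le_rpow (by simp) (α := 1 - β) (by simpa using hβ)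
        (Eventually.of_forall hb) hk.aestronglyMeasurable
    have := h2.contDiff_convolution_right (n := ⊤) (ContinuousLinearMap.mul ℝ ℝ) hl h1
    exact this
  cases s with
  | left =>
    have := key ((Ioi 0).indicator fun t => t ^ (β - 1))
      ((by fun_prop : Measurable fun t : ℝ => t ^ (β - 1)).indicator measurableSet_Ioi) (by
        intro x
        by_cases hx : x ∈ Ioi (0 : ℝ)
        · rw [indicator_of_mem hx, Real.norm_eq_abs, Real.norm_eq_abs, abs_of_pos (a := x) hx,
            abs_of_pos (Real.rpow_pos_of_pos hx _)]
          simp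
        · rw [indicator_of_notMem hx]; simp; positivity)
    have h : fracIntegral .left β φ = fun x => (1 / Real.Gamma β) *
        ∫ t, (Ioi 0).indicator (fun t => t ^ (β - 1)) t * φ (x - t) := by
      ext x
      simp only [fracIntegral]
      rw [← integral_sub_left_eq_self _ volume x, ← integral_indicator measurableSet_Iio]
      congr 2
      ext t
      by_cases ht : t < x <;> simp [indicator, ht]
    rw [h]
    exact contDiff_const.mul this
  | right =>
    have := key ((Iio 0).indicator fun t => (-t) ^ (β - 1))
      ((by fun_prop : Measurable fun t : ℝ => (-t) ^ (β - 1)).indicator measurableSet_Iio) (by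
        intro x
        by_cases hx : x ∈ Iio (0 : ℝ)
        · rw [indicator_of_mem hx, Real.norm_eq_abs, Real.norm_eq_abs, abs_of_neg (a := x) hx,
            abs_of_pos (Real.rpow_pos_of_pos (neg_pos.2 hx) _)]
          simp
        · rw [indicator_of_notMem hx]; simp; positivity)
    have h : fracIntegral .right β φ = fun x => (1 / Real.Gamma β) *
        ∫ t, (Iio 0).indicator (fun t => (-t) ^ (β - 1)) t * φ (x - t) := by
      ext x
      simp only [fracIntegral]
      rw [← integral_sub_left_eq_self _ volume x, ← integral_indicator measurableSet_Ioi]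
      congr 2
      ext t
      by_cases ht : x < t <;> simp [indicator, ht]
    rw [h]
    exact contDiff_const.mul this

theorem continuous_rlDeriv (s : Side) {α a b : ℝ} (hα : α < 1) {φ : ℝ → ℝ} (h : IsTest a b φ) :
    Continuous (rlDeriv s α φ) := by
  have := fun s => (contDiff_fracIntegral s (sub_pos.2 hα) h.smooth h.compact).continuous_deriv
    (by simp)
  cases s with
  | left => exact this .left
  | right => exact (this .right).neg

theorem integrableOn_mul_rlDeriv (s : Side) {α a b : ℝ} (hα : α < 1) {u φ : ℝ → ℝ}
    (hu : IntegrableOn u (Ioo a b)) (h : IsTest a b φ) :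
    IntegrableOn (fun x => u x * rlDeriv s α φ x) (Ioo a b) :=
  hu.mul_continuousOn_of_subset (continuous_rlDeriv s hα h).continuousOn measurableSet_Ioo
    isCompact_Icc Ioo_subset_Icc_self

theorem integrableOn_mul_test {a b : ℝ} {v φ : ℝ → ℝ}
    (hv : LocallyIntegrableOn v (Ioo a b)) (h : IsTest a b φ) :
    IntegrableOn (fun x => v x * φ x) (Ioo a b) := by
  have h1 : IntegrableOn (fun x => v x * φ x) (tsupport φ) :=
    (hv.integrableOn_compact_subset h.supp h.compact).mul_continuousOn
      h.smooth.continuous.continuousOn h.compact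
  refine ((integrableOn_iff_integrable_of_support_subset ?_).1 h1).integrableOn
  intro x hx
  exact subset_tsupport φ (right_ne_zero_of_mul hx)

namespace IsWeakDeriv

variable {s : Side} {α a b : ℝ} {u u' v v' : ℝ → ℝ}

theorem congr (h : IsWeakDeriv s α a b u v) (hu : u' =ᵐ[volume.restrict (Ioo a b)] u)
    (hv : v' =ᵐ[volume.restrict (Ioo a b)] v) : IsWeakDeriv s α a b u' v' where
  integrable := h.integrable.congr hu.symm
  locInt := by
    rw [locallyIntegrableOn_iff isOpen_Ioo.isLocallyClosed]
    intro k hk hkc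
    exact (h.locInt.integrableOn_compact_subset hk hkc).congr
      (ae_restrict_of_ae_restrict_of_subset hk hv.symm)
  integral_eq φ hφ := by
    have e := h.integral_eq φ hφ
    have e1 : ∫ x in Ioo a b, v' x * φ x = ∫ x in Ioo a b, v x * φ x :=
      integral_congr_ae (hv.mono fun x hx => by simp only [hx])
    have e2 : ∫ x in Ioo a b, u' x * rlDeriv s.opp α φ x
        = ∫ x in Ioo a b, u x * rlDeriv s.opp α φ x :=
      integral_congr_ae (hu.mono fun x hx => by simp only [hx])
    rw [e1, e2, e]

theorem zero : IsWeakDeriv s α a b 0 0 where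
  integrable := integrable_zero _ _ _
  locInt := locallyIntegrableOn_zero
  integral_eq φ _ := by simp

theorem add (hα : α < 1) (h : IsWeakDeriv s α a b u v) (h' : IsWeakDeriv s α a b u' v') :
    IsWeakDeriv s α a b (u + u') (v + v') where
  integrable := h.integrable.add h'.integrable
  locInt := h.locInt.add h'.locInt
  integral_eq φ hφ := by
    simp only [Pi.add_apply, add_mul]
    rw [integral_add (integrableOn_mul_test h.locInt hφ) (integrableOn_mul_test h'.locInt hφ),
      integral_add (integrableOn_mul_rlDeriv _ hα h.integrable hφ)
        (integrableOn_mul_rlDeriv _ hα h'.integrable hφ), h.integral_eq φ hφ, h'.integral_eq φ hφ]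

theorem smul (c : ℝ) (h : IsWeakDeriv s α a b u v) : IsWeakDeriv s α a b (c • u) (c • v) where
  integrable := h.integrable.smul c
  locInt := h.locInt.smul c
  integral_eq φ hφ := by
    simp only [Pi.smul_apply, smul_eq_mul, mul_assoc]
    rw [integral_const_mul, integral_const_mul, h.integral_eq φ hφ]

theorem unique (h : IsWeakDeriv s α a b u v) (h' : IsWeakDeriv s α a b u v') :
    v =ᵐ[volume.restrict (Ioo a b)] v' := by
  have := isOpen_Ioo.ae_eq_zero_of_integral_contDiff_smul_eq_zero (h.locInt.sub h'.locInt)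
    (μ := volume) (by
      intro φ h1 h2 h3
      have hφ : IsTest a b φ := ⟨h1, h2, h3⟩
      have e := (h.integral_eq φ hφ).trans (h'.integral_eq φ hφ).symm
      have e2 : ∫ x in Ioo a b, (v x * φ x - v' x * φ x) = 0 := by
        rw [integral_sub (integrableOn_mul_test h.locInt hφ) (integrableOn_mul_test h'.locInt hφ),
          e, sub_self]
      rw [setIntegral_eq_integral_of_forall_compl_eq_zero] at e2
      · rw [← e2]
        congr 1
        ext x
        simp only [smul_eq_mul, Pi.sub_apply]
        ring
      · intro x hx
        have : φ x = 0 := image_eq_zero_of_notMem_tsupport fun hx' => hx (h3 hx')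
        simp [this])
  rw [EventuallyEq, ae_restrict_iff' measurableSet_Ioo]
  filter_upwards [this] with x hx hx'
  exact sub_eq_zero.1 (hx hx')

end IsWeakDeriv

/-! ### The fractional Sobolev spaces -/

/-- Real `L^p((a,b))`. -/
abbrev LpI (p : ℝ≥0∞) (a b : ℝ) : Type := Lp ℝ p (volume.restrict (Ioo a b))

theorem weakDeriv_unique {s : Side} {α : ℝ} {p : ℝ≥0∞} {a b : ℝ} {u v v' : LpI p a b}
    (h : IsWeakDeriv s α a b u v) (h' : IsWeakDeriv s α a b u v') : v = v' :=
  Lp.ext (h.unique h')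

/-- The set of all `u ∈ L^p((a,b))` that have a weak fractional derivative in `L^p((a,b))`,
as a linear subspace of `L^p((a,b))`. -/
def fracSubmodule (s : Side) (α : ℝ) [hα : Fact (α ∈ Ioo (0 : ℝ) 1)] (p : ℝ≥0∞) [Fact (1 ≤ p)]
    (a b : ℝ) : Submodule ℝ (LpI p a b) where
  carrier := {u | ∃ v : LpI p a b, IsWeakDeriv s α a b u v}
  zero_mem' := ⟨0, IsWeakDeriv.zero.congr (Lp.coeFn_zero _ _ _) (Lp.coeFn_zero _ _ _)⟩
  add_mem' := by
    rintro u u' ⟨v, h⟩ ⟨v', h'⟩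
    exact ⟨v + v', (h.add hα.out.2 h').congr (Lp.coeFn_add _ _) (Lp.coeFn_add _ _)⟩
  smul_mem' := by
    rintro c u ⟨v, h⟩
    exact ⟨c • v, (h.smul c).congr (Lp.coeFn_smul _ _) (Lp.coeFn_smul _ _)⟩

section

variable (s : Side) (α : ℝ) [hα : Fact (α ∈ Ioo (0 : ℝ) 1)] (p : ℝ≥0∞) [hp : Fact (1 ≤ p)]
  (a b : ℝ)

/-- The one-sided fractional Sobolev space of order `0 < α < 1` and exponent `1 ≤ p < ∞` on
`(a,b)`. It is a type of its own, because its norm is not the one of `L^p`. -/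
def FracSobolev : Type := ↥(fracSubmodule s α p a b)

instance : AddCommGroup (FracSobolev s α p a b) :=
  inferInstanceAs (AddCommGroup ↥(fracSubmodule s α p a b))

instance : Module ℝ (FracSobolev s α p a b) :=
  inferInstanceAs (Module ℝ ↥(fracSubmodule s α p a b))

/-- The inclusion of the one-sided space into `L^p((a,b))`. -/
def FracSobolev.toLp : FracSobolev s α p a b →ₗ[ℝ] LpI p a b :=
  (fracSubmodule s α p a b).subtype

theorem FracSobolev.toLp_injective : Function.Injective (FracSobolev.toLp s α p a b) :=
  Subtype.val_injective

/-- The weak fractional derivative on the one-sided space. -/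
def FracSobolev.weakDeriv : FracSobolev s α p a b →ₗ[ℝ] LpI p a b where
  toFun u := u.2.choose
  map_add' u w := weakDeriv_unique (u + w).2.choose_spec
    ((u.2.choose_spec.add hα.out.2 w.2.choose_spec).congr (Lp.coeFn_add _ _) (Lp.coeFn_add _ _))
  map_smul' c u := weakDeriv_unique (c • u).2.choose_spec
    ((u.2.choose_spec.smul c).congr (Lp.coeFn_smul _ _) (Lp.coeFn_smul _ _))

variable {s α p a b} in
theorem FracSobolev.isWeakDeriv (u : FracSobolev s α p a b) :
    IsWeakDeriv s α a b (FracSobolev.toLp s α p a b u) (FracSobolev.weakDeriv s α p a b u) :=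
  u.2.choose_spec

/-- The map `u ↦ (u, D^α u)` into the `ℓ^p`-product of two copies of `L^p((a,b))`. -/
def FracSobolev.toProd : FracSobolev s α p a b →ₗ[ℝ] WithLp p (LpI p a b × LpI p a b) :=
  (WithLp.linearEquiv p ℝ (LpI p a b × LpI p a b)).symm.toLinearMap ∘ₗ
    (FracSobolev.toLp s α p a b).prod (FracSobolev.weakDeriv s α p a b)

theorem FracSobolev.toProd_injective : Function.Injective (FracSobolev.toProd s α p a b) := by
  intro u w h
  exact FracSobolev.toLp_injective s α p a b
    (congrArg (fun z : WithLp p (LpI p a b × LpI p a b) => z.fst) h)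

/-- The norm `(‖u‖^p + ‖D^α u‖^p)^(1/p)`, see `FracSobolev.norm_def`. -/
instance : NormedAddCommGroup (FracSobolev s α p a b) :=
  NormedAddCommGroup.induced _ _ (FracSobolev.toProd s α p a b)
    (FracSobolev.toProd_injective s α p a b)

instance : NormedSpace ℝ (FracSobolev s α p a b) :=
  NormedSpace.induced ℝ _ _ (FracSobolev.toProd s α p a b)

variable {s α p a b} in
theorem FracSobolev.norm_def (hp' : p ≠ ⊤) (u : FracSobolev s α p a b) :
    ‖u‖ = (‖FracSobolev.toLp s α p a b u‖ ^ p.toReal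
      + ‖FracSobolev.weakDeriv s α p a b u‖ ^ p.toReal) ^ (1 / p.toReal) :=
  WithLp.prod_norm_eq_add (ENNReal.toReal_pos (zero_lt_one.trans_le hp.out).ne' hp') _

/-- The symmetric fractional Sobolev space: the intersection of the left and the right space,
with the norm given by `SymFracSobolev.norm_def`. -/
def SymFracSobolev : Type := ↥(fracSubmodule .left α p a b ⊓ fracSubmodule .right α p a b)

instance : AddCommGroup (SymFracSobolev α p a b) :=
  inferInstanceAs (AddCommGroup ↥(fracSubmodule .left α p a b ⊓ fracSubmodule .right α p a b))

instance : Module ℝ (SymFracSobolev α p a b) :=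
  inferInstanceAs (Module ℝ ↥(fracSubmodule .left α p a b ⊓ fracSubmodule .right α p a b))

/-- The inclusion of the symmetric space into `L^p((a,b))`. -/
def SymFracSobolev.toLp : SymFracSobolev α p a b →ₗ[ℝ] LpI p a b :=
  (fracSubmodule .left α p a b ⊓ fracSubmodule .right α p a b).subtype

/-- The inclusion of the symmetric space into the one-sided spaces. -/
def SymFracSobolev.toSide : SymFracSobolev α p a b →ₗ[ℝ] FracSobolev s α p a b :=
  match s with
  | .left => Submodule.inclusion inf_le_left
  | .right => Submodule.inclusion inf_le_right

/-- The map `u ↦ (u, u)` into the `ℓ^p`-product of the left and the right space. -/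
def SymFracSobolev.toProd : SymFracSobolev α p a b →ₗ[ℝ]
    WithLp p (FracSobolev .left α p a b × FracSobolev .right α p a b) :=
  (WithLp.linearEquiv p ℝ
    (FracSobolev .left α p a b × FracSobolev .right α p a b)).symm.toLinearMap ∘ₗ
    (SymFracSobolev.toSide .left α p a b).prod (SymFracSobolev.toSide .right α p a b)

theorem SymFracSobolev.toProd_injective : Function.Injective (SymFracSobolev.toProd α p a b) := by
  intro u w h
  have := congrArg (fun z : WithLp p (FracSobolev .left α p a b × FracSobolev .right α p a b) =>
    FracSobolev.toLp .left α p a b z.fst) h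
  exact Subtype.ext this

/-- The norm `(‖u‖₋^p + ‖u‖₊^p)^(1/p)`, see `SymFracSobolev.norm_def`. -/
instance : NormedAddCommGroup (SymFracSobolev α p a b) :=
  NormedAddCommGroup.induced _ _ (SymFracSobolev.toProd α p a b)
    (SymFracSobolev.toProd_injective α p a b)

instance : NormedSpace ℝ (SymFracSobolev α p a b) :=
  NormedSpace.induced ℝ _ _ (SymFracSobolev.toProd α p a b)

variable {α p a b} in
theorem SymFracSobolev.norm_def (hp' : p ≠ ⊤) (u : SymFracSobolev α p a b) :
    ‖u‖ = (‖SymFracSobolev.toSide .left α p a b u‖ ^ p.toReal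
      + ‖SymFracSobolev.toSide .right α p a b u‖ ^ p.toReal) ^ (1 / p.toReal) :=
  WithLp.prod_norm_eq_add (ENNReal.toReal_pos (zero_lt_one.trans_le hp.out).ne' hp') _

end

/-! ### One-sided traces and zero-trace spaces -/

/-- The half-closed interval up to whose closed end the functions of the one-sided space have a
continuous representative: `(a,b]` for the left space and `[a,b)` for the right space. -/
def Side.dom : Side → ℝ → ℝ → Set ℝ
  | .left, a, b => Ioc a b
  | .right, a, b => Ico a b

/-- The endpoint at which the one-sided trace is taken: `b` for the left space, `a` for the
right space. -/
def Side.endpoint : Side → ℝ → ℝ → ℝ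
  | .left, _, b => b
  | .right, a, _ => a

/-- The one-sided trace of `u` is `t`: the representative of `u` that is continuous up to the
endpoint has the value `t` there. -/
def HasTrace (s : Side) (a b : ℝ) (u : ℝ → ℝ) (t : ℝ) : Prop :=
  ∃ w : ℝ → ℝ, ContinuousOn w (s.dom a b) ∧ u =ᵐ[volume.restrict (Ioo a b)] w ∧
    w (s.endpoint a b) = t

/-- The one-sided trace is unique. -/
theorem HasTrace.unique {s : Side} {a b : ℝ} (hab : a < b) {u : ℝ → ℝ} {t t' : ℝ}
    (h : HasTrace s a b u t) (h' : HasTrace s a b u t') : t = t' := by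
  obtain ⟨w, hw, hu, rfl⟩ := h
  obtain ⟨w', hw', hu', rfl⟩ := h'
  have e := hu.symm.trans hu'
  cases s with
  | left =>
    rw [Measure.restrict_congr_set (Ioo_ae_eq_Ioc (μ := volume))] at e
    exact Measure.eqOn_of_ae_eq e hw hw'
      (by rw [interior_Ioc, closure_Ioo hab.ne]; exact Ioc_subset_Icc_self) ⟨hab, le_rfl⟩
  | right =>
    rw [Measure.restrict_congr_set (Ioo_ae_eq_Ico (μ := volume))] at e
    exact Measure.eqOn_of_ae_eq e hw hw'
      (by rw [interior_Ico, closure_Ioo hab.ne]; exact Ico_subset_Icc_self) ⟨le_rfl, hab⟩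

theorem HasTrace.zero {s : Side} {a b : ℝ} : HasTrace s a b 0 0 :=
  ⟨0, continuousOn_const, EventuallyEq.rfl, rfl⟩

theorem HasTrace.congr {s : Side} {a b : ℝ} {u u' : ℝ → ℝ} {t : ℝ} (h : HasTrace s a b u t)
    (e : u' =ᵐ[volume.restrict (Ioo a b)] u) : HasTrace s a b u' t := by
  obtain ⟨w, hw, hu, ht⟩ := h
  exact ⟨w, hw, e.trans hu, ht⟩

theorem HasTrace.add {s : Side} {a b : ℝ} {u u' : ℝ → ℝ} {t t' : ℝ} (h : HasTrace s a b u t)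
    (h' : HasTrace s a b u' t') : HasTrace s a b (u + u') (t + t') := by
  obtain ⟨w, hw, hu, rfl⟩ := h
  obtain ⟨w', hw', hu', rfl⟩ := h'
  exact ⟨w + w', hw.add hw', hu.add hu', rfl⟩

theorem HasTrace.smul {s : Side} {a b : ℝ} {u : ℝ → ℝ} {t : ℝ} (c : ℝ) (h : HasTrace s a b u t) :
    HasTrace s a b (c • u) (c * t) := by
  obtain ⟨w, hw, hu, rfl⟩ := h
  exact ⟨c • w, hw.const_smul c, hu.const_smul c, rfl⟩

/-- `φ` belongs, on `(a,b)`, to the space of smooth functions that vanish near the right endpoint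
(`left`) or near the left endpoint (`right`); there is no condition at the other endpoint. -/
def IsOneSidedTest : Side → ℝ → ℝ → (ℝ → ℝ) → Prop
  | .left, a, b, φ => ContDiffOn ℝ ∞ φ (Ioo a b) ∧ ∃ c ∈ Ioo a b, ∀ x ∈ Ioo a b, c < x → φ x = 0
  | .right, a, b, φ => ContDiffOn ℝ ∞ φ (Ioo a b) ∧ ∃ c ∈ Ioo a b, ∀ x ∈ Ioo a b, x < c → φ x = 0

theorem IsOneSidedTest.zero {s : Side} {a b : ℝ} (hab : a < b) : IsOneSidedTest s a b 0 := by
  have := nonempty_Ioo.2 hab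
  cases s <;> exact ⟨contDiffOn_const, this.choose, this.choose_spec, fun _ _ _ => rfl⟩

theorem IsOneSidedTest.add {s : Side} {a b : ℝ} {φ ψ : ℝ → ℝ} (h : IsOneSidedTest s a b φ)
    (h' : IsOneSidedTest s a b ψ) : IsOneSidedTest s a b (φ + ψ) := by
  cases s with
  | left =>
    obtain ⟨h1, c, hc, h2⟩ := h
    obtain ⟨h1', c', hc', h2'⟩ := h'
    refine ⟨h1.add h1', max c c', ⟨lt_max_of_lt_left hc.1, max_lt hc.2 hc'.2⟩, fun x hx hcx => ?_⟩
    rw [max_lt_iff] at hcx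
    simp [h2 x hx hcx.1, h2' x hx hcx.2]
  | right =>
    obtain ⟨h1, c, hc, h2⟩ := h
    obtain ⟨h1', c', hc', h2'⟩ := h'
    refine ⟨h1.add h1', min c c', ⟨lt_min hc.1 hc'.1, min_lt_of_left_lt hc.2⟩, fun x hx hcx => ?_⟩
    rw [lt_min_iff] at hcx
    simp [h2 x hx hcx.1, h2' x hx hcx.2]

theorem IsOneSidedTest.smul {s : Side} {a b : ℝ} {φ : ℝ → ℝ} (k : ℝ)
    (h : IsOneSidedTest s a b φ) : IsOneSidedTest s a b (k • φ) := by
  cases s <;>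
  · obtain ⟨h1, c, hc, h2⟩ := h
    exact ⟨h1.const_smul k, c, hc, fun x hx hcx => by simp [h2 x hx hcx]⟩

theorem IsTest.zero {a b : ℝ} : IsTest a b 0 :=
  ⟨contDiff_const, HasCompactSupport.zero, by simp [tsupport]⟩

theorem IsTest.add {a b : ℝ} {φ ψ : ℝ → ℝ} (h : IsTest a b φ) (h' : IsTest a b ψ) :
    IsTest a b (φ + ψ) :=
  ⟨h.smooth.add h'.smooth, h.compact.add h'.compact,
    (tsupport_add φ ψ).trans (union_subset h.supp h'.supp)⟩

theorem IsTest.smul {a b : ℝ} {φ : ℝ → ℝ} (k : ℝ) (h : IsTest a b φ) : IsTest a b (k • φ) :=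
  ⟨h.smooth.const_smul k, h.compact.smul_left (f := fun _ => k),
    (tsupport_smul_subset_right (fun _ => k) φ).trans h.supp⟩

section

variable (s : Side) (α : ℝ) [hα : Fact (α ∈ Ioo (0 : ℝ) 1)] (p : ℝ≥0∞) [hp : Fact (1 ≤ p)]
  {a b : ℝ} (hab : a < b)

/-- The one-sided space with zero one-sided trace. -/
def zeroTrace (a b : ℝ) : Submodule ℝ (FracSobolev s α p a b) where
  carrier := {u | HasTrace s a b (FracSobolev.toLp s α p a b u) 0}
  zero_mem' := by
    simp only [mem_ofPred_eq, map_zero]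
    exact HasTrace.zero.congr (Lp.coeFn_zero _ _ _)
  add_mem' := by
    intro u w hu hw
    simp only [mem_ofPred_eq, map_add] at *
    simpa using (hu.add hw).congr (Lp.coeFn_add _ _)
  smul_mem' := by
    intro c u hu
    simp only [mem_ofPred_eq, map_smul] at *
    simpa using (hu.smul c).congr (Lp.coeFn_smul _ _)

/-- The symmetric space with both one-sided traces equal to zero. -/
def symZeroTrace (a b : ℝ) : Submodule ℝ (SymFracSobolev α p a b) :=
  (zeroTrace .left α p a b).comap (SymFracSobolev.toSide .left α p a b) ⊓
    (zeroTrace .right α p a b).comap (SymFracSobolev.toSide .right α p a b)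

/-- The one-side-supported smooth functions that belong to the one-sided space. -/
def oneSidedTest : Submodule ℝ (FracSobolev s α p a b) where
  carrier := {u | ∃ φ : ℝ → ℝ, IsOneSidedTest s a b φ ∧
    FracSobolev.toLp s α p a b u =ᵐ[volume.restrict (Ioo a b)] φ}
  zero_mem' := ⟨0, IsOneSidedTest.zero hab, by rw [map_zero]; exact Lp.coeFn_zero _ _ _⟩
  add_mem' := by
    rintro u w ⟨φ, h1, h2⟩ ⟨ψ, h1', h2'⟩
    exact ⟨φ + ψ, h1.add h1', by rw [map_add]; exact (Lp.coeFn_add _ _).trans (h2.add h2')⟩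
  smul_mem' := by
    rintro c u ⟨φ, h1, h2⟩
    exact ⟨c • φ, h1.smul c, by rw [map_smul]; exact (Lp.coeFn_smul _ _).trans (h2.const_smul c)⟩

/-- `C₀^∞((a,b))` as a subspace of the symmetric space. -/
def symTest (a b : ℝ) : Submodule ℝ (SymFracSobolev α p a b) where
  carrier := {u | ∃ φ : ℝ → ℝ, IsTest a b φ ∧
    SymFracSobolev.toLp α p a b u =ᵐ[volume.restrict (Ioo a b)] φ}
  zero_mem' := ⟨0, IsTest.zero, by rw [map_zero]; exact Lp.coeFn_zero _ _ _⟩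
  add_mem' := by
    rintro u w ⟨φ, h1, h2⟩ ⟨ψ, h1', h2'⟩
    exact ⟨φ + ψ, h1.add h1', by rw [map_add]; exact (Lp.coeFn_add _ _).trans (h2.add h2')⟩
  smul_mem' := by
    rintro c u ⟨φ, h1, h2⟩
    exact ⟨c • φ, h1.smul c, by rw [map_smul]; exact (Lp.coeFn_smul _ _).trans (h2.const_smul c)⟩

end

/-- The completion of `V` in the norm of the ambient space `E` equals the subspace `W` of `E`:
`W` is the closure of `V` in `E`, and the inclusion of `V` into `W` extends to a linear isometric
isomorphism of the abstract completion of `V` onto `W` (so that `W` is complete). -/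
def IsCompletion {E : Type*} [NormedAddCommGroup E] [NormedSpace ℝ E] (V W : Submodule ℝ E) :
    Prop :=
  V.topologicalClosure = W ∧
    ∃ e : UniformSpace.Completion V ≃ₗᵢ[ℝ] W, ∀ v : V, (e (v : UniformSpace.Completion V) : E) = v

end FracSob

end

noncomputable section

namespace FracSob

/-! ### The semigroup law for fractional integrals -/

/-- The kernel of the composition of two left fractional integrals. -/
def betaKernel (β γ x y z : ℝ) : ℝ :=
  if z < y ∧ y < x then (x - y) ^ (β - 1) * (y - z) ^ (γ - 1) else 0

theorem betaKernel_eq {β γ x y z : ℝ} (hβ : 0 < β) (hγ : 0 < γ) (h : z < x) :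
    betaKernel β γ x y z = ProbabilityTheory.beta γ β * (x - z) ^ (β + γ - 1) * (x - z)⁻¹ *
      ProbabilityTheory.betaPDFReal γ β ((y - z) / (x - z)) := by
  have hxz : 0 < x - z := sub_pos.2 h
  have hb := (ProbabilityTheory.beta_pos hγ hβ).ne'
  unfold betaKernel ProbabilityTheory.betaPDFReal
  have e : (z < y ∧ y < x) ↔ (0 < (y - z) / (x - z) ∧ (y - z) / (x - z) < 1) := by
    rw [div_lt_one hxz, div_pos_iff_of_pos_right hxz, sub_pos, sub_lt_sub_iff_right]
  by_cases hy : z < y ∧ y < x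
  · rw [if_pos hy, if_pos (e.1 hy)]
    have h1 : 1 - (y - z) / (x - z) = (x - y) / (x - z) := by field_simp; ring
    rw [h1, Real.div_rpow (sub_pos.2 hy.1).le hxz.le, Real.div_rpow (sub_pos.2 hy.2).le hxz.le]
    have h2 : (x - z) ^ (β + γ - 1) = (x - z) ^ (β - 1) * (x - z) ^ (γ - 1) * (x - z) := by
      rw [← Real.rpow_add hxz, ← Real.rpow_add_one hxz.ne']; congr 1; ring
    rw [h2]
    have := (Real.rpow_pos_of_pos hxz (β - 1)).ne'
    have := (Real.rpow_pos_of_pos hxz (γ - 1)).ne'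
    field_simp
  · rw [if_neg hy, if_neg (fun h => hy (e.2 h)), mul_zero]

theorem betaKernel_eq_zero {β γ x y z : ℝ} (h : x ≤ z) : betaKernel β γ x y z = 0 :=
  if_neg fun h' => (h'.1.trans h'.2).not_ge h

theorem betaKernel_nonneg (β γ x y z : ℝ) : 0 ≤ betaKernel β γ x y z := by
  unfold betaKernel
  split_ifs with h
  · have := sub_pos.2 h.1
    have := sub_pos.2 h.2
    positivity
  · exact le_rfl

theorem integrable_betaPDFReal {β γ : ℝ} (hβ : 0 < β) (hγ : 0 < γ) :
    Integrable (ProbabilityTheory.betaPDFReal β γ) ∧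
      ∫ x, ProbabilityTheory.betaPDFReal β γ x = 1 := by
  have h0 : 0 ≤ᵐ[volume] ProbabilityTheory.betaPDFReal β γ := by
    refine Eventually.of_forall fun x => ?_
    unfold ProbabilityTheory.betaPDFReal
    have := ProbabilityTheory.beta_pos hβ hγ
    dsimp
    split_ifs with h
    · have := sub_pos.2 h.2
      have := h.1
      positivity
    · exact le_rfl
  have h1 := ProbabilityTheory.lintegral_betaPDF_eq_one hβ hγ
  have hm := (ProbabilityTheory.stronglyMeasurable_betaPDFReal β γ).aestronglyMeasurable
    (μ := volume)
  have h2 : ∫⁻ x, ENNReal.ofReal (ProbabilityTheory.betaPDFReal β γ x) = 1 := h1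
  refine ⟨⟨hm, ?_⟩, ?_⟩
  · rw [hasFiniteIntegral_iff_ofReal h0, h2]; exact ENNReal.one_lt_top
  · rw [integral_eq_lintegral_of_nonneg_ae h0 hm, h2]; rfl

theorem integrable_betaKernel {β γ : ℝ} (hβ : 0 < β) (hγ : 0 < γ) (x z : ℝ) :
    Integrable (fun y => betaKernel β γ x y z) := by
  rcases le_or_gt x z with h | h
  · simp [betaKernel_eq_zero h]
  · simp only [betaKernel_eq hβ hγ h]
    exact (((integrable_betaPDFReal hγ hβ).1.comp_div (sub_pos.2 h).ne').comp_sub_right z).const_mul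
      _

theorem integral_betaKernel {β γ x z : ℝ} (hβ : 0 < β) (hγ : 0 < γ) (h : z < x) :
    ∫ y, betaKernel β γ x y z = ProbabilityTheory.beta γ β * (x - z) ^ (β + γ - 1) := by
  have hxz : 0 < x - z := sub_pos.2 h
  simp only [betaKernel_eq hβ hγ h]
  rw [integral_const_mul, integral_sub_right_eq_self (fun y =>
    ProbabilityTheory.betaPDFReal γ β (y / (x - z))), Measure.integral_comp_div,
    (integrable_betaPDFReal hγ hβ).2, abs_of_pos hxz]
  simp
  field_simp

theorem measurable_betaKernel (β γ x : ℝ) :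
    Measurable (fun q : ℝ × ℝ => betaKernel β γ x q.1 q.2) := by
  unfold betaKernel
  refine Measurable.ite ?_ (by fun_prop) (by fun_prop)
  exact (measurableSet_lt measurable_snd measurable_fst).inter
    (measurableSet_lt measurable_fst measurable_const)

/-- The semigroup law for left fractional integrals. -/
theorem fracIntegral_left_comp {β γ : ℝ} (hβ : 0 < β) (hγ : 0 < γ) {f : ℝ → ℝ} {x : ℝ}
    (hf : AEStronglyMeasurable f)
    (hi : IntegrableOn (fun z => (x - z) ^ (β + γ - 1) * f z) (Iio x)) :
    fracIntegral .left β (fracIntegral .left γ f) x = fracIntegral .left (β + γ) f x := by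
  have hI : ∀ z, (∫ y, betaKernel β γ x y z) * f z =
      ProbabilityTheory.beta γ β * (Iio x).indicator (fun z => (x - z) ^ (β + γ - 1) * f z) z := by
    intro z
    rcases lt_or_ge z x with h | h
    · rw [integral_betaKernel hβ hγ h, indicator_of_mem (mem_Iio.2 h)]; ring
    · rw [indicator_of_notMem (notMem_Iio.2 h)]; simp [betaKernel_eq_zero h]
  have hint : Integrable (fun q : ℝ × ℝ => betaKernel β γ x q.1 q.2 * f q.2)
      (volume.prod volume) := by
    refine (integrable_prod_iff' (f := fun q : ℝ × ℝ => betaKernel β γ x q.1 q.2 * f q.2)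
      ((measurable_betaKernel β γ x).aestronglyMeasurable.mul hf.comp_snd)).2 ⟨Eventually.of_forall fun z => (integrable_betaKernel hβ hγ x z).mul_const (f z), ?_⟩
    have : (fun z => ∫ y, ‖betaKernel β γ x y z * f z‖) = fun z => ‖ProbabilityTheory.beta γ β *
        (Iio x).indicator (fun z => (x - z) ^ (β + γ - 1) * f z) z‖ := by
      ext z
      rw [← hI z, norm_mul, Real.norm_of_nonneg (integral_nonneg fun y =>
        betaKernel_nonneg β γ x y z), ← integral_mul_const]
      simp only [norm_mul, Real.norm_of_nonneg (betaKernel_nonneg _ _ _ _ _)]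
    simp only [this]
    exact ((integrable_indicator_iff measurableSet_Iio).2 hi |>.const_mul _).norm
  have hswap := integral_integral_swap (f := fun y z => betaKernel β γ x y z * f z) hint
  simp only [fracIntegral]
  rw [← integral_indicator measurableSet_Iio (μ := volume) (f := fun z =>
    (x - z) ^ (β + γ - 1) * f z)]
  have hL : ∫ y in Iio x, (x - y) ^ (β - 1) * (1 / Real.Gamma γ * ∫ z in Iio y,
      (y - z) ^ (γ - 1) * f z) = 1 / Real.Gamma γ * ∫ y, ∫ z, betaKernel β γ x y z * f z := by
    rw [← integral_const_mul, ← integral_indicator measurableSet_Iio]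
    congr 1
    ext y
    by_cases hy : y < x
    · rw [indicator_of_mem (mem_Iio.2 hy), mul_left_comm, ← integral_const_mul,
        ← integral_indicator measurableSet_Iio]
      congr 2
      ext z
      by_cases hz : z < y <;> simp [betaKernel, hz, hy, mul_assoc]
    · simp [hy, betaKernel]
  rw [hL, hswap]
  simp only [integral_mul_const, hI]
  rw [integral_const_mul, ProbabilityTheory.beta, add_comm γ β]
  have := (Real.Gamma_pos_of_pos hβ).ne'
  have := (Real.Gamma_pos_of_pos hγ).ne'
  have := (Real.Gamma_pos_of_pos (add_pos hβ hγ)).ne'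
  field_simp

/-! ### Reflection, the convolution form, and the adjoint relation -/

/-- The kernel `t₊^(β - 1)` of the Riemann-Liouville integral. -/
def rlKernel (β : ℝ) : ℝ → ℝ := (Ioi 0).indicator fun t => t ^ (β - 1)

theorem rlKernel_of_pos {β t : ℝ} (ht : 0 < t) : rlKernel β t = t ^ (β - 1) :=
  indicator_of_mem (mem_Ioi.2 ht) _

theorem rlKernel_of_nonpos {β t : ℝ} (ht : t ≤ 0) : rlKernel β t = 0 :=
  indicator_of_notMem (notMem_Ioi.2 ht) _

theorem rlKernel_nonneg (β t : ℝ) : 0 ≤ rlKernel β t :=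
  indicator_nonneg (fun _ hs => Real.rpow_nonneg (le_of_lt hs) _) t

@[fun_prop]
theorem measurable_rlKernel (β : ℝ) : Measurable (rlKernel β) :=
  (by fun_prop : Measurable fun t : ℝ => t ^ (β - 1)).indicator measurableSet_Ioi

theorem locallyIntegrable_rlKernel {β : ℝ} (hβ : 0 < β) : LocallyIntegrable (rlKernel β) := by
  refine locallyIntegrable_of_norm_le_rpow (C := 1) (by simp) (α := 1 - β) (by simpa using hβ)
    (Eventually.of_forall fun x => ?_) (measurable_rlKernel β).aestronglyMeasurable
  rcases lt_or_ge 0 x with hx | hx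
  · rw [rlKernel_of_pos hx, Real.norm_eq_abs, Real.norm_eq_abs, abs_of_pos hx,
      abs_of_pos (Real.rpow_pos_of_pos hx _)]
    simp
  · rw [rlKernel_of_nonpos hx]; simp; positivity

theorem fracIntegral_left_eq (β : ℝ) (f : ℝ → ℝ) (x : ℝ) :
    fracIntegral .left β f x = (1 / Real.Gamma β) * ∫ y, rlKernel β (x - y) * f y := by
  rw [fracIntegral, ← integral_indicator measurableSet_Iio]
  congr 2
  ext y
  by_cases hy : y < x <;> simp [rlKernel, indicator, hy]

theorem fracIntegral_right_eq (β : ℝ) (f : ℝ → ℝ) (x : ℝ) :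
    fracIntegral .right β f x = (1 / Real.Gamma β) * ∫ y, rlKernel β (y - x) * f y := by
  rw [fracIntegral, ← integral_indicator measurableSet_Ioi]
  congr 2
  ext y
  by_cases hy : x < y <;> simp [rlKernel, indicator, hy]

theorem fracIntegral_right_eq_left (β : ℝ) (f : ℝ → ℝ) (x : ℝ) :
    fracIntegral .right β f x = fracIntegral .left β (fun y => f (-y)) (-x) := by
  rw [fracIntegral_right_eq, fracIntegral_left_eq, ← integral_neg_eq_self]
  congr 3
  ext y
  ring_nf

theorem rlDeriv_right_eq_left (α : ℝ) (f : ℝ → ℝ) (x : ℝ) :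
    rlDeriv .right α f x = rlDeriv .left α (fun y => f (-y)) (-x) := by
  have : fracIntegral .right (1 - α) f =
      fun x => fracIntegral .left (1 - α) (fun y => f (-y)) (-x) :=
    funext fun x => fracIntegral_right_eq_left _ _ _
  rw [rlDeriv, rlDeriv, this, deriv_comp_neg (f := fracIntegral .left (1 - α) fun y => f (-y)),
    neg_neg]

theorem rlDeriv_left_eq_right (α : ℝ) (f : ℝ → ℝ) (x : ℝ) :
    rlDeriv .left α f x = rlDeriv .right α (fun y => f (-y)) (-x) := by
  rw [rlDeriv_right_eq_left]; simp

theorem hasDerivAt_fracIntegral_left {β : ℝ} (hβ : 0 < β) {φ : ℝ → ℝ} (h1 : ContDiff ℝ ∞ φ)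
    (h2 : HasCompactSupport φ) (x : ℝ) :
    HasDerivAt (fracIntegral .left β φ) (fracIntegral .left β (deriv φ) x) x := by
  have e : ∀ f : ℝ → ℝ, fracIntegral .left β f = fun x => (1 / Real.Gamma β) *
      (convolution (rlKernel β) f (ContinuousLinearMap.mul ℝ ℝ) volume) x := by
    intro f
    ext x
    rw [fracIntegral_left_eq, ← integral_sub_left_eq_self _ volume x]
    simp [convolution]
  rw [e φ, e (deriv φ)]
  exact (h2.hasDerivAt_convolution_right (ContinuousLinearMap.mul ℝ ℝ)
    (locallyIntegrable_rlKernel hβ) (h1.of_le (by simp)) x).const_mul _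

theorem rlDeriv_left_eq {α : ℝ} (hα : α < 1) {φ : ℝ → ℝ} (h1 : ContDiff ℝ ∞ φ)
    (h2 : HasCompactSupport φ) (x : ℝ) :
    rlDeriv .left α φ x = fracIntegral .left (1 - α) (deriv φ) x :=
  (hasDerivAt_fracIntegral_left (sub_pos.2 hα) h1 h2 x).deriv

theorem hasCompactSupport_comp_neg {φ : ℝ → ℝ} (h : HasCompactSupport φ) :
    HasCompactSupport fun x => φ (-x) :=
  h.comp_homeomorph (Homeomorph.neg ℝ)

theorem rlDeriv_right_eq {α : ℝ} (hα : α < 1) {φ : ℝ → ℝ} (h1 : ContDiff ℝ ∞ φ)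
    (h2 : HasCompactSupport φ) (x : ℝ) :
    rlDeriv .right α φ x = -fracIntegral .right (1 - α) (deriv φ) x := by
  rw [rlDeriv_right_eq_left, rlDeriv_left_eq (φ := fun y => φ (-y)) hα (h1.comp contDiff_neg)
    (hasCompactSupport_comp_neg h2), fracIntegral_right_eq_left, fracIntegral_left_eq,
    fracIntegral_left_eq, ← mul_neg, ← integral_neg]
  congr 3
  ext y
  rw [deriv_comp_neg (f := φ)]
  ring

theorem integrable_rlKernel_mul {β : ℝ} (hβ : 0 < β) {ψ : ℝ → ℝ} (hψ : Continuous ψ)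
    (hc : HasCompactSupport ψ) (x : ℝ) : Integrable fun y => rlKernel β (y - x) * ψ y := by
  have := (locallyIntegrable_rlKernel hβ).integrable_smul_right_of_hasCompactSupport
    (hψ.comp (continuous_add_const x)) (hc.comp_homeomorph (Homeomorph.addRight x))
  simpa [mul_comm] using this.comp_sub_right x

theorem exists_integral_rlKernel_mul_le {β : ℝ} (hβ : 0 < β) (hβ1 : β ≤ 1) {ψ : ℝ → ℝ}
    (hψ : Continuous ψ) (hc : HasCompactSupport ψ) :
    ∃ C, ∀ x, ∫ y, rlKernel β (y - x) * |ψ y| ≤ C := by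
  obtain ⟨M, hM⟩ := hc.exists_bound_of_continuous hψ
  have hM0 : 0 ≤ M := (norm_nonneg _).trans (hM 0)
  have hk : Integrable ((Ioo (0 : ℝ) 1).indicator (rlKernel β)) :=
    (integrable_indicator_iff measurableSet_Ioo).2
      ((locallyIntegrable_rlKernel hβ).integrableOn_isCompact isCompact_Icc |>.mono_set
        Ioo_subset_Icc_self)
  refine ⟨∫ y, (M * (Ioo (0 : ℝ) 1).indicator (rlKernel β) y + |ψ y|), fun x => ?_⟩
  have hψi : Integrable fun y => |ψ y| := (hψ.integrable_of_hasCompactSupport hc).abs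
  have e : ∫ y, (M * (Ioo (0 : ℝ) 1).indicator (rlKernel β) y + |ψ y|) =
      ∫ y, (M * (Ioo (0 : ℝ) 1).indicator (rlKernel β) (y - x) + |ψ y|) := by
    rw [integral_add (hk.const_mul M) hψi,
      integral_add ((hk.comp_sub_right x).const_mul M) hψi, integral_sub_right_eq_self
        (fun y => M * (Ioo (0 : ℝ) 1).indicator (rlKernel β) y)]
  rw [e]
  refine integral_mono (integrable_rlKernel_mul hβ hψ.abs hc.abs x)
    (((hk.comp_sub_right x).const_mul M).add hψi) fun y => ?_
  dsimp only
  rcases le_or_gt (y - x) 0 with h | h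
  · rw [rlKernel_of_nonpos h, zero_mul]
    have := indicator_nonneg (s := Ioo (0 : ℝ) 1) (fun t _ => rlKernel_nonneg β t) (y - x)
    positivity
  · rcases lt_or_ge (y - x) 1 with h' | h'
    · rw [indicator_of_mem (show y - x ∈ Ioo (0 : ℝ) 1 from ⟨h, h'⟩), mul_comm]
      have := mul_le_mul_of_nonneg_right (hM y) (rlKernel_nonneg β (y - x))
      rw [Real.norm_eq_abs] at this
      linarith [abs_nonneg (ψ y)]
    · rw [indicator_of_notMem (fun h'' => h'.not_gt h''.2), rlKernel_of_pos h]
      have := Real.rpow_le_one_of_one_le_of_nonpos h' (by linarith : β - 1 ≤ 0)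
      nlinarith [abs_nonneg (ψ y)]

theorem integrable_rlKernel_prod {β : ℝ} (hβ : 0 < β) (hβ1 : β ≤ 1) {f ψ : ℝ → ℝ}
    (hf : Integrable f) (hψ : Continuous ψ) (hc : HasCompactSupport ψ) :
    Integrable (fun q : ℝ × ℝ => f q.1 * (rlKernel β (q.2 - q.1) * ψ q.2))
      (volume.prod volume) := by
  have hm : AEStronglyMeasurable (fun q : ℝ × ℝ => f q.1 * (rlKernel β (q.2 - q.1) * ψ q.2))
      (volume.prod volume) :=
    hf.aestronglyMeasurable.comp_fst.mul (Measurable.aestronglyMeasurable (by fun_prop))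
  refine (integrable_prod_iff hm).2 ⟨Eventually.of_forall fun x =>
    (integrable_rlKernel_mul hβ hψ hc x).const_mul (f x), ?_⟩
  obtain ⟨C, hC⟩ := exists_integral_rlKernel_mul_le hβ hβ1 hψ hc
  refine Integrable.mono' (hf.abs.mul_const C) hm.norm.integral_prod_right'
    (Eventually.of_forall fun x => ?_)
  rw [Real.norm_of_nonneg (by positivity)]
  simp only [norm_mul, Real.norm_eq_abs, abs_of_nonneg (rlKernel_nonneg _ _)]
  rw [integral_const_mul]
  exact mul_le_mul_of_nonneg_left (hC x) (abs_nonneg _)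

/-- The left and the right fractional integral are adjoint to each other. -/
theorem integral_mul_fracIntegral_right {β : ℝ} (hβ : 0 < β) (hβ1 : β ≤ 1) {f ψ : ℝ → ℝ}
    (hf : Integrable f) (hψ : Continuous ψ) (hc : HasCompactSupport ψ) :
    ∫ x, f x * fracIntegral .right β ψ x = ∫ y, fracIntegral .left β f y * ψ y := by
  have := integral_integral_swap (f := fun x y => f x * (rlKernel β (y - x) * ψ y))
    (integrable_rlKernel_prod hβ hβ1 hf hψ hc)
  simp only [fracIntegral_left_eq, fracIntegral_right_eq]
  simp only [mul_left_comm (f _) (1 / Real.Gamma β), mul_assoc (1 / Real.Gamma β)]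
  rw [integral_const_mul, integral_const_mul]
  congr 1
  simp only [← integral_const_mul, ← integral_mul_const]
  rw [this]
  congr 2
  ext y
  congr 1
  ext x
  ring

theorem integrable_fracIntegral_left_mul {β : ℝ} (hβ : 0 < β) (hβ1 : β ≤ 1) {f ψ : ℝ → ℝ}
    (hf : Integrable f) (hψ : Continuous ψ) (hc : HasCompactSupport ψ) :
    Integrable fun y => fracIntegral .left β f y * ψ y := by
  have := (integrable_rlKernel_prod hβ hβ1 hf hψ hc).integral_prod_right.const_mul
    (1 / Real.Gamma β)
  refine this.congr (Eventually.of_forall fun y => ?_)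
  dsimp only
  rw [fracIntegral_left_eq, mul_assoc, ← integral_mul_const]
  congr 2
  ext x
  ring

theorem locallyIntegrable_fracIntegral_left {β : ℝ} (hβ : 0 < β) (hβ1 : β ≤ 1) {f : ℝ → ℝ}
    (hf : Integrable f) : LocallyIntegrable (fracIntegral .left β f) := by
  rw [locallyIntegrable_iff]
  intro k hk
  obtain ⟨ψ, hs, -, h2, -⟩ := exists_continuous_one_zero_of_isCompact hk isClosed_empty
    (disjoint_empty k)
  have := (integrable_fracIntegral_left_mul hβ hβ1 hf ψ.continuous h2).integrableOn (s := k)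
  refine this.congr_fun (fun x hx => ?_) hk.measurableSet
  simp [hs hx]

/-! ### Primitives and the lemma of du Bois-Reymond -/

theorem fracIntegral_left_one (f : ℝ → ℝ) (x : ℝ) : fracIntegral .left 1 f x = ∫ y in Iio x, f y := by
  simp [fracIntegral]

theorem fracIntegral_right_one_deriv {φ : ℝ → ℝ} (h1 : ContDiff ℝ 1 φ) (h2 : HasCompactSupport φ)
    (x : ℝ) : fracIntegral .right 1 (deriv φ) x = -φ x := by
  simp [fracIntegral, h2.integral_Ioi_deriv_eq h1 x]

/-- Integration by parts against the primitive of an integrable function. -/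
theorem integral_primitive_mul_deriv {v φ : ℝ → ℝ} (hv : Integrable v) (h1 : ContDiff ℝ 1 φ)
    (h2 : HasCompactSupport φ) :
    ∫ x, fracIntegral .left 1 v x * deriv φ x = -∫ x, v x * φ x := by
  rw [← integral_mul_fracIntegral_right one_pos le_rfl hv (h1.continuous_deriv le_rfl) h2.deriv,
    ← integral_neg]
  simp only [fracIntegral_right_one_deriv h1 h2, mul_neg]

theorem exists_Icc_of_isCompact_subset_Ioo {a b : ℝ} (hab : a < b) {k : Set ℝ} (hk : IsCompact k)
    (h : k ⊆ Ioo a b) : ∃ c d, a < c ∧ c ≤ d ∧ d < b ∧ k ⊆ Icc c d := by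
  rcases k.eq_empty_or_nonempty with rfl | hne
  · obtain ⟨c, hc⟩ := nonempty_Ioo.2 hab
    exact ⟨c, c, hc.1, le_rfl, hc.2, empty_subset _⟩
  · obtain ⟨c, hc, hc'⟩ := hk.exists_isLeast hne
    obtain ⟨d, hd, hd'⟩ := hk.exists_isGreatest hne
    exact ⟨c, d, (h hc).1, hc' hd, (h hd).2, fun x hx => ⟨hc' hx, hd' hx⟩⟩

theorem IsTest.exists_Icc {a b : ℝ} (hab : a < b) {φ : ℝ → ℝ} (h : IsTest a b φ) :
    ∃ c d, a < c ∧ c ≤ d ∧ d < b ∧ ∀ x, φ x ≠ 0 → x ∈ Icc c d := by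
  obtain ⟨c, d, hc, hcd, hd, hs⟩ := exists_Icc_of_isCompact_subset_Ioo hab h.compact h.supp
  exact ⟨c, d, hc, hcd, hd, fun x hx => hs (subset_tsupport φ hx)⟩

theorem isTest_of_Icc {a b c d : ℝ} {φ : ℝ → ℝ} (h1 : ContDiff ℝ ∞ φ) (hc : a < c) (hd : d < b)
    (h : ∀ x, φ x ≠ 0 → x ∈ Icc c d) : IsTest a b φ := by
  have : tsupport φ ⊆ Icc c d := closure_minimal h isClosed_Icc
  exact ⟨h1, HasCompactSupport.of_support_subset_isCompact isCompact_Icc h,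
    this.trans (Icc_subset_Ioo hc hd)⟩

theorem IsTest.deriv {a b : ℝ} {φ : ℝ → ℝ} (h : IsTest a b φ) : IsTest a b (deriv φ) :=
  ⟨h.smooth.deriv', h.compact.deriv, tsupport_deriv_subset.trans h.supp⟩

theorem IsTest.eq_zero_of_notMem {a b : ℝ} {φ : ℝ → ℝ} (h : IsTest a b φ) {x : ℝ}
    (hx : x ∉ Ioo a b) : φ x = 0 :=
  image_eq_zero_of_notMem_tsupport fun h' => hx (h.supp h')

theorem IsTest.setIntegral_mul {a b : ℝ} {φ : ℝ → ℝ} (h : IsTest a b φ) (f : ℝ → ℝ) :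
    ∫ x in Ioo a b, f x * φ x = ∫ x, f x * φ x :=
  setIntegral_eq_integral_of_forall_compl_eq_zero fun x hx => by simp [h.eq_zero_of_notMem hx]

/-- A test function with zero mean is the derivative of a test function. -/
theorem IsTest.exists_primitive {a b : ℝ} (hab : a < b) {χ : ℝ → ℝ} (h : IsTest a b χ)
    (h0 : ∫ x, χ x = 0) : ∃ φ, IsTest a b φ ∧ _root_.deriv φ = χ := by
  obtain ⟨c, d, hc, hcd, hd, hs⟩ := h.exists_Icc hab
  refine ⟨fracIntegral .left 1 χ, isTest_of_Icc (contDiff_fracIntegral .left one_pos h.smooth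
    h.compact) hc hd fun x hx => ?_, ?_⟩
  · rw [fracIntegral_left_one] at hx
    by_contra hx'
    apply hx
    rw [mem_Icc, not_and_or, not_le, not_le] at hx'
    rcases hx' with hx' | hx'
    · refine setIntegral_eq_zero_of_forall_eq_zero fun y hy => ?_
      by_contra hy'
      exact absurd (hs y hy').1 (not_le.2 ((mem_Iio.1 hy).trans hx'))
    · rw [← h0]
      refine setIntegral_eq_integral_of_forall_compl_eq_zero fun y hy => ?_
      by_contra hy'
      exact hy ((hs y hy').2.trans_lt hx')
  · ext x
    rw [(hasDerivAt_fracIntegral_left one_pos h.smooth h.compact x).deriv, fracIntegral_left_one,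
      ← integral_Iic_eq_integral_Iio,
      h.compact.integral_Iic_deriv_eq (h.smooth.of_le (by simp)) x]

theorem exists_isTest_integral_one {a b : ℝ} (hab : a < b) :
    ∃ ρ, IsTest a b ρ ∧ ∫ x, ρ x = 1 := by
  set B : ContDiffBump ((a + b) / 2) := ⟨(b - a) / 8, (b - a) / 4, by linarith, by linarith⟩
  refine ⟨B.normed volume, isTest_of_Icc (c := (a + b) / 2 - (b - a) / 4)
    (d := (a + b) / 2 + (b - a) / 4) B.contDiff_normed (by linarith) (by linarith) fun x hx => ?_,
    B.integral_normed⟩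
  have : x ∈ Function.support (B.normed volume) := hx
  rw [B.support_normed_eq, Real.ball_eq_Ioo] at this
  exact Ioo_subset_Icc_self this

/-- A function that annihilates the test functions vanishes almost everywhere. -/
theorem ae_eq_zero_of_integral_test {a b : ℝ} {w : ℝ → ℝ} (hw : LocallyIntegrableOn w (Ioo a b))
    (h : ∀ φ, IsTest a b φ → ∫ x, w x * φ x = 0) : w =ᵐ[volume.restrict (Ioo a b)] 0 := by
  have := isOpen_Ioo.ae_eq_zero_of_integral_contDiff_smul_eq_zero hw (μ := volume)
    (fun φ h1 h2 h3 => by simpa [mul_comm] using h φ ⟨h1, h2, h3⟩)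
  rw [EventuallyEq, ae_restrict_iff' measurableSet_Ioo]
  exact this

/-- The lemma of du Bois-Reymond. -/
theorem ae_eq_const_of_integral_deriv {a b : ℝ} (hab : a < b) {w : ℝ → ℝ}
    (hw : LocallyIntegrable w)
    (h : ∀ φ, IsTest a b φ → ∫ x, w x * deriv φ x = 0) :
    ∃ c : ℝ, w =ᵐ[volume.restrict (Ioo a b)] fun _ => c := by
  obtain ⟨ρ, hρ, hρ1⟩ := exists_isTest_integral_one hab
  have hi : ∀ {φ : ℝ → ℝ}, IsTest a b φ → Integrable fun x => w x * φ x := fun {φ} hφ => by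
    simpa [mul_comm] using hw.integrable_smul_left_of_hasCompactSupport hφ.smooth.continuous
      hφ.compact
  set c := ∫ x, w x * ρ x
  refine ⟨c, ?_⟩
  have : (fun x => w x - c) =ᵐ[volume.restrict (Ioo a b)] 0 := by
    refine ae_eq_zero_of_integral_test ((hw.sub (locallyIntegrable_const c)).locallyIntegrableOn _)
      fun ψ hψ => ?_
    obtain ⟨φ, hφ, hφ'⟩ := (hψ.add (hρ.smul (-∫ x, ψ x))).exists_primitive hab (by
      simp only [Pi.add_apply, Pi.smul_apply, smul_eq_mul]
      rw [integral_add (hψ.smooth.continuous.integrable_of_hasCompactSupport hψ.compact)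
        ((hρ.smooth.continuous.integrable_of_hasCompactSupport hρ.compact).const_mul _),
        integral_const_mul, hρ1]
      ring)
    have e := h φ hφ
    rw [hφ'] at e
    have e1 : ∀ x, w x * (ψ + (-∫ x, ψ x) • ρ) x = w x * ψ x - (∫ x, ψ x) * (w x * ρ x) := by
      intro x; simp; ring
    simp only [e1] at e
    rw [integral_sub (hi hψ) ((hi hρ).const_mul _), integral_const_mul] at e
    simp only [sub_mul]
    rw [integral_sub (hi hψ) ((hψ.smooth.continuous.integrable_of_hasCompactSupport
      hψ.compact).const_mul _), integral_const_mul]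
    linarith
  filter_upwards [this] with x hx
  exact sub_eq_zero.1 hx

/-! ### Representation of functions with an integrable weak fractional derivative -/

theorem integrable_rlKernel_mul_of_bdd {β : ℝ} (hβ : 0 < β) {g : ℝ → ℝ} {a C : ℝ}
    (hg : AEStronglyMeasurable g) (hC : ∀ y, |g y| ≤ C) (h0 : ∀ y < a, g y = 0) (x : ℝ) :
    Integrable fun y => rlKernel β (x - y) * g y := by
  have h1 : Integrable ((Icc 0 (x - a)).indicator (rlKernel β)) :=
    (integrable_indicator_iff measurableSet_Icc).2
      ((locallyIntegrable_rlKernel hβ).integrableOn_isCompact isCompact_Icc)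
  refine ((h1.comp_sub_left x).const_mul C).mono'
    ((Measurable.aestronglyMeasurable (by fun_prop)).mul hg) (Eventually.of_forall fun y => ?_)
  have hC0 : 0 ≤ C := (abs_nonneg _).trans (hC y)
  have hp : 0 ≤ C * (Icc 0 (x - a)).indicator (rlKernel β) (x - y) :=
    mul_nonneg hC0 (indicator_nonneg (fun t _ => rlKernel_nonneg β t) _)
  rw [norm_mul, Real.norm_of_nonneg (rlKernel_nonneg _ _), Real.norm_eq_abs]
  rcases lt_or_ge y a with hy | hy
  · rw [h0 y hy, abs_zero, mul_zero]; exact hp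
  · rcases le_or_gt (x - y) 0 with hxy | hxy
    · rw [rlKernel_of_nonpos hxy, zero_mul]; exact hp
    · rw [indicator_of_mem (show x - y ∈ Icc 0 (x - a) from ⟨hxy.le, by linarith⟩), mul_comm]
      exact mul_le_mul_of_nonneg_right (hC y) (rlKernel_nonneg _ _)

theorem fracIntegral_left_eq_zero {β a x : ℝ} {f : ℝ → ℝ} (h0 : ∀ y < a, f y = 0) (hx : x ≤ a) :
    fracIntegral .left β f x = 0 := by
  rw [fracIntegral, setIntegral_eq_zero_of_forall_eq_zero, mul_zero]
  intro y hy
  rw [h0 y (lt_of_lt_of_le hy hx), mul_zero]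

theorem fracIntegral_left_congr {β x : ℝ} {f g : ℝ → ℝ}
    (h : f =ᵐ[volume.restrict (Iio x)] g) :
    fracIntegral .left β f x = fracIntegral .left β g x := by
  rw [fracIntegral, fracIntegral]
  congr 1
  refine integral_congr_ae (h.mono fun y hy => ?_)
  simp only [hy]

theorem integrableOn_pow_mul {β : ℝ} (hβ : 1 ≤ β) {f : ℝ → ℝ} (hf : Integrable f) {a : ℝ}
    (h0 : ∀ y < a, f y = 0) (x : ℝ) :
    IntegrableOn (fun z => (x - z) ^ (β - 1) * f z) (Iio x) := by
  refine ((hf.abs.const_mul (|x - a| ^ (β - 1))).integrableOn (s := Iio x)).mono'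
    ((Measurable.aestronglyMeasurable (by fun_prop)).mul hf.aestronglyMeasurable.restrict) ?_
  rw [ae_restrict_iff' measurableSet_Iio]
  refine Eventually.of_forall fun z hz => ?_
  have hxz : 0 < x - z := sub_pos.2 hz
  rw [norm_mul, Real.norm_of_nonneg (Real.rpow_nonneg hxz.le _), Real.norm_eq_abs]
  rcases lt_or_ge z a with hza | hza
  · simp [h0 z hza]
  · refine mul_le_mul_of_nonneg_right (Real.rpow_le_rpow hxz.le ?_ (by linarith)) (abs_nonneg _)
    rw [abs_of_pos (by linarith [mem_Iio.1 hz])]; linarith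

theorem fracIntegral_left_indicator_Ici (α a x : ℝ) :
    fracIntegral .left α ((Ici a).indicator fun _ => 1) x =
      fracIntegral .left 1 (fun y => (1 / Real.Gamma α) * rlKernel α (y - a)) x := by
  rw [fracIntegral_left_eq, fracIntegral_left_one, integral_const_mul,
    ← integral_Iic_eq_integral_Iio, ← integral_indicator measurableSet_Iic,
    ← integral_sub_left_eq_self _ volume (x + a)]
  congr 2
  ext y
  have : x - (x + a - y) = y - a := by ring
  rw [this]
  by_cases hy : y ≤ x
  · rw [indicator_of_mem (show x + a - y ∈ Ici a by rw [mem_Ici]; linarith),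
      indicator_of_mem (mem_Iic.2 hy), mul_one]
  · rw [indicator_of_notMem (show x + a - y ∉ Ici a by rw [mem_Ici]; linarith),
      indicator_of_notMem (notMem_Iic.2 (not_le.1 hy)), mul_zero]

theorem IsWeakDeriv.exists_fracIntegral_eq {α a b : ℝ} (hα : α ∈ Ioo (0 : ℝ) 1) (hab : a < b)
    {u v : ℝ → ℝ} (h : IsWeakDeriv .left α a b u v) (hv : IntegrableOn v (Ioo a b)) :
    ∃ c : ℝ, ∀ᵐ x ∂volume.restrict (Ioo a b),
      fracIntegral .left (1 - α) ((Ioo a b).indicator u) x =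
        fracIntegral .left 1 ((Ioo a b).indicator v) x + c := by
  have hU := (integrable_indicator_iff measurableSet_Ioo).2 h.integrable
  have hV := (integrable_indicator_iff measurableSet_Ioo).2 hv
  have h1α : 0 < 1 - α := sub_pos.2 hα.2
  have l1 := locallyIntegrable_fracIntegral_left h1α (by linarith [hα.1]) hU
  have l2 := locallyIntegrable_fracIntegral_left one_pos le_rfl hV
  obtain ⟨c, hc⟩ := ae_eq_const_of_integral_deriv hab (l1.sub l2) (fun φ hφ => by
    have e := h.integral_eq φ hφ
    rw [← integral_indicator measurableSet_Ioo, ← integral_indicator measurableSet_Ioo] at e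
    simp only [indicator_mul_left] at e
    have hd := hφ.deriv
    have e1 := integral_primitive_mul_deriv hV (hφ.smooth.of_le (by simp)) hφ.compact
    have e2 := integral_mul_fracIntegral_right h1α (by linarith [hα.1]) hU hd.smooth.continuous
      hd.compact
    simp only [Side.opp, rlDeriv_right_eq hα.2 hφ.smooth hφ.compact, mul_neg, integral_neg] at e
    simp only [Pi.sub_apply, sub_mul]
    rw [integral_sub (integrable_fracIntegral_left_mul h1α (by linarith [hα.1]) hU
      hd.smooth.continuous hd.compact) (integrable_fracIntegral_left_mul one_pos le_rfl hV
      hd.smooth.continuous hd.compact), e1, ← e2, e]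
    ring)
  refine ⟨c, hc.mono fun x hx => ?_⟩
  simp only [Pi.sub_apply] at hx
  linarith

theorem indicator_Ioo_eq_zero {a b : ℝ} (f : ℝ → ℝ) : ∀ y < a, (Ioo a b).indicator f y = 0 :=
  fun _ hy => indicator_of_notMem (fun h => h.1.not_gt hy) _

/-- A function with an integrable weak left derivative `v` is the sum of a multiple of
`(x - a)^(α - 1)` and the fractional integral of `v`. -/
theorem IsWeakDeriv.exists_representation {α a b : ℝ} (hα : α ∈ Ioo (0 : ℝ) 1) (hab : a < b)
    {u v : ℝ → ℝ} (h : IsWeakDeriv .left α a b u v) (hv : IntegrableOn v (Ioo a b)) :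
    ∃ c : ℝ, u =ᵐ[volume.restrict (Ioo a b)] fun x =>
      c * rlKernel α (x - a) + fracIntegral .left α ((Ioo a b).indicator v) x := by
  obtain ⟨c, hc⟩ := h.exists_fracIntegral_eq hα hab hv
  set U := (Ioo a b).indicator u with hUdef
  set V := (Ioo a b).indicator v with hVdef
  have hU : Integrable U := (integrable_indicator_iff measurableSet_Ioo).2 h.integrable
  have hV : Integrable V := (integrable_indicator_iff measurableSet_Ioo).2 hv
  have hU0 : ∀ y < a, U y = 0 := indicator_Ioo_eq_zero u
  have hV0 : ∀ y < a, V y = 0 := indicator_Ioo_eq_zero v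
  have h1α : 0 < 1 - α := sub_pos.2 hα.2
  refine ⟨c * (1 / Real.Gamma α), ?_⟩
  set E : ℝ → ℝ := fun y => (1 / Real.Gamma α) * rlKernel α (y - a) with hE
  have hEl : LocallyIntegrable E := by
    rw [locallyIntegrable_iff]
    intro k hk
    have := ((locallyIntegrable_rlKernel hα.1).integrableOn_isCompact
      (hk.image (continuous_sub_right a)))
    have h2 := ((integrable_indicator_iff (hk.image (continuous_sub_right a)).measurableSet).2
      this).comp_sub_right a
    refine Integrable.const_mul (c := (1 / Real.Gamma α)) ?_ |>.congr (EventuallyEq.rfl)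
    refine h2.integrableOn.congr_fun (fun x hx => ?_) hk.measurableSet
    exact indicator_of_mem (mem_image_of_mem _ hx) _
  have hEx : ∀ x < b, IntegrableOn E (Iio x) := fun x _ => by
    have := (hEl.integrableOn_isCompact (isCompact_Icc (a := a) (b := x)))
    rw [← integrable_indicator_iff measurableSet_Icc] at this
    refine this.integrableOn.congr_fun (fun y hy => ?_) measurableSet_Iio
    by_cases hya : a ≤ y
    · exact indicator_of_mem (show y ∈ Icc a x from ⟨hya, le_of_lt hy⟩) _
    · rw [indicator_of_notMem (fun h => hya h.1), hE]
      simp [rlKernel_of_nonpos (sub_nonpos.2 (not_le.1 hya).le)]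
  have hIl := locallyIntegrable_fracIntegral_left hα.1 hα.2.le hV
  have hIx : ∀ x < b, IntegrableOn (fracIntegral .left α V) (Iio x) := fun x _ => by
    have := (hIl.integrableOn_isCompact (isCompact_Icc (a := a) (b := x)))
    rw [← integrable_indicator_iff measurableSet_Icc] at this
    refine this.integrableOn.congr_fun (fun y hy => ?_) measurableSet_Iio
    by_cases hya : a ≤ y
    · exact indicator_of_mem (show y ∈ Icc a x from ⟨hya, le_of_lt hy⟩) _
    · rw [indicator_of_notMem (fun h => hya h.1), fracIntegral_left_eq_zero hV0
        (not_le.1 hya).le]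
  -- the primitive of the difference vanishes
  have key : ∀ x < b, ∫ y in Iio x, (U y - (c * E y + fracIntegral .left α V y)) = 0 := by
    intro x hx
    have hsum : IntegrableOn (fun y => c * E y + fracIntegral .left α V y) (Iio x) :=
      ((hEx x hx).const_mul c).add (hIx x hx)
    rw [integral_sub hU.integrableOn hsum, integral_add ((hEx x hx).const_mul c) (hIx x hx), integral_const_mul,
      ← fracIntegral_left_one U, ← fracIntegral_left_one E,
      ← fracIntegral_left_one (fracIntegral .left α V)]
    have s1 : fracIntegral .left α (fracIntegral .left (1 - α) U) x = fracIntegral .left 1 U x := by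
      have := fracIntegral_left_comp hα.1 h1α (x := x) hU.aestronglyMeasurable
        (integrableOn_pow_mul (by linarith) hU hU0 x)
      simpa using this
    have s2 : fracIntegral .left α (fracIntegral .left 1 V) x =
        fracIntegral .left 1 (fracIntegral .left α V) x := by
      rw [fracIntegral_left_comp hα.1 one_pos hV.aestronglyMeasurable
          (integrableOn_pow_mul (by linarith [hα.1]) hV hV0 x),
        fracIntegral_left_comp one_pos hα.1 hV.aestronglyMeasurable
          (integrableOn_pow_mul (by linarith [hα.1]) hV hV0 x), add_comm]
    have s3 : fracIntegral .left α (fracIntegral .left (1 - α) U) x =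
        fracIntegral .left α (fun y => fracIntegral .left 1 V y +
          c * (Ici a).indicator (fun _ => 1) y) x := by
      refine fracIntegral_left_congr ?_
      rw [ae_restrict_iff' measurableSet_Ioo] at hc
      rw [EventuallyEq, ae_restrict_iff' measurableSet_Iio]
      filter_upwards [hc, (measure_eq_zero_iff_ae_notMem.1 (measure_singleton a) :
        ∀ᵐ y ∂(volume : Measure ℝ), y ∉ ({a} : Set ℝ))] with y hy hya hyx
      rcases lt_or_ge y a with h' | h'
      · rw [fracIntegral_left_eq_zero hU0 h'.le, fracIntegral_left_eq_zero hV0 h'.le,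
          indicator_of_notMem (notMem_Ici.2 h')]
        simp
      · rw [hy ⟨lt_of_le_of_ne h' (Ne.symm hya), (mem_Iio.1 hyx).trans hx⟩,
          indicator_of_mem (mem_Ici.2 h'), mul_one]
    have i1 : Integrable fun y => rlKernel α (x - y) * fracIntegral .left 1 V y := by
      refine integrable_rlKernel_mul_of_bdd hα.1 (a := a) (C := ∫ y, |V y|)
        (locallyIntegrable_fracIntegral_left one_pos le_rfl hV).aestronglyMeasurable
        (fun y => ?_) (fun y hy => fracIntegral_left_eq_zero hV0 hy.le) x
      rw [fracIntegral_left_one]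
      exact (abs_integral_le_integral_abs).trans (setIntegral_le_integral hV.abs
        (Eventually.of_forall fun _ => abs_nonneg _))
    have i2 : Integrable fun y => rlKernel α (x - y) * (Ici a).indicator (fun _ => (1 : ℝ)) y :=
      integrable_rlKernel_mul_of_bdd hα.1 (a := a) (C := 1)
        (measurable_const.indicator measurableSet_Ici).aestronglyMeasurable
        (fun y => by by_cases h : y ∈ Ici a <;> simp [h])
        (fun y hy => indicator_of_notMem (notMem_Ici.2 hy) _) x
    have s4 : fracIntegral .left α (fun y => fracIntegral .left 1 V y +
          c * (Ici a).indicator (fun _ => 1) y) x =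
        fracIntegral .left α (fracIntegral .left 1 V) x +
          c * fracIntegral .left α ((Ici a).indicator fun _ => 1) x := by
      simp only [fracIntegral_left_eq α, mul_add, mul_left_comm _ c]
      rw [integral_add i1 (i2.const_mul c), integral_const_mul]
      ring
    rw [fracIntegral_left_indicator_Ici, s2] at s4
    rw [← s1, s3, s4]
    ring
  have hw : LocallyIntegrable fun y => U y - (c * E y + fracIntegral .left α V y) :=
    hU.locallyIntegrable.sub ((hEl.smul c).add hIl)
  set w : ℝ → ℝ := (Ioo a b).indicator fun y => U y - (c * E y + fracIntegral .left α V y)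
    with hwdef
  have hwi : Integrable w := (integrable_indicator_iff measurableSet_Ioo).2
    ((hw.integrableOn_isCompact (isCompact_Icc (a := a) (b := b))).mono_set Ioo_subset_Icc_self)
  have hw0 : ∀ x < b, fracIntegral .left 1 w x = 0 := by
    intro x hx
    rw [fracIntegral_left_one, ← key x hx]
    refine integral_congr_ae ?_
    rw [EventuallyEq, ae_restrict_iff' measurableSet_Iio]
    filter_upwards [(measure_eq_zero_iff_ae_notMem.1 (measure_singleton a) :
        ∀ᵐ y ∂(volume : Measure ℝ), y ∉ ({a} : Set ℝ))] with y hya hyx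
    rcases lt_or_ge y a with h' | h'
    · rw [hwdef, indicator_Ioo_eq_zero _ y h', hU0 y h', fracIntegral_left_eq_zero hV0 h'.le, hE]
      simp [rlKernel_of_nonpos (sub_nonpos.2 h'.le)]
    · exact indicator_of_mem (show y ∈ Ioo a b from
        ⟨lt_of_le_of_ne h' (Ne.symm hya), (mem_Iio.1 hyx).trans hx⟩) _
  have := ae_eq_zero_of_integral_test (a := a) (b := b) (w := w)
    (hwi.locallyIntegrable.locallyIntegrableOn _) fun φ hφ => by
      have e := integral_primitive_mul_deriv hwi (hφ.smooth.of_le (by simp)) hφ.compact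
      rw [← neg_eq_zero, ← e]
      refine integral_eq_zero_of_ae (Eventually.of_forall fun x => ?_)
      dsimp only [Pi.zero_apply]
      rcases lt_or_ge x b with hx | hx
      · rw [hw0 x hx, zero_mul]
      · rw [hφ.deriv.eq_zero_of_notMem (fun h => h.2.not_ge hx), mul_zero]
  rw [EventuallyEq, ae_restrict_iff' measurableSet_Ioo] at this ⊢
  filter_upwards [this] with x hx hxm
  have := hx hxm
  rw [hwdef, indicator_of_mem hxm, hUdef, indicator_of_mem hxm] at this
  simp only [hE, Pi.zero_apply] at this
  linarith

/-! ### Fractional integrals of `L^p` functions for `αp > 1` -/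

/-- The part of the Riemann-Liouville kernel in `(0,δ)`. -/
def shortKernel (α δ : ℝ) : ℝ → ℝ := (Ioo 0 δ).indicator (rlKernel α)

theorem shortKernel_nonneg (α δ t : ℝ) : 0 ≤ shortKernel α δ t :=
  indicator_nonneg (fun t _ => rlKernel_nonneg α t) t

@[fun_prop]
theorem measurable_shortKernel (α δ : ℝ) : Measurable (shortKernel α δ) :=
  (measurable_rlKernel α).indicator measurableSet_Ioo

theorem shortKernel_rpow {α δ q : ℝ} (hq : 0 < q) (t : ℝ) :
    ‖shortKernel α δ t‖ ^ q = (Ioo 0 δ).indicator (fun t => t ^ ((α - 1) * q)) t := by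
  rw [Real.norm_of_nonneg (shortKernel_nonneg _ _ _)]
  by_cases ht : t ∈ Ioo 0 δ
  · rw [shortKernel, indicator_of_mem ht, indicator_of_mem ht, rlKernel_of_pos ht.1,
      ← Real.rpow_mul ht.1.le]
  · rw [shortKernel, indicator_of_notMem ht, indicator_of_notMem ht, Real.zero_rpow hq.ne']

theorem integrable_shortKernel_rpow {α δ q : ℝ} (hq : 0 < q) (h : -1 < (α - 1) * q) (hδ : 0 < δ) :
    Integrable (fun t => ‖shortKernel α δ t‖ ^ q) ∧
      ∫ t, ‖shortKernel α δ t‖ ^ q = δ ^ ((α - 1) * q + 1) / ((α - 1) * q + 1) := by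
  simp only [shortKernel_rpow hq]
  refine ⟨(integrable_indicator_iff measurableSet_Ioo).2
    ((intervalIntegrable_iff_integrableOn_Ioo_of_le hδ.le).1
      (intervalIntegral.intervalIntegrable_rpow' h)), ?_⟩
  rw [integral_indicator measurableSet_Ioo, ← integral_Ioc_eq_integral_Ioo,
    ← intervalIntegral.integral_of_le hδ.le, integral_rpow (Or.inl h),
    Real.zero_rpow (by linarith), sub_zero]

theorem exists_shortKernel_bound {α : ℝ} {p : ℝ≥0∞} (hp1 : 1 < p) (hptop : p ≠ ⊤)
    (hαp : 1 < α * p.toReal) :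
    ∃ κ : ℝ → ℝ, Tendsto κ (nhdsWithin 0 (Ioi 0)) (nhds 0) ∧ (∀ δ > 0, 0 ≤ κ δ) ∧
      ∀ V : ℝ → ℝ, MemLp V p → ∀ δ > 0, ∀ x,
        Integrable (fun y => shortKernel α δ (x - y) * V y) ∧
        ∫ y, |shortKernel α δ (x - y) * V y| ≤ κ δ * (eLpNorm V p).toReal := by
  have hp0 : p ≠ 0 := (zero_lt_one.trans hp1).ne'
  have hP : 1 < p.toReal := by
    rw [← ENNReal.toReal_one]; exact (ENNReal.toReal_lt_toReal ENNReal.one_ne_top hptop).2 hp1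
  set q := Real.conjExponent p.toReal with hq
  have hc : p.toReal.HolderConjugate q := Real.HolderConjugate.conjExponent hP
  have hq0 : 0 < q := hc.symm.pos
  have hr : -1 < (α - 1) * q := by
    have h1 := hc.inv_add_inv_eq_one
    have h2 : p.toReal⁻¹ < α := by rw [inv_lt_iff_one_lt_mul₀ hc.pos]; exact hαp
    have h3 : -q⁻¹ < α - 1 := by linarith
    have := mul_lt_mul_of_pos_right h3 hq0
    rwa [neg_mul, inv_mul_cancel₀ hq0.ne'] at this
  refine ⟨fun δ => (δ ^ ((α - 1) * q + 1) / ((α - 1) * q + 1)) ^ (1 / q), ?_, ?_, ?_⟩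
  · have : ContinuousAt (fun δ : ℝ => (δ ^ ((α - 1) * q + 1) / ((α - 1) * q + 1)) ^ (1 / q)) 0 :=
      ((Real.continuousAt_rpow_const 0 _ (Or.inr (by linarith))).div_const _).rpow_const
        (Or.inr hc.symm.one_div_nonneg)
    have h := this.tendsto.mono_left (nhdsWithin_le_nhds (s := Ioi 0))
    rwa [Real.zero_rpow (by linarith), zero_div, Real.zero_rpow hc.symm.one_div_ne_zero] at h
  · intro δ hδ
    have : 0 < (α - 1) * q + 1 := by linarith
    positivity
  · intro V hV δ hδ x
    obtain ⟨hi, he⟩ := integrable_shortKernel_rpow hq0 hr hδ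
    have hki : Integrable (fun y => ‖shortKernel α δ (x - y)‖ ^ q) := hi.comp_sub_left x
    have hk : MemLp (fun y => shortKernel α δ (x - y)) (ENNReal.ofReal q) := by
      rw [← integrable_norm_rpow_iff (Measurable.aestronglyMeasurable (by fun_prop))
        (by simpa using hq0) ENNReal.ofReal_ne_top, ENNReal.toReal_ofReal hq0.le]
      exact hki
    have hV' : MemLp V (ENNReal.ofReal p.toReal) := by rwa [ENNReal.ofReal_toReal hptop]
    constructor
    · have : ENNReal.HolderConjugate (ENNReal.ofReal q) (ENNReal.ofReal p.toReal) :=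
        hc.symm.ennrealOfReal
      exact hk.integrable_mul hV'
    · have := integral_mul_norm_le_Lp_mul_Lq hc.symm hk hV'
      simp only [abs_mul, ← Real.norm_eq_abs]
      refine this.trans ?_
      rw [integral_sub_left_eq_self (fun y => ‖shortKernel α δ y‖ ^ q), he,
        hV.eLpNorm_eq_integral_rpow_norm hp0 hptop, ENNReal.toReal_ofReal (by positivity),
        one_div p.toReal]

/-- Continuous bounded approximation of the Riemann-Liouville kernel. -/
def contKernel (α δ t : ℝ) : ℝ := max t 0 * max t δ ^ (α - 2)

theorem continuous_contKernel (α : ℝ) {δ : ℝ} (hδ : 0 < δ) : Continuous (contKernel α δ) := by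
  unfold contKernel
  exact (continuous_id.max continuous_const).mul ((continuous_id.max continuous_const).rpow_const
    fun t => Or.inl (lt_max_of_lt_right hδ).ne')

theorem contKernel_nonneg (α : ℝ) {δ : ℝ} (hδ : 0 < δ) (t : ℝ) : 0 ≤ contKernel α δ t := by
  unfold contKernel
  have : 0 < max t δ := lt_max_of_lt_right hδ
  positivity

theorem contKernel_eq {α δ t : ℝ} (hδ : 0 < δ) (ht : δ ≤ t) : contKernel α δ t = rlKernel α t := by
  have h0 := hδ.trans_le ht
  rw [contKernel, max_eq_left h0.le, max_eq_left ht, rlKernel_of_pos h0, mul_comm,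
    ← Real.rpow_add_one h0.ne']
  congr 1; ring

theorem contKernel_le {α δ : ℝ} (hα : α < 1) (hδ : 0 < δ) (t : ℝ) :
    contKernel α δ t ≤ rlKernel α t ∧ contKernel α δ t ≤ δ ^ (α - 1) := by
  rcases le_or_gt t 0 with h0 | h0
  · rw [contKernel, max_eq_right h0, zero_mul]
    exact ⟨rlKernel_nonneg _ _, by positivity⟩
  rcases le_or_gt δ t with h | h
  · rw [contKernel_eq hδ h]
    refine ⟨le_rfl, ?_⟩
    rw [rlKernel_of_pos h0]
    exact Real.rpow_le_rpow_of_nonpos hδ h (by linarith)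
  · rw [contKernel, max_eq_left h0.le, max_eq_right h.le, rlKernel_of_pos h0]
    have e : ∀ s : ℝ, 0 < s → s ^ (α - 1) = s * s ^ (α - 2) := fun s hs => by
      rw [mul_comm, ← Real.rpow_add_one hs.ne']; congr 1; ring
    rw [e t h0, e δ hδ]
    exact ⟨mul_le_mul_of_nonneg_left (Real.rpow_le_rpow_of_nonpos h0 h.le (by linarith)) h0.le,
      mul_le_mul_of_nonneg_right h.le (by positivity)⟩

theorem abs_rlKernel_sub_contKernel_le {α δ : ℝ} (hα : α < 1) (hδ : 0 < δ) (t : ℝ) :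
    |rlKernel α t - contKernel α δ t| ≤ shortKernel α δ t := by
  rcases le_or_gt t 0 with h0 | h0
  · rw [rlKernel_of_nonpos h0, contKernel, max_eq_right h0]
    simp [shortKernel_nonneg]
  rcases le_or_gt δ t with h | h
  · rw [contKernel_eq hδ h, sub_self, abs_zero]
    exact shortKernel_nonneg _ _ _
  · rw [shortKernel, indicator_of_mem (show t ∈ Ioo 0 δ from ⟨h0, h⟩),
      abs_of_nonneg (sub_nonneg.2 (contKernel_le hα hδ t).1)]
    linarith [contKernel_nonneg α hδ t]

theorem rlKernel_mul_eq_shortKernel {α a δ x y : ℝ} {V : ℝ → ℝ} (h0 : ∀ y < a, V y = 0)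
    (hδ : x - a < δ) : rlKernel α (x - y) * V y = shortKernel α δ (x - y) * V y := by
  rcases lt_or_ge y a with h | h
  · rw [h0 y h, mul_zero, mul_zero]
  · rcases le_or_gt (x - y) 0 with h' | h'
    · rw [rlKernel_of_nonpos h', shortKernel, indicator_of_notMem (fun h => h.1.not_ge h')]
    · rw [shortKernel, indicator_of_mem (show x - y ∈ Ioo 0 δ from ⟨h', by linarith⟩)]

theorem integrable_rlKernel_mul_of_memLp {α : ℝ} {p : ℝ≥0∞} (hp1 : 1 < p) (hptop : p ≠ ⊤)
    (hαp : 1 < α * p.toReal) {V : ℝ → ℝ} (hV : MemLp V p) {a : ℝ} (h0 : ∀ y < a, V y = 0) (x : ℝ) :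
    Integrable fun y => rlKernel α (x - y) * V y := by
  obtain ⟨κ, -, -, hκ⟩ := exists_shortKernel_bound hp1 hptop hαp
  have := (hκ V hV (|x - a| + 1) (by positivity) x).1
  simpa only [rlKernel_mul_eq_shortKernel h0
    (show x - a < |x - a| + 1 by linarith [le_abs_self (x - a)])] using this

theorem exists_fracIntegral_left_bound {α : ℝ} {p : ℝ≥0∞} (hα : 0 < α) (hp1 : 1 < p)
    (hptop : p ≠ ⊤) (hαp : 1 < α * p.toReal) (a b : ℝ) :
    ∃ C, 0 ≤ C ∧ ∀ V : ℝ → ℝ, MemLp V p → (∀ y < a, V y = 0) → ∀ x ≤ b,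
      |fracIntegral .left α V x| ≤ C * (eLpNorm V p).toReal := by
  obtain ⟨κ, -, hκ0, hκ⟩ := exists_shortKernel_bound hp1 hptop hαp
  have hδ : 0 < |b - a| + 1 := by positivity
  have hΓ := Real.Gamma_pos_of_pos hα
  refine ⟨1 / Real.Gamma α * κ (|b - a| + 1), mul_nonneg (by positivity) (hκ0 _ hδ),
    fun V hV h0 x hx => ?_⟩
  rw [fracIntegral_left_eq, abs_mul, abs_of_pos (by positivity), mul_assoc]
  refine mul_le_mul_of_nonneg_left ?_ (by positivity)
  simp only [rlKernel_mul_eq_shortKernel h0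
    (show x - a < |b - a| + 1 by linarith [le_abs_self (b - a)])]
  exact abs_integral_le_integral_abs.trans (hκ V hV _ hδ x).2

theorem continuous_integral_contKernel_mul {α δ : ℝ} (hα : α < 1) (hδ : 0 < δ) {V : ℝ → ℝ}
    (hV : Integrable V) : (∀ x, Integrable fun y => contKernel α δ (x - y) * V y) ∧
      Continuous fun x => ∫ y, contKernel α δ (x - y) * V y := by
  have hb : ∀ t, ‖contKernel α δ t‖ ≤ δ ^ (α - 1) := fun t => by
    rw [Real.norm_of_nonneg (contKernel_nonneg α hδ t)]; exact (contKernel_le hα hδ t).2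
  have hm : ∀ x, AEStronglyMeasurable (fun y => contKernel α δ (x - y)) := fun x =>
    ((continuous_contKernel α hδ).comp (continuous_sub_left x)).aestronglyMeasurable
  refine ⟨fun x => hV.bdd_mul (hm x) (Eventually.of_forall fun y => hb (x - y)), ?_⟩
  refine continuous_of_dominated (bound := fun y => δ ^ (α - 1) * |V y|)
    (fun x => (hm x).mul hV.aestronglyMeasurable) (fun x => Eventually.of_forall fun y => ?_)
    (hV.abs.const_mul _) (Eventually.of_forall fun y => ?_)
  · rw [norm_mul, Real.norm_eq_abs (V y)]
    exact mul_le_mul_of_nonneg_right (hb _) (abs_nonneg _)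
  · exact ((continuous_contKernel α hδ).comp (continuous_sub_right y)).mul continuous_const

theorem abs_integral_rlKernel_sub_le {α δ x : ℝ} (hα : α < 1) (hδ : 0 < δ) {V : ℝ → ℝ}
    (h1 : Integrable fun y => rlKernel α (x - y) * V y)
    (h2 : Integrable fun y => contKernel α δ (x - y) * V y)
    (h3 : Integrable fun y => shortKernel α δ (x - y) * V y) :
    |(∫ y, rlKernel α (x - y) * V y) - ∫ y, contKernel α δ (x - y) * V y| ≤
      ∫ y, |shortKernel α δ (x - y) * V y| := by
  rw [← integral_sub h1 h2]
  refine abs_integral_le_integral_abs.trans (integral_mono (h1.sub h2).abs h3.abs fun y => ?_)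
  dsimp only
  rw [← sub_mul, abs_mul, abs_mul, abs_of_nonneg (shortKernel_nonneg _ _ _)]
  exact mul_le_mul_of_nonneg_right (abs_rlKernel_sub_contKernel_le hα hδ _) (abs_nonneg _)

theorem continuous_integral_rlKernel_mul {α : ℝ} {p : ℝ≥0∞} (hα : α < 1) (hp1 : 1 < p)
    (hptop : p ≠ ⊤) (hαp : 1 < α * p.toReal) {V : ℝ → ℝ} (hV : MemLp V p) (hVi : Integrable V)
    {a : ℝ} (h0 : ∀ y < a, V y = 0) : Continuous fun x => ∫ y, rlKernel α (x - y) * V y := by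
  obtain ⟨κ, hκt, hκ0, hκ⟩ := exists_shortKernel_bound hp1 hptop hαp
  refine continuous_of_uniform_approx_of_continuous fun s hs => ?_
  obtain ⟨ε, hε, hεs⟩ := Metric.mem_uniformity_dist.1 hs
  have ht : Tendsto (fun δ : ℝ => κ δ * (eLpNorm V p).toReal) (nhdsWithin (0 : ℝ) (Ioi 0))
      (nhds (0 : ℝ)) := by
    have := hκt.mul_const (eLpNorm V p).toReal
    rwa [zero_mul] at this
  have he : ∀ᶠ δ in nhdsWithin (0 : ℝ) (Ioi 0), κ δ * (eLpNorm V p).toReal < ε ∧ δ ∈ Ioi 0 :=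
    (ht.eventually_lt_const hε).and self_mem_nhdsWithin
  obtain ⟨δ, hδ, hδ0⟩ := he.exists
  rw [mem_Ioi] at hδ0
  obtain ⟨i2, hc⟩ := continuous_integral_contKernel_mul hα hδ0 hVi
  refine ⟨fun x => ∫ y, contKernel α δ (x - y) * V y, hc, fun x => hεs ?_⟩
  have i1 := integrable_rlKernel_mul_of_memLp hp1 hptop hαp hV h0 x
  obtain ⟨j1, j2⟩ := hκ V hV δ hδ0 x
  rw [Real.dist_eq]
  exact ((abs_integral_rlKernel_sub_le hα hδ0 i1 (i2 x) j1).trans j2).trans_lt hδ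

theorem continuous_fracIntegral_left {α : ℝ} {p : ℝ≥0∞} (hα : α ∈ Ioo (0 : ℝ) 1) (hp1 : 1 < p)
    (hptop : p ≠ ⊤) (hαp : 1 < α * p.toReal) {V : ℝ → ℝ} (hV : MemLp V p) (hVi : Integrable V)
    {a : ℝ} (h0 : ∀ y < a, V y = 0) : Continuous (fracIntegral .left α V) := by
  have := continuous_const (y := 1 / Real.Gamma α) |>.mul
    (continuous_integral_rlKernel_mul hα.2 hp1 hptop hαp hV hVi h0)
  exact this.congr fun x => (fracIntegral_left_eq α V x).symm

/-! ### The left trace -/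

section

variable {α : ℝ} {p : ℝ≥0∞} {a b : ℝ} {u v : ℝ → ℝ}

theorem memLp_indicator (h : MemLp v p (volume.restrict (Ioo a b))) :
    MemLp ((Ioo a b).indicator v) p :=
  (memLp_indicator_iff_restrict measurableSet_Ioo).2 h

theorem integrable_indicator_of_memLp (hp : 1 ≤ p) (h : MemLp v p (volume.restrict (Ioo a b))) :
    Integrable ((Ioo a b).indicator v) :=
  (integrable_indicator_iff measurableSet_Ioo).2 (h.integrable hp)

theorem continuous_fracIntegral_left_indicator (hα : α ∈ Ioo (0 : ℝ) 1) (hp1 : 1 < p)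
    (hptop : p ≠ ⊤) (hαp : 1 < α * p.toReal) (h : MemLp v p (volume.restrict (Ioo a b))) :
    Continuous (fracIntegral .left α ((Ioo a b).indicator v)) :=
  continuous_fracIntegral_left hα hp1 hptop hαp (memLp_indicator h)
    (integrable_indicator_of_memLp hp1.le h) (indicator_Ioo_eq_zero v)

theorem continuousOn_rlKernel_sub (α a : ℝ) : ContinuousOn (fun x => rlKernel α (x - a)) (Ioi a) := by
  have : ContinuousOn (fun x : ℝ => (x - a) ^ (α - 1)) (Ioi a) :=
    (continuous_sub_right a).continuousOn.rpow_const fun x hx => Or.inl (sub_pos.2 hx).ne'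
  exact this.congr fun x hx => rlKernel_of_pos (sub_pos.2 hx)

theorem hasTrace_left_of_representation (hα : α ∈ Ioo (0 : ℝ) 1) (hp1 : 1 < p)
    (hptop : p ≠ ⊤) (hαp : 1 < α * p.toReal) (h : MemLp v p (volume.restrict (Ioo a b))) {c : ℝ}
    (hu : u =ᵐ[volume.restrict (Ioo a b)] fun x =>
      c * rlKernel α (x - a) + fracIntegral .left α ((Ioo a b).indicator v) x) :
    HasTrace .left a b u (c * rlKernel α (b - a) +
      fracIntegral .left α ((Ioo a b).indicator v) b) := by
  refine ⟨fun x => c * rlKernel α (x - a) + fracIntegral .left α ((Ioo a b).indicator v) x,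
    ?_, hu, rfl⟩
  exact (continuousOn_const.mul ((continuousOn_rlKernel_sub α a).mono fun x hx => hx.1)).add
    (continuous_fracIntegral_left_indicator hα hp1 hptop hαp h).continuousOn

theorem toReal_eLpNorm_indicator (f : ℝ → ℝ) :
    (eLpNorm ((Ioo a b).indicator f) p volume).toReal =
      (eLpNorm f p (volume.restrict (Ioo a b))).toReal := by
  rw [eLpNorm_indicator_eq_eLpNorm_restrict measurableSet_Ioo]

theorem integral_abs_le_toReal_eLpNorm (hab : a < b) (hp1 : 1 < p)
    (hu : MemLp u p (volume.restrict (Ioo a b))) :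
    ∫ x in Ioo a b, |u x| ≤ (eLpNorm u p (volume.restrict (Ioo a b))).toReal *
      (volume (Ioo a b) ^ (1 - 1 / p.toReal)).toReal := by
  have h := eLpNorm_le_eLpNorm_mul_rpow_measure_univ hp1.le hu.aestronglyMeasurable
  have e : ∫ x in Ioo a b, |u x| = (eLpNorm u 1 (volume.restrict (Ioo a b))).toReal := by
    rw [eLpNorm_one_eq_lintegral_enorm, ← integral_norm_eq_lintegral_enorm hu.aestronglyMeasurable]
    rfl
  rw [e, ← ENNReal.toReal_mul]
  have e1 : volume (Ioo a b) ≠ 0 := by simpa using hab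
  refine ENNReal.toReal_mono (ENNReal.mul_ne_top hu.eLpNorm_ne_top
    (ENNReal.rpow_ne_top_of_ne_zero e1 (by simp))) ?_
  simpa using h

/-- The left trace exists and is bounded by the norm of the one-sided Sobolev space. -/
theorem exists_left_trace_bound (hα : α ∈ Ioo (0 : ℝ) 1) (hab : a < b) (hp1 : 1 < p)
    (hptop : p ≠ ⊤) (hαp : 1 < α * p.toReal) :
    ∃ K, 0 ≤ K ∧ ∀ u v : ℝ → ℝ, IsWeakDeriv .left α a b u v →
      MemLp u p (volume.restrict (Ioo a b)) → MemLp v p (volume.restrict (Ioo a b)) →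
      ∃ t, HasTrace .left a b u t ∧ |t| ≤ K * ((eLpNorm u p (volume.restrict (Ioo a b))).toReal +
        (eLpNorm v p (volume.restrict (Ioo a b))).toReal) := by
  obtain ⟨C, hC0, hC⟩ := exists_fracIntegral_left_bound hα.1 hp1 hptop hαp a b
  set D := (volume (Ioo a b) ^ (1 - 1 / p.toReal)).toReal
  set m := ∫ x in Ioo a b, rlKernel α (x - a) with hm
  set κ := rlKernel α (b - a)
  have hκ : 0 ≤ κ := rlKernel_nonneg _ _
  have hD : 0 ≤ D := ENNReal.toReal_nonneg
  have hki : IntegrableOn (fun x => rlKernel α (x - a)) (Ioo a b) := by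
    have : IntegrableOn (rlKernel α) (Ioo 0 (b - a)) :=
      ((locallyIntegrable_rlKernel hα.1).integrableOn_isCompact isCompact_Icc).mono_set
        Ioo_subset_Icc_self
    rw [← integrable_indicator_iff measurableSet_Ioo] at this ⊢
    refine (this.comp_sub_right a).congr (Eventually.of_forall fun x => ?_)
    simp only [indicator, mem_Ioo, sub_pos, sub_lt_sub_iff_right]
  have hm0 : 0 < m := by
    rw [hm, setIntegral_pos_iff_support_of_nonneg_ae (Eventually.of_forall fun x =>
      rlKernel_nonneg _ _) hki]
    have : Ioo a b ⊆ Function.support (fun x => rlKernel α (x - a)) ∩ Ioo a b := fun x hx =>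
      ⟨by
        rw [Function.mem_support, rlKernel_of_pos (sub_pos.2 hx.1)]
        exact (Real.rpow_pos_of_pos (sub_pos.2 hx.1) _).ne', hx⟩
    exact lt_of_lt_of_le (by simpa using hab) (measure_mono this)
  refine ⟨κ * ((D + (b - a) * C) / m) + C, by have := sub_pos.2 hab; positivity,
    fun u v huv hu hv => ?_⟩
  obtain ⟨c, hc⟩ := huv.exists_representation hα hab (hv.integrable hp1.le)
  refine ⟨_, hasTrace_left_of_representation hα hp1 hptop hαp hv hc, ?_⟩
  set N := (eLpNorm u p (volume.restrict (Ioo a b))).toReal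
  set N' := (eLpNorm v p (volume.restrict (Ioo a b))).toReal with hN'
  have hN0 : 0 ≤ N := ENNReal.toReal_nonneg
  have hN0' : 0 ≤ N' := ENNReal.toReal_nonneg
  have hI : ∀ x ≤ b, |fracIntegral .left α ((Ioo a b).indicator v) x| ≤ C * N' := fun x hx => by
    rw [hN', ← toReal_eLpNorm_indicator]
    exact hC _ (memLp_indicator hv) (indicator_Ioo_eq_zero v) x hx
  have hcm : |c| * m ≤ N * D + (b - a) * (C * N') := by
    have h1 : ∫ x in Ioo a b, |c| * rlKernel α (x - a) ≤ ∫ x in Ioo a b, (|u x| + C * N') := by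
      refine integral_mono_ae (hki.const_mul _) ((hu.integrable hp1.le).abs.add
        (integrable_const _)) ?_
      filter_upwards [hc, ae_restrict_mem measurableSet_Ioo] with x hx hxm
      rw [← abs_of_nonneg (rlKernel_nonneg α (x - a)), ← abs_mul]
      have : c * rlKernel α (x - a) = u x - fracIntegral .left α ((Ioo a b).indicator v) x := by
        rw [hx]; ring
      rw [this]
      exact (abs_sub _ _).trans (add_le_add le_rfl (hI x hxm.2.le))
    rw [integral_const_mul, integral_add (hu.integrable hp1.le).abs (integrable_const _)] at h1
    have h2 := integral_abs_le_toReal_eLpNorm hab hp1 hu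
    have h3 : ∫ _ in Ioo a b, C * N' = (b - a) * (C * N') := by
      simp [hab.le]
    linarith
  have hc' : |c| ≤ (D + (b - a) * C) / m * (N + N') := by
    rw [div_mul_eq_mul_div, le_div_iff₀ hm0]
    have := sub_pos.2 hab
    nlinarith [mul_nonneg hD hN0', mul_nonneg (mul_nonneg this.le hC0) hN0]
  calc |c * κ + fracIntegral .left α ((Ioo a b).indicator v) b|
      ≤ |c| * κ + C * N' := by
        refine (abs_add_le _ _).trans (add_le_add ?_ (hI b le_rfl))
        rw [abs_mul, abs_of_nonneg hκ]
    _ ≤ (κ * ((D + (b - a) * C) / m) + C) * (N + N') := by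
        have := mul_le_mul_of_nonneg_left hc' hκ
        nlinarith [mul_nonneg hC0 hN0]

/-- If a function is bounded near `a`, the singular part of its representation vanishes. -/
theorem eq_zero_of_bounded_near (hα1 : α < 1) (hab : a < b) {c M : ℝ} {w : ℝ → ℝ}
    (hw : ∀ᵐ x ∂volume.restrict (Ioo a b), |c * rlKernel α (x - a) + w x| ≤ M)
    (hwb : ∀ x ∈ Ioo a b, |w x| ≤ M) : c = 0 := by
  by_contra hc
  have ht : Tendsto (fun x : ℝ => |c| * (x - a) ^ (α - 1)) (nhdsWithin a (Ioi a)) atTop := by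
    refine Tendsto.const_mul_atTop (abs_pos.2 hc) ?_
    have h1 := tendsto_rpow_neg_nhdsGT_zero (show α - 1 < 0 by linarith)
    refine h1.comp (tendsto_nhdsWithin_iff.2 ⟨?_, ?_⟩)
    · have : Tendsto (fun x : ℝ => x - a) (nhds a) (nhds (a - a)) :=
        (continuous_sub_right a).tendsto a
      rw [sub_self] at this
      exact this.mono_left nhdsWithin_le_nhds
    · filter_upwards [self_mem_nhdsWithin] with x hx
      exact sub_pos.2 (mem_Ioi.1 hx)
  have h2 := ht.eventually_gt_atTop (2 * M)
  obtain ⟨d, hd, hd'⟩ := (mem_nhdsGT_iff_exists_Ioo_subset' hab).1 h2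
  have hne : (volume (Ioo a (min b d))) ≠ 0 := by simpa using ⟨hab, hd⟩
  have h3 := ae_restrict_of_ae_restrict_of_subset
    (Ioo_subset_Ioo_right (min_le_left b d)) hw
  rw [ae_restrict_iff' measurableSet_Ioo] at h3
  have : ∃ x ∈ Ioo a (min b d), |c * rlKernel α (x - a) + w x| ≤ M := by
    by_contra hcon
    push Not at hcon
    apply hne
    refine measure_mono_null (fun x hx => ?_) h3
    exact fun h => (hcon x hx).not_ge (h hx)
  obtain ⟨x, hx, hxM⟩ := this
  have hx1 := hwb x ⟨hx.1, hx.2.trans_le (min_le_left _ _)⟩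
  have hx2 : 2 * M < |c| * (x - a) ^ (α - 1) := hd' ⟨hx.1, hx.2.trans_le (min_le_right _ _)⟩
  have e : |c| * (x - a) ^ (α - 1) = |c * rlKernel α (x - a)| := by
    rw [abs_mul, abs_of_nonneg (rlKernel_nonneg _ _), rlKernel_of_pos (sub_pos.2 hx.1)]
  rw [e] at hx2
  have := abs_sub (c * rlKernel α (x - a) + w x) (w x)
  rw [add_sub_cancel_right] at this
  linarith

end

/-! ### Jensen's inequality and operators of Hardy type -/

theorem lintegral_rpow_le {Ω : Type*} [MeasurableSpace Ω] (μ : Measure Ω) {P : ℝ} (hP : 1 < P)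
    {g : Ω → ℝ≥0∞} (hg : AEMeasurable g μ) :
    (∫⁻ x, g x ∂μ) ^ P ≤ μ univ ^ (P - 1) * ∫⁻ x, g x ^ P ∂μ := by
  have hc := Real.HolderConjugate.conjExponent hP
  have h := ENNReal.lintegral_mul_le_Lp_mul_Lq μ hc hg (aemeasurable_const (b := (1 : ℝ≥0∞)))
  simp only [Pi.mul_apply, mul_one, ENNReal.one_rpow, lintegral_const, one_mul] at h
  have h2 := ENNReal.rpow_le_rpow h hc.nonneg
  rw [ENNReal.mul_rpow_of_nonneg _ _ hc.nonneg, ← ENNReal.rpow_mul, ← ENNReal.rpow_mul,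
    one_div_mul_cancel hc.ne_zero, ENNReal.rpow_one, mul_comm] at h2
  refine h2.trans_eq ?_
  congr 2
  have e := hc.inv_add_inv_eq_one
  have := hc.ne_zero
  have e2 : (Real.conjExponent P)⁻¹ = 1 - P⁻¹ := by linarith
  rw [one_div, e2, sub_mul, inv_mul_cancel₀ this, one_mul]

theorem lintegral_comp_mul_right {r : ℝ} (hr : 0 < r) {f : ℝ → ℝ≥0∞} (hf : Measurable f) :
    ENNReal.ofReal r * ∫⁻ t, f (t * r) = ∫⁻ t, f t := by
  have h := lintegral_map (μ := volume) hf (measurable_mul_const r)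
  rw [← h, Real.map_volume_mul_right hr.ne', lintegral_smul_measure, smul_eq_mul, ← mul_assoc,
    ← ENNReal.ofReal_mul hr.le, abs_of_pos (inv_pos.2 hr), mul_inv_cancel₀ hr.ne',
    ENNReal.ofReal_one, one_mul]

/-- The `L^p` bound for the integral operator with the homogeneous kernel generated by `k`. -/
theorem lintegral_hardy_le {P : ℝ} (hP : 1 < P) {k f : ℝ → ℝ≥0∞} (hk : Measurable k)
    (hf : Measurable f) :
    ∫⁻ t, (∫⁻ r in Ioi 0, k r * f (t * r)) ^ P ≤
      (∫⁻ r in Ioi 0, k r * ENNReal.ofReal (r ^ (-(1 / P)))) ^ P * ∫⁻ t, f t ^ P := by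
  have hP0 : 0 < P := zero_lt_one.trans hP
  set wt : ℝ → ℝ≥0∞ := fun r => k r * ENNReal.ofReal (r ^ (-(1 / P))) with hwt
  have hwtm : Measurable wt := hk.mul (by fun_prop)
  set ν := (volume.restrict (Ioi (0 : ℝ))).withDensity wt with hν
  have hA : ν univ = ∫⁻ r in Ioi 0, k r * ENNReal.ofReal (r ^ (-(1 / P))) := by
    rw [hν, withDensity_apply _ MeasurableSet.univ, Measure.restrict_univ]
  have hpos : ∀ᵐ r ∂ν, 0 < r :=
    (withDensity_absolutelyContinuous _ wt).ae_le (ae_restrict_mem measurableSet_Ioi)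
  have hF : Measurable fun q : ℝ × ℝ => ENNReal.ofReal (q.2 ^ (1 / P)) * f (q.1 * q.2) := by
    have : Measurable fun q : ℝ × ℝ => f (q.1 * q.2) := hf.comp (measurable_fst.mul measurable_snd)
    exact Measurable.mul (by fun_prop) this
  have hin : ∀ t, ∫⁻ r in Ioi 0, k r * f (t * r) =
      ∫⁻ r, ENNReal.ofReal (r ^ (1 / P)) * f (t * r) ∂ν := by
    intro t
    rw [hν, lintegral_withDensity_eq_lintegral_mul _ hwtm (g := fun r =>
      ENNReal.ofReal (r ^ (1 / P)) * f (t * r)) (hF.comp measurable_prodMk_left)]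
    refine setLIntegral_congr_fun measurableSet_Ioi fun r hr => ?_
    have hr : 0 < r := hr
    have e : ENNReal.ofReal (r ^ (-(1 / P))) * ENNReal.ofReal (r ^ (1 / P)) = 1 := by
      rw [← ENNReal.ofReal_mul (by positivity), ← Real.rpow_add hr, neg_add_cancel,
        Real.rpow_zero, ENNReal.ofReal_one]
    simp only [Pi.mul_apply, hwt]
    rw [mul_assoc, ← mul_assoc (ENNReal.ofReal _) (ENNReal.ofReal _), e, one_mul]
  calc ∫⁻ t, (∫⁻ r in Ioi 0, k r * f (t * r)) ^ P
      ≤ ∫⁻ t, ν univ ^ (P - 1) * ∫⁻ r, (ENNReal.ofReal (r ^ (1 / P)) * f (t * r)) ^ P ∂ν := by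
        refine lintegral_mono fun t => ?_
        dsimp only
        rw [hin t]
        exact lintegral_rpow_le ν hP (hF.comp measurable_prodMk_left).aemeasurable
    _ = ν univ ^ (P - 1) * ∫⁻ r, (∫⁻ t, (ENNReal.ofReal (r ^ (1 / P)) * f (t * r)) ^ P) ∂ν := by
        rw [lintegral_const_mul _ (hF.pow_const P).lintegral_prod_right',
          lintegral_lintegral_swap (hF.pow_const P).aemeasurable]
    _ = ν univ ^ (P - 1) * ∫⁻ _, (∫⁻ t, f t ^ P) ∂ν := by
        congr 1
        refine lintegral_congr_ae (hpos.mono fun r hr => ?_)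
        dsimp only
        rw [← lintegral_comp_mul_right hr (hf.pow_const P),
          ← lintegral_const_mul (f := fun t => f (t * r) ^ P) _
            ((hf.pow_const P).comp (measurable_mul_const r))]
        congr 1
        ext t
        rw [ENNReal.mul_rpow_of_nonneg _ _ hP0.le, ENNReal.ofReal_rpow_of_nonneg (by positivity)
          hP0.le, ← Real.rpow_mul hr.le, one_div_mul_cancel hP0.ne', Real.rpow_one]
    _ = ν univ ^ P * ∫⁻ t, f t ^ P := by
        rw [lintegral_const, mul_comm (∫⁻ t, f t ^ P), ← mul_assoc]
        congr 1
        nth_rewrite 2 [← ENNReal.rpow_one (ν univ)]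
        rw [← ENNReal.rpow_add_of_nonneg _ _ (by linarith) zero_le_one, sub_add_cancel]
    _ = _ := by rw [hA]

/-- The kernel that bounds `s^(-α) (I^α v)(b - s)` when `I^α v` vanishes at `b`. -/
def hardyKernel (α r : ℝ) : ℝ := |rlKernel α (r - 1) - rlKernel α r|

theorem hardyKernel_le_of_two_le {α r : ℝ} (hα : α ∈ Ioo (0 : ℝ) 1) (hr : 2 ≤ r) :
    hardyKernel α r ≤ 2 * r ^ (α - 2) := by
  have h0 : 0 < r := by linarith
  have h1 : 0 < r - 1 := by linarith
  rw [hardyKernel, rlKernel_of_pos h0, rlKernel_of_pos h1]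
  have hle : r ^ (α - 1) ≤ (r - 1) ^ (α - 1) :=
    Real.rpow_le_rpow_of_nonpos h1 (by linarith) (by linarith [hα.2])
  rw [abs_of_nonneg (sub_nonneg.2 hle)]
  have e : (r - 1) ^ (α - 1) = r ^ (α - 1) * (1 + 1 / (r - 1)) ^ (1 - α) := by
    have : 1 + 1 / (r - 1) = r / (r - 1) := by field_simp; ring
    rw [this, Real.div_rpow h0.le h1.le, show 1 - α = -(α - 1) by ring, Real.rpow_neg h0.le,
      Real.rpow_neg h1.le]
    have := (Real.rpow_pos_of_pos h0 (α - 1)).ne'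
    have := (Real.rpow_pos_of_pos h1 (α - 1)).ne'
    field_simp
  have hb := rpow_one_add_le_one_add_mul_self (s := 1 / (r - 1)) (p := 1 - α)
    (by have : 0 < 1 / (r - 1) := by positivity
        linarith) (by linarith [hα.2]) (by linarith [hα.1])
  have h2 : r ^ (α - 1) = r ^ (α - 2) * r := by
    rw [← Real.rpow_add_one h0.ne']; congr 1; ring
  have h3 : (1 - α) * (1 / (r - 1)) ≤ 2 / r := by
    have : 1 / (r - 1) ≤ 2 / r := by rw [div_le_div_iff₀ h1 h0]; linarith
    have h4 : 0 ≤ 1 / (r - 1) := by positivity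
    nlinarith [hα.1]
  have hp := Real.rpow_pos_of_pos h0 (α - 1)
  calc (r - 1) ^ (α - 1) - r ^ (α - 1) ≤ r ^ (α - 1) * (2 / r) := by
        rw [e]; nlinarith
    _ = 2 * r ^ (α - 2) := by rw [h2]; field_simp

theorem integrableOn_hardyKernel {α P : ℝ} (hα : α ∈ Ioo (0 : ℝ) 1) (hP : 1 < P)
    (hαP : 1 < α * P) : IntegrableOn (fun r => hardyKernel α r * r ^ (-(1 / P))) (Ioi 0) := by
  have hP0 : 0 < P := zero_lt_one.trans hP
  have hαP' : 1 / P < α := by rwa [div_lt_iff₀ hP0]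
  have hPi : 0 < 1 / P := by positivity
  have hm : Measurable fun r => hardyKernel α r * r ^ (-(1 / P)) := by
    unfold hardyKernel; fun_prop
  have hn : ∀ r, 0 ≤ hardyKernel α r := fun r => abs_nonneg _
  have hle1 : ∀ r : ℝ, 1 ≤ r → r ^ (-(1 / P)) ≤ 1 := fun r hr =>
    Real.rpow_le_one_of_one_le_of_nonpos hr (by linarith)
  have e : Ioi (0 : ℝ) = Ioc 0 1 ∪ Ioo 1 2 ∪ Ici 2 := by
    ext x
    simp only [mem_Ioi, mem_union, mem_Ioc, mem_Ioo, mem_Ici]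
    constructor
    · intro h
      rcases le_or_gt x 1 with h1 | h1
      · exact Or.inl (Or.inl ⟨h, h1⟩)
      · rcases lt_or_ge x 2 with h2 | h2
        · exact Or.inl (Or.inr ⟨h1, h2⟩)
        · exact Or.inr h2
    · rintro ((h | h) | h)
      · exact h.1
      · linarith [h.1]
      · linarith
  rw [e]
  refine (IntegrableOn.union ?_ ?_).union ?_
  · have h := (intervalIntegrable_iff_integrableOn_Ioc_of_le (zero_le_one (α := ℝ))).1
      (intervalIntegral.intervalIntegrable_rpow' (a := 0) (b := 1) (r := α - 1 - 1 / P)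
        (by linarith))
    refine h.congr_fun (fun r hr => ?_) measurableSet_Ioc
    dsimp only
    rw [hardyKernel, rlKernel_of_nonpos (by linarith [hr.2]), rlKernel_of_pos hr.1, zero_sub,
      abs_neg, abs_of_pos (Real.rpow_pos_of_pos hr.1 _), ← Real.rpow_add hr.1]
    congr 1
  · have h : IntegrableOn (fun r => rlKernel α (r - 1)) (Ioo 1 2) := by
      have : IntegrableOn (rlKernel α) (Icc 0 1) :=
        (locallyIntegrable_rlKernel hα.1).integrableOn_isCompact isCompact_Icc
      rw [← integrable_indicator_iff measurableSet_Icc] at this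
      refine (this.comp_sub_right 1).integrableOn.congr_fun (fun r hr => ?_) measurableSet_Ioo
      exact indicator_of_mem (show r - 1 ∈ Icc (0 : ℝ) 1 from
        ⟨by linarith [hr.1], by linarith [hr.2]⟩) _
    refine h.mono' hm.aestronglyMeasurable ?_
    filter_upwards [ae_restrict_mem measurableSet_Ioo] with r hr
    have h0 : 0 < r := by linarith [hr.1]
    rw [Real.norm_of_nonneg (mul_nonneg (hn r) (Real.rpow_nonneg h0.le _))]
    have h1 : hardyKernel α r ≤ rlKernel α (r - 1) := by
      have : rlKernel α r ≤ rlKernel α (r - 1) := by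
        rw [rlKernel_of_pos h0, rlKernel_of_pos (by linarith [hr.1])]
        exact Real.rpow_le_rpow_of_nonpos (by linarith [hr.1]) (by linarith) (by linarith [hα.2])
      rw [hardyKernel, abs_of_nonneg (sub_nonneg.2 this)]
      linarith [rlKernel_nonneg α r]
    exact (mul_le_of_le_one_right (hn r) (hle1 r hr.1.le)).trans h1
  · have h := (integrableOn_Ioi_rpow_of_lt (a := α - 2) (by linarith [hα.2])
      (zero_lt_one (α := ℝ))).mono_set (show Ici (2 : ℝ) ⊆ Ioi 1 from fun x hx =>
        mem_Ioi.2 (lt_of_lt_of_le one_lt_two hx))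
    refine (h.const_mul 2).mono' hm.aestronglyMeasurable ?_
    filter_upwards [ae_restrict_mem measurableSet_Ici] with r hr
    have hr : 2 ≤ r := hr
    rw [Real.norm_of_nonneg (mul_nonneg (hn r) (Real.rpow_nonneg (by linarith) _))]
    exact (mul_le_of_le_one_right (hn r) (hle1 r (by linarith))).trans
      (hardyKernel_le_of_two_le hα hr)

/-- The kernel of the tail operator. -/
def tailKernel (α r : ℝ) : ℝ := (1 + r) ^ (-α - 1) * r ^ α

theorem integrableOn_tailKernel {α P : ℝ} (hP : 1 < P) (hαP : 1 < α * P) :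
    IntegrableOn (fun r => tailKernel α r * r ^ (-(1 / P))) (Ioi 0) := by
  have hP0 : 0 < P := zero_lt_one.trans hP
  have hαP' : 1 / P < α := by rwa [div_lt_iff₀ hP0]
  have hPi : 0 < 1 / P := by positivity
  have hm : Measurable fun r => tailKernel α r * r ^ (-(1 / P)) := by
    unfold tailKernel; fun_prop
  have e : ∀ r : ℝ, 0 < r → tailKernel α r * r ^ (-(1 / P)) =
      (1 + r) ^ (-α - 1) * r ^ (α - 1 / P) := fun r hr => by
    rw [tailKernel, mul_assoc, ← Real.rpow_add hr]; congr 1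
  rw [← Ioc_union_Ioi_eq_Ioi (zero_le_one (α := ℝ))]
  refine IntegrableOn.union ?_ ?_
  · refine (integrableOn_const (C := (1 : ℝ)) (by simp)).mono' hm.aestronglyMeasurable ?_
    filter_upwards [ae_restrict_mem measurableSet_Ioc] with r hr
    have h0 := hr.1
    rw [e r h0, Real.norm_of_nonneg (by positivity)]
    have h1 : (1 + r) ^ (-α - 1) ≤ 1 :=
      Real.rpow_le_one_of_one_le_of_nonpos (by linarith) (by linarith)
    have h2 : r ^ (α - 1 / P) ≤ 1 := Real.rpow_le_one h0.le hr.2 (by linarith)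
    exact mul_le_one₀ h1 (by positivity) h2
  · refine (integrableOn_Ioi_rpow_of_lt (a := -1 - 1 / P) (by linarith)
      (zero_lt_one (α := ℝ))).mono' hm.aestronglyMeasurable ?_
    filter_upwards [ae_restrict_mem measurableSet_Ioi] with r hr
    have h0 : 0 < r := zero_lt_one.trans hr
    rw [e r h0, Real.norm_of_nonneg (by positivity)]
    have h1 : (1 + r) ^ (-α - 1) ≤ r ^ (-α - 1) :=
      Real.rpow_le_rpow_of_nonpos h0 (by linarith) (by linarith)
    calc _ ≤ r ^ (-α - 1) * r ^ (α - 1 / P) :=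
          mul_le_mul_of_nonneg_right h1 (by positivity)
      _ = r ^ (-1 - 1 / P) := by rw [← Real.rpow_add h0]; congr 1; ring

/-! ### Extension by zero across the endpoint `b` -/

theorem rlKernel_mul (α : ℝ) {s : ℝ} (hs : 0 < s) (t : ℝ) :
    rlKernel α (t * s) = s ^ (α - 1) * rlKernel α t := by
  rcases le_or_gt t 0 with h | h
  · rw [rlKernel_of_nonpos h, rlKernel_of_nonpos (mul_nonpos_of_nonpos_of_nonneg h hs.le), mul_zero]
  · rw [rlKernel_of_pos h, rlKernel_of_pos (mul_pos h hs), Real.mul_rpow h.le hs.le, mul_comm]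

/-- The majorant of `s^(-α) (I^α V)(b - s)`. -/
def hardyMajorant (α b : ℝ) (V : ℝ → ℝ) (s : ℝ) : ℝ≥0∞ :=
  ∫⁻ r in Ioi 0, ENNReal.ofReal (hardyKernel α r) * ‖V (b - s * r)‖ₑ

@[fun_prop]
theorem measurable_hardyKernel (α : ℝ) : Measurable (hardyKernel α) := by
  unfold hardyKernel; fun_prop

@[fun_prop]
theorem measurable_tailKernel (α : ℝ) : Measurable (tailKernel α) := by
  unfold tailKernel; fun_prop

theorem measurable_hardyMajorant (α b : ℝ) {V : ℝ → ℝ} (hV : Measurable V) :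
    Measurable (hardyMajorant α b V) := by
  unfold hardyMajorant
  exact Measurable.lintegral_prod_right' (f := fun q : ℝ × ℝ =>
    ENNReal.ofReal (hardyKernel α q.2) * ‖V (b - q.1 * q.2)‖ₑ) (by fun_prop)

theorem lintegral_sub_left (f : ℝ → ℝ≥0∞) (b : ℝ) : ∫⁻ y, f (b - y) = ∫⁻ y, f y :=
  lintegral_sub_left_eq_self f b

section

variable {α : ℝ} {p : ℝ≥0∞} {a b : ℝ} {V : ℝ → ℝ}

theorem enorm_fracIntegral_left_le (hα : 0 < α) (hp1 : 1 < p) (hptop : p ≠ ⊤)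
    (hαp : 1 < α * p.toReal) (hVm : Measurable V) (hV : MemLp V p)
    (h0 : ∀ y, y ∉ Ioo a b → V y = 0) (hb : fracIntegral .left α V b = 0) {s : ℝ} (hs : 0 < s) :
    ‖fracIntegral .left α V (b - s)‖ₑ ≤
      ENNReal.ofReal (1 / Real.Gamma α) * (ENNReal.ofReal (s ^ α) * hardyMajorant α b V s) := by
  have ha0 : ∀ y < a, V y = 0 := fun y hy => h0 y fun h => h.1.not_gt hy
  have i1 := fun x => integrable_rlKernel_mul_of_memLp hp1 hptop hαp hV ha0 x
  have e : fracIntegral .left α V (b - s) = (1 / Real.Gamma α) *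
      ∫ y, (rlKernel α (b - s - y) - rlKernel α (b - y)) * V y := by
    rw [← sub_zero (fracIntegral .left α V (b - s)), ← hb, fracIntegral_left_eq,
      fracIntegral_left_eq, ← mul_sub, ← integral_sub (i1 _) (i1 _)]
    simp only [sub_mul]
  rw [e, enorm_mul, Real.enorm_eq_ofReal (by have := Real.Gamma_pos_of_pos hα; positivity)]
  refine mul_le_mul_right ((enorm_integral_le_lintegral_enorm _).trans_eq ?_) _
  set F : ℝ → ℝ≥0∞ := fun z => ‖(rlKernel α (z - s) - rlKernel α z) * V (b - z)‖ₑ with hF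
  have hFm : Measurable F := by fun_prop
  have e1 : ∫⁻ y, ‖(rlKernel α (b - s - y) - rlKernel α (b - y)) * V y‖ₑ = ∫⁻ z, F z := by
    rw [← lintegral_sub_left F b]
    congr 1
    ext y
    rw [hF]
    dsimp only
    rw [sub_sub_cancel, sub_right_comm]
  rw [e1, ← lintegral_comp_mul_right hs hFm, hardyMajorant, 
    ← lintegral_const_mul' _ _ ENNReal.ofReal_ne_top, ← lintegral_indicator measurableSet_Ioi,
    ← lintegral_const_mul' _ _ ENNReal.ofReal_ne_top]
  congr 1
  ext r
  rw [hF]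
  dsimp only
  rcases le_or_gt r 0 with hr | hr
  · rw [indicator_of_notMem (notMem_Ioi.2 hr), h0 _ (fun h => ?_)]
    · simp
    · have := h.2
      nlinarith
  · rw [indicator_of_mem (mem_Ioi.2 hr), rlKernel_mul α hs,
      show r * s - s = (r - 1) * s by ring, rlKernel_mul α hs, ← mul_sub, mul_assoc, enorm_mul,
      enorm_mul, Real.enorm_eq_ofReal (by positivity), ← mul_assoc, ← ENNReal.ofReal_mul hs.le,
      Real.enorm_eq_ofReal_abs (rlKernel α (r - 1) - rlKernel α r), hardyKernel, mul_comm r s]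
    congr 2
    rw [mul_comm, ← Real.rpow_add_one hs.ne', sub_add_cancel]

/-- The derivative of order `α`, to the right of `b`, of a function supported in `[a,b]`. -/
def tailDeriv (α a b : ℝ) (w : ℝ → ℝ) (x : ℝ) : ℝ :=
  -(α / Real.Gamma (1 - α)) * ∫ y in Ioo a b, (x - y) ^ (-α - 1) * w y

theorem enorm_tailDeriv_le (hα : α ∈ Ioo (0 : ℝ) 1) (hp1 : 1 < p) (hptop : p ≠ ⊤)
    (hαp : 1 < α * p.toReal) (hVm : Measurable V) (hV : MemLp V p)
    (h0 : ∀ y, y ∉ Ioo a b → V y = 0) (hb : fracIntegral .left α V b = 0) {t : ℝ} (ht : 0 < t) :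
    ‖tailDeriv α a b (fracIntegral .left α V) (b + t)‖ₑ ≤
      ENNReal.ofReal (α / Real.Gamma (1 - α)) * (ENNReal.ofReal (1 / Real.Gamma α) *
        ∫⁻ r in Ioi 0, ENNReal.ofReal (tailKernel α r) * hardyMajorant α b V (t * r)) := by
  have hΓ := Real.Gamma_pos_of_pos (sub_pos.2 hα.2)
  rw [tailDeriv, enorm_mul, enorm_neg, Real.enorm_eq_ofReal (by have := hα.1; positivity)]
  refine mul_le_mul_right ((enorm_integral_le_lintegral_enorm _).trans ?_) _
  set G : ℝ → ℝ≥0∞ := (Ioi 0).indicator fun z =>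
    ENNReal.ofReal ((t + z) ^ (-α - 1) * z ^ α) * hardyMajorant α b V z with hG
  have hMm := measurable_hardyMajorant α b hVm
  have hGm : Measurable G := Measurable.indicator (by fun_prop) measurableSet_Ioi
  have hle : ∫⁻ y in Ioo a b, ‖(b + t - y) ^ (-α - 1) * fracIntegral .left α V y‖ₑ ≤
      ∫⁻ y, ENNReal.ofReal (1 / Real.Gamma α) * G (b - y) := by
    rw [← lintegral_indicator measurableSet_Ioo]
    refine lintegral_mono fun y => ?_
    by_cases hy : y ∈ Ioo a b
    · have hs : 0 < b - y := sub_pos.2 hy.2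
      rw [indicator_of_mem hy, hG, indicator_of_mem (mem_Ioi.2 hs), enorm_mul,
        Real.enorm_eq_ofReal (Real.rpow_nonneg (by linarith) _),
        ENNReal.ofReal_mul (by positivity), show t + (b - y) = b + t - y by ring]
      have := enorm_fracIntegral_left_le hα.1 hp1 hptop hαp hVm hV h0 hb hs
      rw [sub_sub_cancel] at this
      refine (mul_le_mul_right this _).trans_eq ?_
      ring
    · rw [indicator_of_notMem hy]; exact zero_le
  refine hle.trans_eq ?_
  rw [lintegral_const_mul' _ _ ENNReal.ofReal_ne_top, lintegral_sub_left G b,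
    ← lintegral_comp_mul_right ht hGm, ← lintegral_const_mul' _ _ ENNReal.ofReal_ne_top,
    ← lintegral_indicator measurableSet_Ioi]
  congr 2
  ext r
  rw [hG]
  rcases le_or_gt r 0 with hr | hr
  · rw [indicator_of_notMem (notMem_Ioi.2 hr), indicator_of_notMem (notMem_Ioi.2
      (mul_nonpos_of_nonpos_of_nonneg hr ht.le)), mul_zero]
  · rw [indicator_of_mem (mem_Ioi.2 hr), indicator_of_mem (mem_Ioi.2 (mul_pos hr ht)),
      ← mul_assoc, ← ENNReal.ofReal_mul ht.le, mul_comm r t, tailKernel]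
    congr 2
    rw [show t + t * r = t * (1 + r) by ring, Real.mul_rpow ht.le (by positivity),
      Real.mul_rpow ht.le hr.le]
    have : t ^ (-α - 1) * t ^ α * t = 1 := by
      rw [← Real.rpow_add ht, ← Real.rpow_add_one ht.ne', show -α - 1 + α + 1 = 0 by ring,
        Real.rpow_zero]
    linear_combination (1 + r) ^ (-α - 1) * r ^ α * this

theorem measurable_tailDeriv {w : ℝ → ℝ} (hw : Measurable w) : Measurable (tailDeriv α a b w) := by
  unfold tailDeriv
  refine Measurable.const_mul ?_ _
  exact (StronglyMeasurable.integral_prod_right' (ν := volume.restrict (Ioo a b))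
    (f := fun q : ℝ × ℝ => (q.1 - q.2) ^ (-α - 1) * w q.2)
    (Measurable.stronglyMeasurable (by fun_prop))).measurable

theorem lintegral_ofReal_mul_lt_top {k : ℝ → ℝ} (hk0 : ∀ r > 0, 0 ≤ k r) {P : ℝ}
    (h : IntegrableOn (fun r => k r * r ^ (-(1 / P))) (Ioi 0)) :
    ∫⁻ r in Ioi 0, ENNReal.ofReal (k r) * ENNReal.ofReal (r ^ (-(1 / P))) < ⊤ := by
  refine lt_of_le_of_lt (le_of_eq ?_) h.2
  refine setLIntegral_congr_fun measurableSet_Ioi fun r hr => ?_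
  have hr : 0 < r := hr
  dsimp only
  rw [← ENNReal.ofReal_mul (hk0 r hr), Real.enorm_eq_ofReal (mul_nonneg (hk0 r hr) (by positivity))]

theorem memLp_tailDeriv (hα : α ∈ Ioo (0 : ℝ) 1) (hp1 : 1 < p) (hptop : p ≠ ⊤)
    (hαp : 1 < α * p.toReal) (hVm : Measurable V) (hV : MemLp V p) (hVi : Integrable V)
    (h0 : ∀ y, y ∉ Ioo a b → V y = 0) (hb : fracIntegral .left α V b = 0) :
    MemLp ((Ioi b).indicator (tailDeriv α a b (fracIntegral .left α V))) p := by
  have hp0 : p ≠ 0 := (zero_lt_one.trans hp1).ne'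
  have hP : 1 < p.toReal := by
    rw [← ENNReal.toReal_one]; exact (ENNReal.toReal_lt_toReal ENNReal.one_ne_top hptop).2 hp1
  have hP0 : 0 < p.toReal := zero_lt_one.trans hP
  have ha0 : ∀ y < a, V y = 0 := fun y hy => h0 y fun h => h.1.not_gt hy
  set w := fracIntegral .left α V
  have hwc : Continuous w := continuous_fracIntegral_left hα hp1 hptop hαp hV hVi ha0
  have hm : Measurable (tailDeriv α a b w) := measurable_tailDeriv hwc.measurable
  refine ⟨(hm.indicator measurableSet_Ioi).aestronglyMeasurable, ?_⟩
  rw [eLpNorm_lt_top_iff_lintegral_rpow_enorm_lt_top hp0 hptop]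
  set C := ENNReal.ofReal (α / Real.Gamma (1 - α)) * ENNReal.ofReal (1 / Real.Gamma α)
  have hC : C ≠ ⊤ := ENNReal.mul_ne_top ENNReal.ofReal_ne_top ENNReal.ofReal_ne_top
  set f : ℝ → ℝ≥0∞ := fun z => ‖V (b - z)‖ₑ
  have hf : Measurable f := by fun_prop
  have hMm := measurable_hardyMajorant α b hVm
  have h1 : ∫⁻ s, hardyMajorant α b V s ^ p.toReal < ⊤ := by
    refine lt_of_le_of_lt (lintegral_hardy_le hP (k := fun r => ENNReal.ofReal (hardyKernel α r))
      (by fun_prop) hf) (ENNReal.mul_lt_top (ENNReal.rpow_lt_top_of_nonneg hP0.le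
        (lintegral_ofReal_mul_lt_top (fun r _ => abs_nonneg _)
          (integrableOn_hardyKernel hα hP hαp)).ne) ?_)
    rw [lintegral_sub_left (fun z => ‖V z‖ₑ ^ p.toReal) b]
    exact (eLpNorm_lt_top_iff_lintegral_rpow_enorm_lt_top hp0 hptop).1 hV.2
  have h2 : ∫⁻ t, (∫⁻ r in Ioi 0, ENNReal.ofReal (tailKernel α r) *
      hardyMajorant α b V (t * r)) ^ p.toReal < ⊤ := by
    refine lt_of_le_of_lt (lintegral_hardy_le hP (k := fun r => ENNReal.ofReal (tailKernel α r))
      (by fun_prop) hMm) (ENNReal.mul_lt_top (ENNReal.rpow_lt_top_of_nonneg hP0.le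
        (lintegral_ofReal_mul_lt_top (fun r hr => ?_) (integrableOn_tailKernel hP hαp)).ne) h1)
    have hr : 0 < r := hr
    unfold tailKernel
    positivity
  have h3 : ∫⁻ x, ‖(Ioi b).indicator (tailDeriv α a b w) x‖ₑ ^ p.toReal =
      ∫⁻ t, ‖(Ioi b).indicator (tailDeriv α a b w) (b + t)‖ₑ ^ p.toReal :=
    (lintegral_add_left_eq_self (fun x => ‖(Ioi b).indicator (tailDeriv α a b w) x‖ₑ ^ p.toReal)
      b).symm
  rw [h3]
  refine lt_of_le_of_lt (lintegral_mono (g := fun t => C ^ p.toReal * (∫⁻ r in Ioi 0,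
    ENNReal.ofReal (tailKernel α r) * hardyMajorant α b V (t * r)) ^ p.toReal) fun t => ?_) ?_
  · dsimp only
    rcases le_or_gt t 0 with ht | ht
    · rw [indicator_of_notMem (by rw [mem_Ioi]; linarith), enorm_zero, ENNReal.zero_rpow_of_pos hP0]
      exact zero_le
    · rw [indicator_of_mem (by rw [mem_Ioi]; linarith), ← ENNReal.mul_rpow_of_nonneg _ _ hP0.le,
        mul_assoc]
      exact ENNReal.rpow_le_rpow (enorm_tailDeriv_le hα hp1 hptop hαp hVm hV h0 hb ht) hP0.le
  · have hCP := ENNReal.rpow_ne_top_of_nonneg hP0.le hC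
    rw [lintegral_const_mul' _ _ hCP]
    exact ENNReal.mul_lt_top hCP.lt_top h2

end

/-- `W` is the weak fractional derivative of `U` on the whole line. -/
def IsGlobalWeakDeriv (s : Side) (α : ℝ) (U W : ℝ → ℝ) : Prop :=
  ∀ φ : ℝ → ℝ, ContDiff ℝ ∞ φ → HasCompactSupport φ →
    ∫ x, W x * φ x = ∫ x, U x * rlDeriv s.opp α φ x

theorem integral_shifted_rpow {α b x y : ℝ} (hα : α ∈ Ioo (0 : ℝ) 1) (hy : y < b) (hx : b < x) :
    IntegrableOn (fun t => (t - y) ^ (-α - 1)) (Ioo b x) ∧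
    ∫ t in Ioo b x, (t - y) ^ (-α - 1) =
      (rlKernel (1 - α) (b - y) - rlKernel (1 - α) (x - y)) / α := by
  have h0 : (0 : ℝ) ∉ uIcc (b - y) (x - y) := by
    rw [uIcc_of_le (by linarith)]
    intro h
    linarith [h.1]
  have hi : IntervalIntegrable (fun t => t ^ (-α - 1)) volume (b - y) (x - y) :=
    intervalIntegral.intervalIntegrable_rpow (Or.inr h0)
  constructor
  · have := hi.comp_sub_right y
    rw [sub_add_cancel, sub_add_cancel] at this
    exact (intervalIntegrable_iff_integrableOn_Ioo_of_le hx.le).1 this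
  · rw [← integral_Ioc_eq_integral_Ioo, ← intervalIntegral.integral_of_le hx.le,
      intervalIntegral.integral_comp_sub_right (fun t => t ^ (-α - 1)),
      integral_rpow (Or.inr ⟨by linarith [hα.1], h0⟩), rlKernel_of_pos (by linarith),
      rlKernel_of_pos (by linarith)]
    have := hα.1.ne'
    rw [show -α - 1 + 1 = -α by ring, show 1 - α - 1 = -α by ring]
    field_simp
    ring

theorem integrableOn_tailDeriv {α a b x M : ℝ} (hα : α ∈ Ioo (0 : ℝ) 1) {w : ℝ → ℝ}
    (hw : Measurable w) (hM : ∀ y ∈ Ioo a b, |w y| ≤ M) (hx : b < x) :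
    IntegrableOn (tailDeriv α a b w) (Ioo b x) ∧ ∫ t in Ioo b x, tailDeriv α a b w t =
      fracIntegral .left (1 - α) ((Ioo a b).indicator w) x -
        fracIntegral .left (1 - α) ((Ioo a b).indicator w) b := by
  have h1α : 0 < 1 - α := sub_pos.2 hα.2
  set W := (Ioo a b).indicator w with hW
  have hWm : Measurable W := hw.indicator measurableSet_Ioo
  have hWb : ∀ y, |W y| ≤ |M| := fun y => by
    by_cases hy : y ∈ Ioo a b
    · rw [hW, indicator_of_mem hy]; exact (hM y hy).trans (le_abs_self M)
    · rw [hW, indicator_of_notMem hy, abs_zero]; exact abs_nonneg _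
  have hWi : ∀ z, Integrable fun y => rlKernel (1 - α) (z - y) * W y := fun z =>
    integrable_rlKernel_mul_of_bdd h1α hWm.aestronglyMeasurable hWb (indicator_Ioo_eq_zero w) z
  set F : ℝ × ℝ → ℝ := fun q => (q.1 - q.2) ^ (-α - 1) * w q.2 with hF
  have hFm : Measurable F := by fun_prop
  have hint : Integrable F ((volume.restrict (Ioo b x)).prod (volume.restrict (Ioo a b))) := by
    refine (integrable_prod_iff' hFm.aestronglyMeasurable).2 ⟨?_, ?_⟩
    · filter_upwards [ae_restrict_mem measurableSet_Ioo] with y hy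
      exact (integral_shifted_rpow hα hy.2 hx).1.mul_const (w y)
    · have h : IntegrableOn (fun y => α⁻¹ * (|rlKernel (1 - α) (b - y) * W y| -
          |rlKernel (1 - α) (x - y) * W y|)) (Ioo a b) :=
        (((hWi b).abs.sub (hWi x).abs).const_mul α⁻¹).integrableOn
      refine h.congr_fun (fun y hy => ?_) measurableSet_Ioo
      have e : ∫ t in Ioo b x, ‖F (t, y)‖ = (∫ t in Ioo b x, (t - y) ^ (-α - 1)) * |w y| := by
        rw [← integral_mul_const]
        refine setIntegral_congr_fun measurableSet_Ioo fun t ht => ?_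
        simp only [hF]
        rw [norm_mul, Real.norm_of_nonneg (Real.rpow_nonneg (by linarith [ht.1, hy.2]) _),
          Real.norm_eq_abs]
      dsimp only
      rw [e, (integral_shifted_rpow hα hy.2 hx).2, hW, indicator_of_mem hy, abs_mul, abs_mul,
        abs_of_nonneg (rlKernel_nonneg _ _), abs_of_nonneg (rlKernel_nonneg _ _)]
      ring
  constructor
  · exact hint.integral_prod_left.const_mul _
  · have hswap := integral_integral_swap (f := fun t y => F (t, y)) hint
    simp only [tailDeriv]
    rw [integral_const_mul]
    have e1 : ∫ t in Ioo b x, ∫ y in Ioo a b, (t - y) ^ (-α - 1) * w y =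
        ∫ y in Ioo a b, ∫ t in Ioo b x, (t - y) ^ (-α - 1) * w y := hswap
    have e2 : ∫ y in Ioo a b, ∫ t in Ioo b x, (t - y) ^ (-α - 1) * w y =
        ∫ y, α⁻¹ * (rlKernel (1 - α) (b - y) * W y - rlKernel (1 - α) (x - y) * W y) := by
      rw [← integral_indicator measurableSet_Ioo]
      congr 1
      ext y
      by_cases hy : y ∈ Ioo a b
      · rw [indicator_of_mem hy, integral_mul_const, (integral_shifted_rpow hα hy.2 hx).2, hW,
          indicator_of_mem hy]
        ring
      · rw [indicator_of_notMem hy, hW, indicator_of_notMem hy]; ring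
    rw [e1, e2, integral_const_mul, integral_sub (hWi b) (hWi x), fracIntegral_left_eq,
      fracIntegral_left_eq]
    have := hα.1.ne'
    field_simp
    ring

section

variable {α : ℝ} {p : ℝ≥0∞} {a b : ℝ} {V : ℝ → ℝ}

/-- The fractional integral of order `1 - α` of the extension by zero of `I^α V` is the primitive
of `V` continued by the tail. -/
theorem fracIntegral_extension_eq (hα : α ∈ Ioo (0 : ℝ) 1) (hp1 : 1 < p) (hptop : p ≠ ⊤)
    (hαp : 1 < α * p.toReal) (hV : MemLp V p) (hVi : Integrable V)
    (h0 : ∀ y, y ∉ Ioo a b → V y = 0) (x : ℝ) :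
    IntegrableOn (fun y => V y + (Ioi b).indicator (tailDeriv α a b (fracIntegral .left α V)) y)
      (Iio x) ∧
    fracIntegral .left (1 - α) ((Ioo a b).indicator (fracIntegral .left α V)) x =
      ∫ y in Iio x, (V y + (Ioi b).indicator (tailDeriv α a b (fracIntegral .left α V)) y) := by
  have h1α : 0 < 1 - α := sub_pos.2 hα.2
  have ha0 : ∀ y < a, V y = 0 := fun y hy => h0 y fun h => h.1.not_gt hy
  set w := fracIntegral .left α V with hw
  have hwc : Continuous w := continuous_fracIntegral_left hα hp1 hptop hαp hV hVi ha0
  obtain ⟨C, hC0, hC⟩ := exists_fracIntegral_left_bound hα.1 hp1 hptop hαp a b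
  have hM : ∀ y ∈ Ioo a b, |w y| ≤ C * (eLpNorm V p volume).toReal := fun y hy =>
    hC V hV ha0 y hy.2.le
  set T := (Ioi b).indicator (tailDeriv α a b w) with hT
  -- the identity up to `b`
  have hle : ∀ z ≤ b, fracIntegral .left (1 - α) ((Ioo a b).indicator w) z = ∫ y in Iio z, V y := by
    intro z hz
    have e1 : fracIntegral .left (1 - α) ((Ioo a b).indicator w) z =
        fracIntegral .left (1 - α) w z := by
      refine fracIntegral_left_congr ?_
      rw [EventuallyEq, ae_restrict_iff' measurableSet_Iio]
      refine Eventually.of_forall fun y hy => ?_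
      rcases le_or_gt y a with h | h
      · rw [indicator_of_notMem (fun h' => h'.1.not_ge h), hw, fracIntegral_left_eq_zero ha0 h]
      · exact indicator_of_mem (show y ∈ Ioo a b from ⟨h, (mem_Iio.1 hy).trans_le hz⟩) _
    have e2 := fracIntegral_left_comp h1α hα.1 (x := z) hVi.aestronglyMeasurable
      (integrableOn_pow_mul (by linarith) hVi ha0 z)
    rw [e1, hw, e2, sub_add_cancel, fracIntegral_left_one]
  rcases le_or_gt x b with hx | hx
  · have e : EqOn (fun y => V y + T y) V (Iio x) := fun y hy => by
      simp only [hT]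
      rw [indicator_of_notMem (notMem_Ioi.2 ((mem_Iio.1 hy).le.trans hx)), add_zero]
    exact ⟨hVi.integrableOn.congr_fun e.symm measurableSet_Iio,
      (hle x hx).trans (setIntegral_congr_fun measurableSet_Iio e.symm)⟩
  · obtain ⟨i1, i2⟩ := integrableOn_tailDeriv hα hwc.measurable hM hx
    have hTi : IntegrableOn T (Iio x) := by
      have : Integrable ((Ioo b x).indicator (tailDeriv α a b w)) :=
        (integrable_indicator_iff measurableSet_Ioo).2 i1
      refine this.integrableOn.congr_fun (fun y hy => ?_) measurableSet_Iio
      by_cases h : b < y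
      · rw [hT, indicator_of_mem (mem_Ioi.2 h), indicator_of_mem (show y ∈ Ioo b x from ⟨h, hy⟩)]
      · rw [hT, indicator_of_notMem (notMem_Ioi.2 (not_lt.1 h)), indicator_of_notMem
          (fun h' => h h'.1)]
    have e3 : ∫ y in Iio x, T y = ∫ y in Ioo b x, tailDeriv α a b w y := by
      rw [hT, setIntegral_indicator measurableSet_Ioi, Iio_inter_Ioi]
    have e4 : ∫ y in Iio x, V y = ∫ y in Iio b, V y := by
      rw [setIntegral_eq_integral_of_forall_compl_eq_zero, setIntegral_eq_integral_of_forall_compl_eq_zero]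
      · exact fun y hy => h0 y fun h => hy h.2
      · exact fun y hy => h0 y fun h => hy (h.2.trans hx)
    refine ⟨hVi.integrableOn.add hTi, ?_⟩
    rw [integral_add hVi.integrableOn hTi, e3, i2, e4, ← hle b le_rfl]
    ring

theorem isGlobalWeakDeriv_extension (hα : α ∈ Ioo (0 : ℝ) 1) (hp1 : 1 < p) (hptop : p ≠ ⊤)
    (hαp : 1 < α * p.toReal) (hV : MemLp V p) (hVi : Integrable V)
    (h0 : ∀ y, y ∉ Ioo a b → V y = 0) :
    IsGlobalWeakDeriv .left α ((Ioo a b).indicator (fracIntegral .left α V))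
      (fun y => V y + (Ioi b).indicator (tailDeriv α a b (fracIntegral .left α V)) y) := by
  intro φ h1 h2
  have h1α : 0 < 1 - α := sub_pos.2 hα.2
  have ha0 : ∀ y < a, V y = 0 := fun y hy => h0 y fun h => h.1.not_gt hy
  have hext := fracIntegral_extension_eq hα hp1 hptop hαp hV hVi h0
  set w := fracIntegral .left α V with hw
  have hwc : Continuous w := continuous_fracIntegral_left hα hp1 hptop hαp hV hVi ha0
  have hUi : Integrable ((Ioo a b).indicator w) := (integrable_indicator_iff measurableSet_Ioo).2
    ((hwc.integrableOn_Icc).mono_set Ioo_subset_Icc_self)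
  set E : ℝ → ℝ := fun y => V y + (Ioi b).indicator (tailDeriv α a b w) y with hE
  obtain ⟨R, hR⟩ := h2.isCompact.bddAbove
  have hφ0 : ∀ x, R < x → φ x = 0 := fun x hx =>
    image_eq_zero_of_notMem_tsupport fun h => (hR h).not_gt hx
  have hφ0' : ∀ x, R < x → deriv φ x = 0 := fun x hx =>
    image_eq_zero_of_notMem_tsupport fun h => (hR (tsupport_deriv_subset h)).not_gt hx
  set S := R + 1
  have hEi : Integrable ((Iio S).indicator E) :=
    (integrable_indicator_iff measurableSet_Iio).2 (hext S).1
  have e1 : ∫ x, E x * φ x = ∫ x, (Iio S).indicator E x * φ x := by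
    congr 1
    ext x
    rcases lt_or_ge x S with h | h
    · rw [indicator_of_mem (mem_Iio.2 h)]
    · rw [hφ0 x (by linarith), mul_zero, mul_zero]
  have e2 := integral_primitive_mul_deriv hEi (h1.of_le (by simp)) h2
  have e3 := integral_mul_fracIntegral_right h1α (by linarith [hα.1]) hUi
    (h1.continuous_deriv (by simp)) h2.deriv
  have e4 : ∫ x, fracIntegral .left 1 ((Iio S).indicator E) x * deriv φ x =
      ∫ x, fracIntegral .left (1 - α) ((Ioo a b).indicator w) x * deriv φ x := by
    congr 1
    ext x
    rcases lt_or_ge x S with h | h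
    · rw [(hext x).2, fracIntegral_left_one]
      congr 1
      refine setIntegral_congr_fun measurableSet_Iio fun y hy => ?_
      exact indicator_of_mem (mem_Iio.2 ((mem_Iio.1 hy).trans h)) _
    · rw [hφ0' x (by linarith), mul_zero, mul_zero]
  simp only [Side.opp, rlDeriv_right_eq hα.2 h1 h2, mul_neg, integral_neg]
  rw [e1, e3, ← e4, e2, neg_neg]

/-- A function of the left space that is a fractional integral and vanishes at `b` extends by zero
to a function with a weak fractional derivative in `L^p` on the whole line. -/
theorem exists_isGlobalWeakDeriv_left {u v : ℝ → ℝ} (hα : α ∈ Ioo (0 : ℝ) 1) (hp1 : 1 < p)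
    (hptop : p ≠ ⊤) (hαp : 1 < α * p.toReal) (hv : MemLp v p (volume.restrict (Ioo a b)))
    (hu : u =ᵐ[volume.restrict (Ioo a b)] fracIntegral .left α ((Ioo a b).indicator v))
    (hb : fracIntegral .left α ((Ioo a b).indicator v) b = 0) :
    ∃ W, MemLp W p ∧ W =ᵐ[volume.restrict (Ioo a b)] v ∧
      IsGlobalWeakDeriv .left α ((Ioo a b).indicator u) W := by
  set v' := hv.aestronglyMeasurable.mk v with hv'
  have hvv' : v =ᵐ[volume.restrict (Ioo a b)] v' := hv.aestronglyMeasurable.ae_eq_mk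
  have hm : Measurable v' := hv.aestronglyMeasurable.stronglyMeasurable_mk.measurable
  have hvp : MemLp v' p (volume.restrict (Ioo a b)) := hv.ae_eq hvv'
  set V := (Ioo a b).indicator v' with hVdef
  have hae : (Ioo a b).indicator v =ᵐ[volume] V := by
    rw [ae_eq_restrict_iff_indicator_ae_eq measurableSet_Ioo] at hvv'
    exact hvv'
  have hfr : fracIntegral .left α ((Ioo a b).indicator v) = fracIntegral .left α V :=
    funext fun x => fracIntegral_left_congr (ae_restrict_of_ae hae)
  rw [hfr] at hu hb
  have hV := memLp_indicator hvp
  have hVi := integrable_indicator_of_memLp hp1.le hvp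
  have hVm : Measurable V := hm.indicator measurableSet_Ioo
  have h0 : ∀ y, y ∉ Ioo a b → V y = 0 := fun y hy => indicator_of_notMem hy _
  refine ⟨_, hV.add (memLp_tailDeriv hα hp1 hptop hαp hVm hV hVi h0 hb), ?_, ?_⟩
  · filter_upwards [hvv', ae_restrict_mem measurableSet_Ioo] with x hx hxm
    rw [Pi.add_apply, hVdef, indicator_of_mem hxm, indicator_of_notMem
      (notMem_Ioi.2 hxm.2.le), add_zero, hx]
  · intro φ h1 h2
    have h := isGlobalWeakDeriv_extension hα hp1 hptop hαp hV hVi h0 φ h1 h2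
    refine h.trans (integral_congr_ae ?_)
    rw [ae_eq_restrict_iff_indicator_ae_eq measurableSet_Ioo] at hu
    filter_upwards [hu] with x hx
    rw [hx]

end

/-! ### Affine changes of variables and mollification -/

theorem integral_comp_affine {c : ℝ} (hc : 0 < c) (d : ℝ) (f : ℝ → ℝ) :
    ∫ x, f (c * x + d) = c⁻¹ * ∫ x, f x := by
  rw [Measure.integral_comp_mul_left (fun y => f (y + d)) c, integral_add_right_eq_self f d,
    abs_of_pos (inv_pos.2 hc), smul_eq_mul]

theorem fracIntegral_comp_affine (s : Side) (β : ℝ) {c : ℝ} (hc : 0 < c) (d : ℝ) (f : ℝ → ℝ)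
    (x : ℝ) : fracIntegral s β (fun y => f (c * y + d)) x =
      c ^ (-β) * fracIntegral s β f (c * x + d) := by
  have hk : ∀ t, rlKernel β t = c ^ (1 - β) * rlKernel β (c * t) := fun t => by
    rw [mul_comm c t, rlKernel_mul β hc, ← mul_assoc, ← Real.rpow_add hc]
    simp
  have hcc : c ^ (1 - β) * c⁻¹ = c ^ (-β) := by
    rw [← Real.rpow_neg_one c, ← Real.rpow_add hc]; congr 1; ring
  cases s with
  | left =>
    have := integral_comp_affine hc d fun y => rlKernel β (c * x + d - y) * f y
    rw [fracIntegral_left_eq, fracIntegral_left_eq]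
    simp only [hk (x - _), mul_assoc]
    rw [integral_const_mul, ← hcc]
    rw [show (∫ y, rlKernel β (c * (x - y)) * f (c * y + d)) = c⁻¹ * ∫ y, rlKernel β
      (c * x + d - y) * f y by rw [← this]; congr 1; ext y; congr 2; ring]
    ring
  | right =>
    have := integral_comp_affine hc d fun y => rlKernel β (y - (c * x + d)) * f y
    rw [fracIntegral_right_eq, fracIntegral_right_eq]
    simp only [hk (_ - x), mul_assoc]
    rw [integral_const_mul, ← hcc]
    rw [show (∫ y, rlKernel β (c * (y - x)) * f (c * y + d)) = c⁻¹ * ∫ y, rlKernel β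
      (y - (c * x + d)) * f y by rw [← this]; congr 1; ext y; congr 2; ring]
    ring

theorem rlDeriv_comp_affine (s : Side) (α : ℝ) {c : ℝ} (hc : 0 < c) (d : ℝ) (f : ℝ → ℝ)
    (x : ℝ) : rlDeriv s α (fun y => f (c * y + d)) x = c ^ α * rlDeriv s α f (c * x + d) := by
  have key : ∀ s, deriv (fracIntegral s (1 - α) fun y => f (c * y + d)) x =
      c ^ α * deriv (fracIntegral s (1 - α) f) (c * x + d) := by
    intro s
    rw [show (fracIntegral s (1 - α) fun y => f (c * y + d)) = fun x =>
      c ^ (-(1 - α)) * fracIntegral s (1 - α) f (c * x + d) from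
        funext fun x => fracIntegral_comp_affine s (1 - α) hc d f x]
    rw [deriv_const_mul_field, deriv_comp_mul_left c (fun y => fracIntegral s (1 - α) f (y + d)),
      deriv_comp_add_const, smul_eq_mul, ← mul_assoc, ← Real.rpow_add_one hc.ne']
    congr 2; ring
  cases s with
  | left => exact key .left
  | right => rw [rlDeriv, rlDeriv, key .right, mul_neg]

theorem contDiff_comp_affine {f : ℝ → ℝ} (h : ContDiff ℝ ∞ f) (c d : ℝ) :
    ContDiff ℝ ∞ fun y => f (c * y + d) :=
  h.comp ((contDiff_const.mul contDiff_id).add contDiff_const)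

theorem hasCompactSupport_comp_affine {f : ℝ → ℝ} (h : HasCompactSupport f) {c : ℝ} (hc : 0 < c)
    (d : ℝ) : HasCompactSupport fun y => f (c * y + d) :=
  h.comp_homeomorph ((Homeomorph.mulLeft₀ c hc.ne').trans (Homeomorph.addRight d))

theorem IsGlobalWeakDeriv.comp_affine {s : Side} {α : ℝ} {U W : ℝ → ℝ}
    (h : IsGlobalWeakDeriv s α U W) {c : ℝ} (hc : 0 < c) (d : ℝ) :
    IsGlobalWeakDeriv s α (fun x => U (c * x + d)) (fun x => c ^ α * W (c * x + d)) := by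
  intro φ h1 h2
  have hci : 0 < c⁻¹ := inv_pos.2 hc
  have e := h _ (contDiff_comp_affine h1 c⁻¹ (-(c⁻¹ * d)))
    (hasCompactSupport_comp_affine h2 hci (-(c⁻¹ * d)))
  have hinv : ∀ x, c⁻¹ * (c * x + d) + -(c⁻¹ * d) = x := fun x => by field_simp; ring
  have e1 := integral_comp_affine hc d fun y => W y * φ (c⁻¹ * y + -(c⁻¹ * d))
  have e2 := integral_comp_affine hc d fun y =>
    U y * rlDeriv s.opp α (fun y => φ (c⁻¹ * y + -(c⁻¹ * d))) y
  simp only [hinv] at e1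
  rw [e] at e1
  rw [← e1] at e2
  simp only [rlDeriv_comp_affine s.opp α hci, hinv] at e2
  have hca : c ^ α * c⁻¹ ^ α = 1 := by
    rw [← Real.mul_rpow hc.le hci.le, mul_inv_cancel₀ hc.ne', Real.one_rpow]
  calc ∫ x, c ^ α * W (c * x + d) * φ x = c ^ α * ∫ x, W (c * x + d) * φ x := by
        rw [← integral_const_mul]; simp only [mul_assoc]
    _ = c ^ α * ∫ x, c⁻¹ ^ α * (U (c * x + d) * rlDeriv s.opp α φ x) := by
        rw [← e2]; congr 2; ext x; ring
    _ = _ := by rw [integral_const_mul, ← mul_assoc, hca, one_mul]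

theorem exists_abs_rlDeriv_le (s : Side) {α : ℝ} (hα : α ∈ Ioo (0 : ℝ) 1) {φ : ℝ → ℝ}
    (h1 : ContDiff ℝ ∞ φ) (h2 : HasCompactSupport φ) : ∃ C, ∀ x, |rlDeriv s α φ x| ≤ C := by
  have key : ∀ φ : ℝ → ℝ, ContDiff ℝ ∞ φ → HasCompactSupport φ →
      ∃ C, ∀ x, |rlDeriv .right α φ x| ≤ C := by
    intro φ h1 h2
    obtain ⟨C, hC⟩ := exists_integral_rlKernel_mul_le (sub_pos.2 hα.2) (by linarith [hα.1])
      (h1.continuous_deriv (by simp)) h2.deriv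
    have hΓ := Real.Gamma_pos_of_pos (sub_pos.2 hα.2)
    refine ⟨1 / Real.Gamma (1 - α) * C, fun x => ?_⟩
    rw [rlDeriv_right_eq hα.2 h1 h2, abs_neg, fracIntegral_right_eq, abs_mul,
      abs_of_pos (by positivity)]
    refine mul_le_mul_of_nonneg_left (abs_integral_le_integral_abs.trans (le_trans (le_of_eq ?_)
      (hC x))) (by positivity)
    simp only [abs_mul, abs_of_nonneg (rlKernel_nonneg _ _)]
  cases s with
  | right => exact key φ h1 h2
  | left =>
    obtain ⟨C, hC⟩ := key _ (h1.comp contDiff_neg) (hasCompactSupport_comp_neg h2)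
    exact ⟨C, fun x => by rw [rlDeriv_left_eq_right]; exact hC (-x)⟩

theorem continuous_rlDeriv' (s : Side) {α : ℝ} (hα : α < 1) {φ : ℝ → ℝ}
    (h1 : ContDiff ℝ ∞ φ) (h2 : HasCompactSupport φ) : Continuous (rlDeriv s α φ) := by
  obtain ⟨R, hR⟩ := h2.isCompact.isBounded.subset_closedBall 0
  rw [Real.closedBall_eq_Icc] at hR
  exact continuous_rlDeriv s (a := 0 - R - 1) (b := 0 + R + 1) hα
    ⟨h1, h2, hR.trans (Icc_subset_Ioo (by linarith) (by linarith))⟩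

section

variable (ρ : ContDiffBump (0 : ℝ))

/-- Mollification of a real function. -/
def mollify (f : ℝ → ℝ) : ℝ → ℝ :=
  convolution (ρ.normed volume) f (ContinuousLinearMap.lsmul ℝ ℝ) volume

theorem mollify_apply (f : ℝ → ℝ) (x : ℝ) :
    mollify ρ f x = ∫ h, ρ.normed volume h * f (x - h) := rfl

theorem contDiff_mollify {f : ℝ → ℝ} (hf : LocallyIntegrable f) : ContDiff ℝ ∞ (mollify ρ f) :=
  ρ.hasCompactSupport_normed.contDiff_convolution_left _ ρ.contDiff_normed hf

theorem normed_eq_zero {h : ℝ} (hh : ρ.rOut ≤ |h|) : ρ.normed volume h = 0 := by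
  by_contra hne
  have : h ∈ Function.support (ρ.normed volume) := hne
  rw [ρ.support_normed_eq, mem_ball_zero_iff, Real.norm_eq_abs] at this
  exact this.not_ge hh

theorem integral_mollify_mul {f ψ : ℝ → ℝ} (hf : Integrable f) (hψ : Continuous ψ) {C : ℝ}
    (hC : ∀ x, |ψ x| ≤ C) :
    ∫ x, mollify ρ f x * ψ x = ∫ h, ρ.normed volume h * ∫ x, f (x - h) * ψ x := by
  have hi : Integrable (fun q : ℝ × ℝ => ρ.normed volume q.2 * f (q.1 - q.2) * ψ q.1)
      (volume.prod volume) := by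
    have h1 : Integrable (fun q : ℝ × ℝ => ρ.normed volume q.2 * f (q.1 - q.2))
        (volume.prod volume) :=
      ρ.integrable_normed.convolution_integrand (ContinuousLinearMap.lsmul ℝ ℝ) hf
    exact h1.mul_bdd (c := C) (hψ.comp continuous_fst).aestronglyMeasurable
      (Eventually.of_forall fun q => hC q.1)
  have := integral_integral_swap (f := fun x h => ρ.normed volume h * f (x - h) * ψ x) hi
  simp only [mollify_apply, ← integral_mul_const, ← integral_const_mul, ← mul_assoc]
  exact this

theorem IsGlobalWeakDeriv.mollify {s : Side} {α : ℝ} (hα : α ∈ Ioo (0 : ℝ) 1) {U W : ℝ → ℝ}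
    (hU : Integrable U) (hW : LocallyIntegrable W) (h : IsGlobalWeakDeriv s α U W) :
    IsGlobalWeakDeriv s α (mollify ρ U) (mollify ρ W) := by
  intro φ h1 h2
  obtain ⟨C, hC⟩ := exists_abs_rlDeriv_le s.opp hα h1 h2
  obtain ⟨M, hM⟩ := h2.exists_bound_of_continuous h1.continuous
  rw [integral_mollify_mul ρ hU (continuous_rlDeriv' _ hα.2 h1 h2) hC]
  obtain ⟨R, hR⟩ := h2.isCompact.isBounded.subset_closedBall 0
  have hφ0 : ∀ x, R < |x| → φ x = 0 := fun x hx => image_eq_zero_of_notMem_tsupport fun h => by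
    have := hR h
    rw [mem_closedBall_zero_iff, Real.norm_eq_abs] at this
    linarith
  set K := Metric.closedBall (0 : ℝ) (R + ρ.rOut)
  have hWK : Integrable (K.indicator W) :=
    (integrable_indicator_iff Metric.isClosed_closedBall.measurableSet).2
      (hW.integrableOn_isCompact (isCompact_closedBall _ _))
  have hK : ∀ x h, φ x ≠ 0 → |h| < ρ.rOut → K.indicator W (x - h) = W (x - h) := fun x h hx hh => by
    refine indicator_of_mem (mem_closedBall_zero_iff.2 ?_) _
    have : |x| ≤ R := by by_contra hcon; exact hx (hφ0 x (not_le.1 hcon))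
    rw [Real.norm_eq_abs]
    linarith [abs_sub x h]
  have e1 : ∫ x, FracSob.mollify ρ W x * φ x =
      ∫ x, FracSob.mollify ρ (K.indicator W) x * φ x := by
    congr 1
    ext x
    by_cases hx : φ x = 0
    · rw [hx, mul_zero, mul_zero]
    · rw [mollify_apply, mollify_apply]
      congr 2
      ext h
      rcases lt_or_ge |h| ρ.rOut with hh | hh
      · rw [hK x h hx hh]
      · rw [normed_eq_zero ρ hh, zero_mul, zero_mul]
  rw [e1, integral_mollify_mul ρ hWK h1.continuous hM]
  congr 1
  ext t
  rcases lt_or_ge |t| ρ.rOut with ht | ht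
  swap
  · rw [normed_eq_zero ρ ht, zero_mul, zero_mul]
  congr 1
  have e2 : ∫ x, K.indicator W (x - t) * φ x = ∫ x, W (x - t) * φ x := by
    congr 1
    ext x
    by_cases hx : φ x = 0
    · rw [hx, mul_zero, mul_zero]
    · rw [hK x t hx ht]
  have e3 := h.comp_affine one_pos (-t) φ h1 h2
  simp only [one_mul, Real.one_rpow, ← sub_eq_add_neg] at e3
  rw [e2, e3]

end

/-! ### Convergence of dilated mollifications -/

section

variable {p : ℝ≥0∞}

theorem lintegral_normed (ρ : ContDiffBump (0 : ℝ)) :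
    ∫⁻ h, ENNReal.ofReal (ρ.normed volume h) = 1 := by
  rw [← ofReal_integral_eq_lintegral_ofReal ρ.integrable_normed
    (Eventually.of_forall ρ.nonneg_normed), ρ.integral_normed, ENNReal.ofReal_one]

theorem eLpNorm_mollify_le_of_measurable (ρ : ContDiffBump (0 : ℝ)) (hp1 : 1 < p) (hptop : p ≠ ⊤)
    {f : ℝ → ℝ} (hf : Measurable f) :
    eLpNorm (mollify ρ f) p volume ≤ eLpNorm f p volume := by
  have hp0 : p ≠ 0 := (zero_lt_one.trans hp1).ne'
  have hP : 1 < p.toReal := by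
    rw [← ENNReal.toReal_one]; exact (ENNReal.toReal_lt_toReal ENNReal.one_ne_top hptop).2 hp1
  rw [eLpNorm_eq_lintegral_rpow_enorm_toReal hp0 hptop,
    eLpNorm_eq_lintegral_rpow_enorm_toReal hp0 hptop]
  refine ENNReal.rpow_le_rpow ?_ (by positivity)
  have hwt : Measurable fun h => ENNReal.ofReal (ρ.normed volume h) :=
    ρ.continuous_normed.measurable.ennreal_ofReal
  set ν := (volume : Measure ℝ).withDensity fun h => ENNReal.ofReal (ρ.normed volume h) with hν
  have hν1 : ν univ = 1 := by
    rw [hν, withDensity_apply _ MeasurableSet.univ, Measure.restrict_univ, lintegral_normed]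
  have : IsProbabilityMeasure ν := ⟨hν1⟩
  have hF : Measurable fun q : ℝ × ℝ => ‖f (q.1 - q.2)‖ₑ := by fun_prop
  have h1 : ∀ x, ‖mollify ρ f x‖ₑ ^ p.toReal ≤ ∫⁻ h, ‖f (x - h)‖ₑ ^ p.toReal ∂ν := fun x => by
    have h2 : ‖mollify ρ f x‖ₑ ≤ ∫⁻ h, ‖f (x - h)‖ₑ ∂ν := by
      rw [mollify_apply, hν, lintegral_withDensity_eq_lintegral_mul _ hwt (by fun_prop)]
      refine (enorm_integral_le_lintegral_enorm _).trans_eq (lintegral_congr fun h => ?_)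
      rw [enorm_mul, Real.enorm_of_nonneg (ρ.nonneg_normed h)]
      rfl
    refine (ENNReal.rpow_le_rpow h2 (by positivity)).trans ?_
    have := lintegral_rpow_le ν hP (g := fun h => ‖f (x - h)‖ₑ) (by fun_prop)
    rwa [hν1, ENNReal.one_rpow, one_mul] at this
  calc ∫⁻ x, ‖mollify ρ f x‖ₑ ^ p.toReal ≤ ∫⁻ x, ∫⁻ h, ‖f (x - h)‖ₑ ^ p.toReal ∂ν :=
        lintegral_mono h1
    _ = ∫⁻ h, (∫⁻ x, ‖f (x - h)‖ₑ ^ p.toReal) ∂ν :=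
        lintegral_lintegral_swap (hF.pow_const _).aemeasurable
    _ = ∫⁻ x, ‖f x‖ₑ ^ p.toReal := by
        simp only [fun h => lintegral_sub_right_eq_self (μ := volume)
          (fun x => ‖f x‖ₑ ^ p.toReal) h, lintegral_const, hν1, mul_one]

theorem mollify_congr (ρ : ContDiffBump (0 : ℝ)) {f g : ℝ → ℝ} (h : f =ᵐ[volume] g) :
    mollify ρ f = mollify ρ g :=
  convolution_congr _ EventuallyEq.rfl h

theorem eLpNorm_mollify_le (ρ : ContDiffBump (0 : ℝ)) (hp1 : 1 < p) (hptop : p ≠ ⊤)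
    {f : ℝ → ℝ} (hf : AEStronglyMeasurable f volume) :
    eLpNorm (mollify ρ f) p volume ≤ eLpNorm f p volume := by
  rw [mollify_congr ρ hf.ae_eq_mk, eLpNorm_congr_ae hf.ae_eq_mk]
  exact eLpNorm_mollify_le_of_measurable ρ hp1 hptop hf.stronglyMeasurable_mk.measurable

theorem eLpNorm_comp_affine_le {c : ℝ} (hc : 1 ≤ c) (d : ℝ) {f : ℝ → ℝ} (hf : Continuous f) :
    eLpNorm (fun x => f (c * x + d)) p volume ≤ eLpNorm f p volume := by
  have hc0 : 0 < c := zero_lt_one.trans_le hc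
  have hfd : Continuous fun y => f (y + d) := hf.comp (continuous_add_const d)
  have e := eLpNorm_map_measure (p := p) (μ := volume) (f := fun x : ℝ => c * x)
    (g := fun y => f (y + d)) hfd.aestronglyMeasurable (measurable_const_mul c).aemeasurable
  have e2 := eLpNorm_comp_measurePreserving (p := p) hf.aestronglyMeasurable
    (measurePreserving_add_right volume d)
  refine e.symm.le.trans (le_trans ?_ e2.le)
  rw [Real.map_volume_mul_left hc0.ne']
  refine eLpNorm_mono_measure _ (Measure.le_iff.2 fun s _ => ?_)
  rw [Measure.smul_apply, smul_eq_mul]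
  refine mul_le_of_le_one_left zero_le (ENNReal.ofReal_le_one.2 ?_)
  rw [abs_of_pos (inv_pos.2 hc0)]
  exact inv_le_one_of_one_le₀ hc

/-- Mollification followed by the dilation with center `m` and ratio `c⁻¹`. -/
def dilMollify (ρ : ContDiffBump (0 : ℝ)) (c m : ℝ) (f : ℝ → ℝ) (x : ℝ) : ℝ :=
  mollify ρ f (c * x + (1 - c) * m)

theorem continuous_dilMollify (ρ : ContDiffBump (0 : ℝ)) (c m : ℝ) {f : ℝ → ℝ}
    (hf : LocallyIntegrable f) : Continuous (dilMollify ρ c m f) :=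
  (contDiff_mollify ρ hf).continuous.comp (by fun_prop)

theorem eLpNorm_dilMollify_le (ρ : ContDiffBump (0 : ℝ)) {c : ℝ} (hc : 1 ≤ c) (m : ℝ) (hp1 : 1 < p)
    (hptop : p ≠ ⊤) {f : ℝ → ℝ} (hf : MemLp f p volume) :
    eLpNorm (dilMollify ρ c m f) p volume ≤ eLpNorm f p volume :=
  (eLpNorm_comp_affine_le hc _ (contDiff_mollify ρ (hf.locallyIntegrable hp1.le)).continuous).trans
    (eLpNorm_mollify_le ρ hp1 hptop hf.1)

theorem mollify_eq_zero (ρ : ContDiffBump (0 : ℝ)) {f : ℝ → ℝ} {m R x : ℝ}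
    (hf : ∀ y, R ≤ |y - m| → f y = 0) (hx : R + ρ.rOut ≤ |x - m|) : mollify ρ f x = 0 := by
  rw [mollify_apply]
  refine integral_eq_zero_of_ae (Eventually.of_forall fun h => ?_)
  simp only [Pi.zero_apply, mul_eq_zero]
  by_cases hh : ρ.rOut ≤ |h|
  · exact Or.inl (normed_eq_zero ρ hh)
  · refine Or.inr (hf _ ?_)
    have h1 : |x - m| ≤ |x - h - m| + |h| := by
      simpa using abs_add_le (x - h - m) h |>.trans_eq' (by congr 1; ring)
    linarith

theorem dilMollify_eq_zero (ρ : ContDiffBump (0 : ℝ)) {c : ℝ} (hc : 0 < c) {f : ℝ → ℝ} {m R x : ℝ}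
    (hf : ∀ y, R ≤ |y - m| → f y = 0) (hx : R + ρ.rOut ≤ c * |x - m|) :
    dilMollify ρ c m f x = 0 := by
  refine mollify_eq_zero ρ hf ?_
  rwa [show c * x + (1 - c) * m - m = c * (x - m) by ring, abs_mul, abs_of_pos hc]

theorem tendsto_dilMollify_of_continuous {ρ : ℕ → ContDiffBump (0 : ℝ)} {c : ℕ → ℝ}
    (hρ : Tendsto (fun n => (ρ n).rOut) atTop (nhds 0)) (hc : ∀ n, 1 ≤ c n)
    (hc1 : Tendsto c atTop (nhds 1)) (m : ℝ) (hptop : p ≠ ⊤) {g : ℝ → ℝ}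
    (hg : Continuous g) (hgc : HasCompactSupport g) :
    Tendsto (fun n => eLpNorm (dilMollify (ρ n) (c n) m g - g) p volume) atTop (nhds 0) := by
  obtain ⟨R, hR0, hR⟩ := hgc.isCompact.isBounded.subset_ball_lt 0 m
  have hg0 : ∀ y, R ≤ |y - m| → g y = 0 := fun y hy => image_eq_zero_of_notMem_tsupport fun h => by
    have := hR h
    rw [Metric.mem_ball, Real.dist_eq] at this
    linarith
  set s := Metric.closedBall m (R + 1)
  set M := (volume s) ^ (1 / p.toReal) with hM
  have hMt : M ≠ ⊤ := ENNReal.rpow_ne_top_of_nonneg (by positivity) measure_closedBall_lt_top.ne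
  have hu := hgc.uniformContinuous_of_continuous hg
  rw [ENNReal.tendsto_nhds_zero]
  intro ε hε
  obtain ⟨η, hη, hηε⟩ : ∃ η : ℝ, 0 < η ∧ ENNReal.ofReal η * M ≤ ε := by
    have : Tendsto (fun η : ℝ => ENNReal.ofReal η * M) (nhdsWithin 0 (Ioi 0)) (nhds 0) := by
      have h := ENNReal.Tendsto.mul_const (b := M) (ENNReal.tendsto_ofReal
        (tendsto_id (α := ℝ) (x := nhds 0))) (Or.inr hMt)
      simp only [id, ENNReal.ofReal_zero, zero_mul] at h
      exact h.mono_left nhdsWithin_le_nhds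
    have := ((ENNReal.tendsto_nhds_zero.1 this ε hε).and self_mem_nhdsWithin).exists
    exact ⟨this.choose, this.choose_spec.2, this.choose_spec.1⟩
  obtain ⟨δ, hδ, hδg⟩ := Metric.uniformContinuous_iff.1 hu (η / 2) (by positivity)
  have hcδ : ∀ᶠ n in atTop, (c n - 1) * (R + 1) < δ := by
    have : Tendsto (fun n => (c n - 1) * (R + 1)) atTop (nhds ((1 - 1) * (R + 1))) :=
      (hc1.sub_const 1).mul_const _
    rw [sub_self, zero_mul] at this
    exact this.eventually (gt_mem_nhds hδ)
  filter_upwards [hcδ, hρ.eventually (gt_mem_nhds hδ), hρ.eventually (gt_mem_nhds one_pos)]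
    with n h1 h2 h3
  have hz : ∀ x, x ∉ s → dilMollify (ρ n) (c n) m g x = 0 := fun x hx => by
    rw [Metric.mem_closedBall, Real.dist_eq, not_le] at hx
    refine dilMollify_eq_zero (ρ n) (zero_lt_one.trans_le (hc n)) hg0 ?_
    nlinarith [hc n, abs_nonneg (x - m)]
  have hz' : ∀ x, x ∉ s → g x = 0 := fun x hx => by
    rw [Metric.mem_closedBall, Real.dist_eq, not_le] at hx
    exact hg0 x (by linarith)
  refine (eLpNorm_sub_le_of_dist_bdd volume hptop Metric.isClosed_closedBall.measurableSet
    hη.le (fun x => ?_) (fun x hx => by_contra fun h => hx (hz x h))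
    (fun x hx => by_contra fun h => hx (hz' x h))).trans hηε
  by_cases hx : x ∈ s
  · rw [Metric.mem_closedBall, Real.dist_eq] at hx
    refine (dist_triangle _ (g (c n * x + (1 - c n) * m)) _).trans ?_
    rw [← add_halves η]
    refine add_le_add ?_ (hδg ?_).le
    · exact ContDiffBump.dist_normed_convolution_le hg.aestronglyMeasurable fun y hy =>
        (hδg ((Metric.mem_ball.1 hy).trans h2)).le
    · rw [Real.dist_eq, show c n * x + (1 - c n) * m - x = (c n - 1) * (x - m) by ring, abs_mul,
        abs_of_nonneg (sub_nonneg.2 (hc n))]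
      exact (mul_le_mul_of_nonneg_left hx (sub_nonneg.2 (hc n))).trans_lt h1
  · rw [hz x hx, hz' x hx, dist_self]; exact hη.le

theorem dilMollify_sub (ρ : ContDiffBump (0 : ℝ)) (c m : ℝ) {f g : ℝ → ℝ}
    (hf : LocallyIntegrable f) (hg : LocallyIntegrable g) :
    dilMollify ρ c m (f - g) = dilMollify ρ c m f - dilMollify ρ c m g := by
  have hi : ∀ {f : ℝ → ℝ}, LocallyIntegrable f → ∀ x, Integrable fun h =>
      ρ.normed volume h * f (x - h) := fun hf x =>
    ρ.hasCompactSupport_normed.convolutionExists_left (ContinuousLinearMap.lsmul ℝ ℝ)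
      ρ.continuous_normed hf x
  ext x
  simp only [dilMollify, Pi.sub_apply, mollify_apply, mul_sub]
  exact integral_sub (hi hf _) (hi hg _)

theorem tendsto_dilMollify {ρ : ℕ → ContDiffBump (0 : ℝ)} {c : ℕ → ℝ}
    (hρ : Tendsto (fun n => (ρ n).rOut) atTop (nhds 0)) (hc : ∀ n, 1 ≤ c n)
    (hc1 : Tendsto c atTop (nhds 1)) (m : ℝ) (hp1 : 1 < p) (hptop : p ≠ ⊤) {f : ℝ → ℝ}
    (hf : MemLp f p volume) :
    Tendsto (fun n => eLpNorm (dilMollify (ρ n) (c n) m f - f) p volume) atTop (nhds 0) := by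
  rw [ENNReal.tendsto_nhds_zero]
  intro ε hε
  have h3 : ε / 3 ≠ 0 := by simp [hε.ne']
  obtain ⟨g, hgc, hgε, hg, hgp⟩ := hf.exists_hasCompactSupport_eLpNorm_sub_le hptop h3
  filter_upwards [ENNReal.tendsto_nhds_zero.1
    (tendsto_dilMollify_of_continuous (p := p) hρ hc hc1 m hptop hg hgc) (ε / 3)
      (pos_iff_ne_zero.2 h3)] with n hn
  have hfl := hf.locallyIntegrable hp1.le
  have hgl := hgp.locallyIntegrable hp1.le
  have e : dilMollify (ρ n) (c n) m f - f =
      dilMollify (ρ n) (c n) m (f - g) + (dilMollify (ρ n) (c n) m g - g) + (g - f) := by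
    rw [dilMollify_sub _ _ _ hfl hgl]; abel
  have m1 := (continuous_dilMollify (ρ n) (c n) m (hfl.sub hgl)).aestronglyMeasurable
    (μ := volume)
  have m2 := ((continuous_dilMollify (ρ n) (c n) m hgl).sub hg).aestronglyMeasurable (μ := volume)
  have m3 := hg.aestronglyMeasurable.sub hf.1
  rw [e]
  calc _ ≤ _ := eLpNorm_add_le (m1.add m2) m3 hp1.le
    _ ≤ _ := add_le_add_left (eLpNorm_add_le m1 m2 hp1.le) _
    _ ≤ ε / 3 + ε / 3 + ε / 3 := by
        refine add_le_add (add_le_add ?_ hn) ?_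
        · exact (eLpNorm_dilMollify_le (ρ n) (hc n) m hp1 hptop (hf.sub hgp)).trans hgε
        · rwa [eLpNorm_sub_comm]
    _ = ε := ENNReal.add_thirds ε

end

/-! ### Approximation by test functions -/

section

variable {p : ℝ≥0∞} {a b : ℝ}

theorem isTest_dilMollify (hab : a < b) {ρ : ContDiffBump (0 : ℝ)} {c : ℝ} (hc : 1 < c)
    (hρ : ρ.rOut ≤ (c - 1) * ((b - a) / 4)) {U : ℝ → ℝ} (hU : LocallyIntegrable U)
    (h0 : ∀ x, x ∉ Ioo a b → U x = 0) : IsTest a b (dilMollify ρ c ((a + b) / 2) U) := by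
  have hc0 : 0 < c := zero_lt_one.trans hc
  set r := (c + 1) / 2 * ((b - a) / 2) / c with hr
  have hrb : r < (b - a) / 2 := by
    rw [hr, div_lt_iff₀ hc0]; nlinarith
  have hU0 : ∀ y, (b - a) / 2 ≤ |y - (a + b) / 2| → U y = 0 := fun y hy => h0 y fun h => by
    refine hy.not_gt (abs_lt.2 ⟨?_, ?_⟩) <;> linarith [h.1, h.2]
  refine isTest_of_Icc (c := (a + b) / 2 - r) (d := (a + b) / 2 + r)
    (contDiff_comp_affine (contDiff_mollify ρ hU) c _) (by linarith) (by linarith) fun x hx => ?_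
  by_contra hcon
  refine hx (dilMollify_eq_zero ρ hc0 hU0 ?_)
  have h1 : r ≤ |x - (a + b) / 2| := by
    by_contra hlt
    have := abs_lt.1 (not_le.1 hlt)
    exact hcon ⟨by linarith [this.1], by linarith [this.2]⟩
  have h2 : c * r = (c + 1) / 2 * ((b - a) / 2) := by rw [hr]; field_simp
  nlinarith [mul_le_mul_of_nonneg_left h1 hc0.le]

theorem isWeakDeriv_of_isGlobalWeakDeriv {s : Side} {α : ℝ} {U W : ℝ → ℝ}
    (hU : IntegrableOn U (Ioo a b)) (h0 : ∀ x, x ∉ Ioo a b → U x = 0) (hW : LocallyIntegrable W)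
    (h : IsGlobalWeakDeriv s α U W) : IsWeakDeriv s α a b U W where
  integrable := hU
  locInt := hW.locallyIntegrableOn _
  integral_eq φ hφ := by
    rw [hφ.setIntegral_mul, h φ hφ.smooth hφ.compact, setIntegral_eq_integral_of_forall_compl_eq_zero]
    intro x hx
    rw [h0 x hx, zero_mul]

theorem eLpNorm_const_mul_sub_le (hp : 1 ≤ p) {μ : Measure ℝ} (k : ℝ) {f g : ℝ → ℝ}
    (hf : AEStronglyMeasurable f μ) (hg : AEStronglyMeasurable g μ) :
    eLpNorm ((fun x => k * f x) - g) p μ ≤ ‖k‖ₑ * eLpNorm (f - g) p μ + ‖k - 1‖ₑ * eLpNorm g p μ := by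
  have e : (fun x => k * f x) - g = k • (f - g) + (k - 1) • g := by
    ext x; simp only [Pi.sub_apply, Pi.add_apply, Pi.smul_apply, smul_eq_mul]; ring
  rw [e, ← eLpNorm_const_smul, ← eLpNorm_const_smul]
  exact eLpNorm_add_le ((hf.sub hg).const_smul k) (hg.const_smul _) hp

/-- A function supported in `(a,b)` is approximated in `L^p` by test functions whose one-sided
weak fractional derivatives approximate those of the function. -/
theorem exists_test_approx {α : ℝ} (hα : α ∈ Ioo (0 : ℝ) 1) (hab : a < b) (hp1 : 1 < p)
    (hptop : p ≠ ⊤) {U : ℝ → ℝ} (hU : MemLp U p) (hUi : Integrable U)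
    (h0 : ∀ x, x ∉ Ioo a b → U x = 0) :
    ∃ φ : ℕ → ℝ → ℝ, (∀ n, IsTest a b (φ n)) ∧
      Tendsto (fun n => eLpNorm (φ n - U) p (volume.restrict (Ioo a b))) atTop (nhds 0) ∧
      ∀ s W, MemLp W p → IsGlobalWeakDeriv s α U W → ∃ ψ : ℕ → ℝ → ℝ,
        (∀ n, MemLp (ψ n) p (volume.restrict (Ioo a b)) ∧ IsWeakDeriv s α a b (φ n) (ψ n)) ∧
        Tendsto (fun n => eLpNorm (ψ n - W) p (volume.restrict (Ioo a b))) atTop (nhds 0) := by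
  have hba : 0 < (b - a) / 4 := by linarith
  let δ : ℕ → ℝ := fun n => 1 / ((n : ℝ) + 1)
  have hδ : ∀ n, 0 < δ n := fun n => Nat.one_div_pos_of_nat
  have hδ0 : Tendsto δ atTop (nhds 0) := tendsto_one_div_add_atTop_nhds_zero_nat
  let c : ℕ → ℝ := fun n => 1 + δ n
  have hc : ∀ n, 1 < c n := fun n => lt_add_of_pos_right 1 (hδ n)
  have hc1 : Tendsto c atTop (nhds 1) := by simpa using hδ0.const_add 1
  let ρ : ℕ → ContDiffBump (0 : ℝ) := fun n =>
    ⟨δ n * ((b - a) / 4) / 2, δ n * ((b - a) / 4), half_pos (mul_pos (hδ n) hba),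
      half_lt_self (mul_pos (hδ n) hba)⟩
  have hρ : Tendsto (fun n => (ρ n).rOut) atTop (nhds 0) := by
    simpa using hδ0.mul_const ((b - a) / 4)
  have hT : ∀ n, IsTest a b (dilMollify (ρ n) (c n) ((a + b) / 2) U) := fun n =>
    isTest_dilMollify hab (hc n) (le_of_eq (by simp [ρ, c])) hUi.locallyIntegrable h0
  have hr : ∀ {f : ℕ → ℝ → ℝ}, Tendsto (fun n => eLpNorm (f n) p volume) atTop (nhds 0) →
      Tendsto (fun n => eLpNorm (f n) p (volume.restrict (Ioo a b))) atTop (nhds 0) := fun h =>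
    tendsto_of_tendsto_of_tendsto_of_le_of_le tendsto_const_nhds h (fun _ => zero_le)
      fun n => eLpNorm_mono_measure _ Measure.restrict_le_self
  refine ⟨fun n => dilMollify (ρ n) (c n) ((a + b) / 2) U, hT,
    hr (tendsto_dilMollify hρ (fun n => (hc n).le) hc1 _ hp1 hptop hU), fun s W hW h => ?_⟩
  have hWl := hW.locallyIntegrable hp1.le
  have hcont := fun n => continuous_dilMollify (ρ n) (c n) ((a + b) / 2) hWl
  have hlim := tendsto_dilMollify hρ (fun n => (hc n).le) hc1 ((a + b) / 2) hp1 hptop hW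
  refine ⟨fun n x => c n ^ α * dilMollify (ρ n) (c n) ((a + b) / 2) W x, fun n => ⟨?_, ?_⟩, ?_⟩
  · refine MemLp.const_mul (f := dilMollify (ρ n) (c n) ((a + b) / 2) W) ?_ _
    refine ⟨(hcont n).aestronglyMeasurable, ?_⟩
    exact (eLpNorm_mono_measure _ Measure.restrict_le_self).trans_lt
      ((eLpNorm_dilMollify_le (ρ n) (hc n).le _ hp1 hptop hW).trans_lt hW.2)
  · refine isWeakDeriv_of_isGlobalWeakDeriv
      ((hT n).smooth.continuous.integrable_of_hasCompactSupport (hT n).compact).integrableOn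
      (fun x hx => (hT n).eq_zero_of_notMem hx) (hcont n |>.const_smul (c n ^ α)).locallyIntegrable ?_
    exact (h.mollify (ρ n) hα hUi hWl).comp_affine (zero_lt_one.trans (hc n)) _
  · refine hr ?_
    have hca : Tendsto (fun n => c n ^ α) atTop (nhds 1) := by
      simpa using hc1.rpow_const (p := α) (Or.inl one_ne_zero)
    have l1 : Tendsto (fun n => ‖c n ^ α‖ₑ) atTop (nhds ‖(1 : ℝ)‖ₑ) := hca.enorm
    have l2 : Tendsto (fun n => ‖c n ^ α - 1‖ₑ) atTop (nhds 0) := by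
      simpa using (hca.sub_const 1).enorm
    have l3 := ENNReal.Tendsto.mul l1 (Or.inr ENNReal.zero_ne_top) hlim
      (Or.inr (by simp : ‖(1 : ℝ)‖ₑ ≠ ⊤))
    have l4 := ENNReal.Tendsto.mul_const (b := eLpNorm W p volume) l2 (Or.inr hW.2.ne)
    have l5 := l3.add l4
    rw [mul_zero, zero_mul, add_zero] at l5
    exact tendsto_of_tendsto_of_tendsto_of_le_of_le tendsto_const_nhds l5 (fun _ => zero_le)
      fun n => eLpNorm_const_mul_sub_le hp1.le _ (hcont n).aestronglyMeasurable hW.1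

end

/-! ### Reflection -/

theorem rlDeriv_opp (s : Side) (α : ℝ) (f : ℝ → ℝ) (x : ℝ) :
    rlDeriv s.opp α f x = rlDeriv s α (fun y => f (-y)) (-x) := by
  cases s with
  | left => exact rlDeriv_right_eq_left α f x
  | right => exact rlDeriv_left_eq_right α f x

theorem IsGlobalWeakDeriv.neg {s : Side} {α : ℝ} {U W : ℝ → ℝ} (h : IsGlobalWeakDeriv s α U W) :
    IsGlobalWeakDeriv s.opp α (fun x => U (-x)) fun x => W (-x) := by
  intro φ h1 h2
  have e := h _ (h1.comp contDiff_neg) (hasCompactSupport_comp_neg h2)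
  rw [← integral_neg_eq_self, ← integral_neg_eq_self (fun x => U (-x) * _)]
  simp only [neg_neg]
  refine e.trans ?_
  congr 1
  ext x
  rw [rlDeriv_opp s.opp, neg_neg]
  rfl

section

variable {s : Side} {α : ℝ} {p : ℝ≥0∞} {a b : ℝ}

theorem measurePreserving_neg_Ioo (a b : ℝ) :
    MeasurePreserving (fun x : ℝ => -x) (volume.restrict (Ioo (-b) (-a)))
      (volume.restrict (Ioo a b)) := by
  have := (Measure.measurePreserving_neg (volume : Measure ℝ)).restrict_preimage
    (measurableSet_Ioo (a := a) (b := b))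
  rwa [show Neg.neg ⁻¹' Ioo a b = Ioo (-b) (-a) by simp] at this

theorem measurableEmbedding_neg : MeasurableEmbedding fun x : ℝ => -x :=
  (Homeomorph.neg ℝ).measurableEmbedding

theorem memLp_neg {f : ℝ → ℝ} (h : MemLp f p (volume.restrict (Ioo a b))) :
    MemLp (fun x => f (-x)) p (volume.restrict (Ioo (-b) (-a))) :=
  h.comp_measurePreserving (measurePreserving_neg_Ioo a b)

theorem eLpNorm_neg_Ioo {f : ℝ → ℝ} (h : AEStronglyMeasurable f (volume.restrict (Ioo a b))) :
    eLpNorm (fun x => f (-x)) p (volume.restrict (Ioo (-b) (-a))) =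
      eLpNorm f p (volume.restrict (Ioo a b)) :=
  eLpNorm_comp_measurePreserving h (measurePreserving_neg_Ioo a b)

theorem ae_eq_neg_Ioo {f g : ℝ → ℝ} (h : f =ᵐ[volume.restrict (Ioo a b)] g) :
    (fun x => f (-x)) =ᵐ[volume.restrict (Ioo (-b) (-a))] fun x => g (-x) :=
  (measurePreserving_neg_Ioo a b).quasiMeasurePreserving.ae_eq_comp h

theorem IsTest.neg {φ : ℝ → ℝ} (h : IsTest a b φ) : IsTest (-b) (-a) fun x => φ (-x) where
  smooth := h.smooth.comp contDiff_neg
  compact := hasCompactSupport_comp_neg h.compact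
  supp := by
    intro x hx
    have : tsupport (fun x => φ (-x)) = Neg.neg ⁻¹' tsupport φ :=
      tsupport_comp_eq_preimage φ (Homeomorph.neg ℝ)
    rw [this] at hx
    have := h.supp hx
    exact ⟨by linarith [this.2], by linarith [this.1]⟩

theorem IsWeakDeriv.neg {u v : ℝ → ℝ} (h : IsWeakDeriv s α a b u v)
    (hv : IntegrableOn v (Ioo a b)) :
    IsWeakDeriv s.opp α (-b) (-a) (fun x => u (-x)) fun x => v (-x) where
  integrable := (measurePreserving_neg_Ioo a b).integrable_comp_of_integrable h.integrable
  locInt := IntegrableOn.locallyIntegrableOn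
    ((measurePreserving_neg_Ioo a b).integrable_comp_of_integrable hv)
  integral_eq φ hφ := by
    have hφ' : IsTest a b fun x => φ (-x) := by simpa using hφ.neg
    have e := h.integral_eq _ hφ'
    have e1 := (measurePreserving_neg_Ioo a b).integral_comp measurableEmbedding_neg
      fun x => v x * φ (-x)
    have e2 := (measurePreserving_neg_Ioo a b).integral_comp measurableEmbedding_neg
      fun x => u x * rlDeriv s.opp α (fun x => φ (-x)) x
    simp only [neg_neg] at e1
    rw [e1, e, ← e2]
    simp only [rlDeriv_opp s.opp]

theorem HasTrace.neg {u : ℝ → ℝ} {t : ℝ} (h : HasTrace s a b u t) :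
    HasTrace s.opp (-b) (-a) (fun x => u (-x)) t := by
  obtain ⟨w, hw, hu, ht⟩ := h
  refine ⟨fun x => w (-x), ?_, ae_eq_neg_Ioo hu, ?_⟩
  · refine hw.comp continuous_neg.continuousOn fun x hx => ?_
    cases s
    · exact ⟨by linarith [hx.2], by linarith [hx.1]⟩
    · exact ⟨by linarith [hx.2], by linarith [hx.1]⟩
  · cases s
    · simpa [Side.endpoint, Side.opp] using ht
    · simpa [Side.endpoint, Side.opp] using ht

theorem exists_trace_bound (s : Side) (hα : α ∈ Ioo (0 : ℝ) 1) (hab : a < b) (hp1 : 1 < p)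
    (hptop : p ≠ ⊤) (hαp : 1 < α * p.toReal) :
    ∃ K, 0 ≤ K ∧ ∀ u v : ℝ → ℝ, IsWeakDeriv s α a b u v →
      MemLp u p (volume.restrict (Ioo a b)) → MemLp v p (volume.restrict (Ioo a b)) →
      ∃ t, HasTrace s a b u t ∧ |t| ≤ K * ((eLpNorm u p (volume.restrict (Ioo a b))).toReal +
        (eLpNorm v p (volume.restrict (Ioo a b))).toReal) := by
  cases s with
  | left => exact exists_left_trace_bound hα hab hp1 hptop hαp
  | right =>
    obtain ⟨K, hK0, hK⟩ := exists_left_trace_bound hα (neg_lt_neg hab) hp1 hptop hαp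
    refine ⟨K, hK0, fun u v h hu hv => ?_⟩
    obtain ⟨t, ht, htK⟩ := hK _ _ (h.neg (hv.integrable hp1.le)) (memLp_neg hu) (memLp_neg hv)
    rw [eLpNorm_neg_Ioo hu.1, eLpNorm_neg_Ioo hv.1] at htK
    have h2 := ht.neg
    simp only [neg_neg] at h2
    exact ⟨t, h2, htK⟩

end

/-! ### Approximation of functions with vanishing traces -/

section

variable {α : ℝ} {p : ℝ≥0∞} {a b : ℝ} {u v : ℝ → ℝ}

/-- The fractional integral of `v` has the weak fractional derivative `v`. -/
theorem isWeakDeriv_fracIntegral_left (hα : α ∈ Ioo (0 : ℝ) 1) (hp1 : 1 < p) (hptop : p ≠ ⊤)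
    (hαp : 1 < α * p.toReal) (hv : MemLp v p (volume.restrict (Ioo a b))) :
    IsWeakDeriv .left α a b (fracIntegral .left α ((Ioo a b).indicator v)) v where
  integrable := (continuous_fracIntegral_left_indicator hα hp1 hptop hαp hv).integrableOn_Icc.mono_set
    Ioo_subset_Icc_self
  locInt := (show IntegrableOn v (Ioo a b) volume from hv.integrable hp1.le).locallyIntegrableOn
  integral_eq φ hφ := by
    have h := isGlobalWeakDeriv_extension hα hp1 hptop hαp (memLp_indicator hv)
      (integrable_indicator_of_memLp hp1.le hv) (fun y hy => indicator_of_notMem hy v)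
      φ hφ.smooth hφ.compact
    rw [← hφ.setIntegral_mul, ← setIntegral_eq_integral_of_forall_compl_eq_zero (s := Ioo a b)
      (f := fun x => (Ioo a b).indicator _ x * _) fun x hx => by
        rw [indicator_of_notMem hx, zero_mul]] at h
    have e1 : ∫ x in Ioo a b, v x * φ x = ∫ x in Ioo a b, ((Ioo a b).indicator v x +
        (Ioi b).indicator (tailDeriv α a b (fracIntegral .left α ((Ioo a b).indicator v))) x) *
          φ x :=
      setIntegral_congr_fun measurableSet_Ioo fun x hx => by
        rw [indicator_of_mem hx, indicator_of_notMem (notMem_Ioi.2 hx.2.le), add_zero]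
    rw [e1, h]
    exact setIntegral_congr_fun measurableSet_Ioo fun x hx => by simp only [indicator_of_mem hx]

theorem isGlobalWeakDeriv_left_of_contDiff {g : ℝ → ℝ} (hα : α ∈ Ioo (0 : ℝ) 1)
    (h1 : ContDiff ℝ ∞ g) (h2 : HasCompactSupport g) :
    IsGlobalWeakDeriv .left α g (rlDeriv .left α g) := by
  intro φ hφ1 hφ2
  have h1α : 0 < 1 - α := sub_pos.2 hα.2
  have hc := (contDiff_fracIntegral .left h1α h1 h2).continuous
  have hd := continuous_rlDeriv' .left hα.2 h1 h2
  have e := integral_mul_deriv_eq_deriv_mul_of_integrable (u := fracIntegral .left (1 - α) g)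
    (v := φ) (u' := rlDeriv .left α g) (v' := deriv φ)
    (fun x _ => ((contDiff_fracIntegral .left h1α h1 h2).differentiable (by simp) x).hasDerivAt)
    (fun x _ => (hφ1.differentiable (by simp) x).hasDerivAt)
    ((hc.mul (hφ1.continuous_deriv (by simp))).integrable_of_hasCompactSupport hφ2.deriv.mul_left)
    ((hd.mul hφ1.continuous).integrable_of_hasCompactSupport hφ2.mul_left)
    ((hc.mul hφ1.continuous).integrable_of_hasCompactSupport hφ2.mul_left)
  have e2 := integral_mul_fracIntegral_right h1α (by linarith [hα.1])
    (h1.continuous.integrable_of_hasCompactSupport h2) (hφ1.continuous_deriv (by simp)) hφ2.deriv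
  simp only [Side.opp, rlDeriv_right_eq hα.2 hφ1 hφ2, mul_neg, integral_neg]
  rw [e2, e, neg_neg]

theorem IsTest.rlDeriv_right_eq_zero (hα : α < 1) {φ : ℝ → ℝ} (h : IsTest a b φ) {x : ℝ}
    (hx : b ≤ x) : rlDeriv .right α φ x = 0 := by
  rw [rlDeriv_right_eq hα h.smooth h.compact, fracIntegral, setIntegral_eq_zero_of_forall_eq_zero,
    mul_zero, neg_zero]
  intro y hy
  rw [h.deriv.eq_zero_of_notMem fun h' => (hx.trans_lt hy).not_gt h'.2, mul_zero]

theorem isWeakDeriv_left_of_contDiff {g : ℝ → ℝ} (hα : α ∈ Ioo (0 : ℝ) 1)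
    (h1 : ContDiff ℝ ∞ g) (h2 : HasCompactSupport g) (h0 : ∀ x ≤ a, g x = 0) :
    IsWeakDeriv .left α a b g (rlDeriv .left α g) where
  integrable := (h1.continuous.integrable_of_hasCompactSupport h2).integrableOn
  locInt := (continuous_rlDeriv' .left hα.2 h1 h2).locallyIntegrable.locallyIntegrableOn _
  integral_eq φ hφ := by
    rw [hφ.setIntegral_mul, isGlobalWeakDeriv_left_of_contDiff hα h1 h2 φ hφ.smooth hφ.compact,
      setIntegral_eq_integral_of_forall_compl_eq_zero]
    intro x hx
    rcases le_or_gt x a with h | h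
    · rw [h0 x h, zero_mul]
    · rw [Side.opp, hφ.rlDeriv_right_eq_zero hα.2 (not_lt.1 fun h' => hx ⟨h, h'⟩), mul_zero]

/-- If the left trace vanishes and the right trace exists, then the extension by zero has a weak
left derivative on the whole line. -/
theorem IsWeakDeriv.exists_extension_left (hα : α ∈ Ioo (0 : ℝ) 1) (hab : a < b) (hp1 : 1 < p)
    (hptop : p ≠ ⊤) (hαp : 1 < α * p.toReal) (h : IsWeakDeriv .left α a b u v)
    (hv : MemLp v p (volume.restrict (Ioo a b))) (hl : HasTrace .left a b u 0) {t : ℝ}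
    (hr : HasTrace .right a b u t) :
    ∃ W, MemLp W p ∧ W =ᵐ[volume.restrict (Ioo a b)] v ∧
      IsGlobalWeakDeriv .left α ((Ioo a b).indicator u) W := by
  obtain ⟨c, hc⟩ := h.exists_representation hα hab (hv.integrable hp1.le)
  obtain ⟨w, hw, huw, -⟩ := hr
  set F := fracIntegral .left α ((Ioo a b).indicator v)
  have hF : Continuous F := continuous_fracIntegral_left_indicator hα hp1 hptop hαp hv
  set d := (a + b) / 2 with hd
  have had : a < d := by linarith
  have hdb : d < b := by linarith
  obtain ⟨M1, hM1⟩ := isCompact_Icc.exists_bound_of_continuousOn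
    (hw.mono fun x hx => ⟨hx.1, hx.2.trans_lt hdb⟩ : ContinuousOn w (Icc a d))
  obtain ⟨M2, hM2⟩ := isCompact_Icc.exists_bound_of_continuousOn
    (hF.continuousOn (s := Icc a d))
  have hc0 : c = 0 := by
    refine eq_zero_of_bounded_near hα.2 had (M := max M1 M2) (w := F) ?_ fun x hx =>
      (hM2 x (Ioo_subset_Icc_self hx)).trans (le_max_right _ _)
    have hs : Ioo a d ⊆ Ioo a b := Ioo_subset_Ioo_right hdb.le
    filter_upwards [ae_restrict_of_ae_restrict_of_subset hs hc,
      ae_restrict_of_ae_restrict_of_subset hs huw, ae_restrict_mem measurableSet_Ioo]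
      with x h1 h2 hx
    rw [← h1, h2]
    exact (hM1 x (Ioo_subset_Icc_self hx)).trans (le_max_left _ _)
  have htr := hl.unique hab (hasTrace_left_of_representation hα hp1 hptop hαp hv hc)
  subst hc0
  rw [zero_mul, zero_add] at htr
  simp only [zero_mul, zero_add] at hc
  exact exists_isGlobalWeakDeriv_left hα hp1 hptop hαp hv hc htr.symm

theorem IsWeakDeriv.exists_extension {s : Side} (hα : α ∈ Ioo (0 : ℝ) 1) (hab : a < b)
    (hp1 : 1 < p) (hptop : p ≠ ⊤) (hαp : 1 < α * p.toReal) (h : IsWeakDeriv s α a b u v)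
    (hv : MemLp v p (volume.restrict (Ioo a b))) (hl : HasTrace s a b u 0) {t : ℝ}
    (hr : HasTrace s.opp a b u t) :
    ∃ W, MemLp W p ∧ W =ᵐ[volume.restrict (Ioo a b)] v ∧
      IsGlobalWeakDeriv s α ((Ioo a b).indicator u) W := by
  cases s with
  | left => exact h.exists_extension_left hα hab hp1 hptop hαp hv hl hr
  | right =>
    obtain ⟨W, hW, hWv, hWd⟩ := (h.neg (hv.integrable hp1.le)).exists_extension_left hα
      (neg_lt_neg hab) hp1 hptop hαp (memLp_neg hv) hl.neg hr.neg
    refine ⟨fun x => W (-x), hW.comp_measurePreserving (Measure.measurePreserving_neg volume),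
      ?_, ?_⟩
    · have := ae_eq_neg_Ioo hWv
      simpa only [neg_neg] using this
    · have := hWd.neg
      change IsGlobalWeakDeriv .right α _ _ at this
      convert this using 1
      funext x
      by_cases hx : x ∈ Ioo a b
      · have hx' : -x ∈ Ioo (-b) (-a) := ⟨neg_lt_neg hx.2, neg_lt_neg hx.1⟩
        rw [indicator_of_mem hx, indicator_of_mem hx', neg_neg]
      · have hx' : -x ∉ Ioo (-b) (-a) := fun h => hx ⟨neg_lt_neg_iff.1 h.2, neg_lt_neg_iff.1 h.1⟩
        rw [indicator_of_notMem hx, indicator_of_notMem hx']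

theorem memLp_Ioo_of_continuous {g : ℝ → ℝ} (hg : Continuous g) :
    MemLp g p (volume.restrict (Ioo a b)) := by
  obtain ⟨M, hM⟩ := isCompact_Icc.exists_bound_of_continuousOn (hg.continuousOn (s := Icc a b))
  refine MemLp.of_bound hg.aestronglyMeasurable M ?_
  filter_upwards [ae_restrict_mem measurableSet_Ioo] with x hx using hM x (Ioo_subset_Icc_self hx)

/-- The cut-off of the kernel `(x - a)^(α - 1)` near `b`. -/
theorem exists_smooth_cutoff (α : ℝ) (hab : a < b) : ∃ g : ℝ → ℝ, ContDiff ℝ ∞ g ∧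
    HasCompactSupport g ∧ (∀ x ≤ a, g x = 0) ∧
    ∃ c ∈ Ioo a b, ∀ x, c ≤ x → x ≤ b → g x = rlKernel α (x - a) := by
  let η : ContDiffBump b := ⟨(b - a) / 3, 2 * (b - a) / 3, by linarith, by linarith⟩
  have hη0 : ∀ x ≤ a + (b - a) / 3, η x = 0 := fun x hx => η.zero_of_le_dist (by
    rw [Real.dist_eq, abs_of_neg (by linarith)]
    change 2 * (b - a) / 3 ≤ _
    linarith)
  refine ⟨fun x => rlKernel α (x - a) * η x, ?_, η.hasCompactSupport.mul_left, fun x hx => ?_,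
    b - (b - a) / 3, ⟨by linarith, by linarith⟩, fun x hx hxb => ?_⟩
  · rw [contDiff_iff_contDiffAt]
    intro x
    rcases lt_or_ge a x with hx | hx
    · have h : ContDiffAt ℝ ∞ (fun y => (y - a) ^ (α - 1)) x :=
        (contDiffAt_id.sub contDiffAt_const).rpow_const_of_ne (sub_pos.2 hx).ne'
      refine (h.mul η.contDiff.contDiffAt).congr_of_eventuallyEq ?_
      filter_upwards [Ioi_mem_nhds hx] with y hy
      rw [rlKernel_of_pos (sub_pos.2 hy)]
    · refine (contDiffAt_const (c := (0 : ℝ))).congr_of_eventuallyEq ?_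
      filter_upwards [Iio_mem_nhds (show x < a + (b - a) / 3 by linarith)] with y hy
      rw [hη0 y (le_of_lt hy), mul_zero]
  · dsimp only
    rw [hη0 x (by linarith), mul_zero]
  · have : η x = 1 := η.one_of_mem_closedBall (by
      rw [Metric.mem_closedBall, Real.dist_eq, abs_of_nonpos (by linarith)]
      change _ ≤ (b - a) / 3
      linarith)
    dsimp only
    rw [this, mul_one]

theorem contDiffOn_rlKernel_sub (α a : ℝ) :
    ContDiffOn ℝ ∞ (fun x => rlKernel α (x - a)) (Ioi a) := by
  have h : ContDiffOn ℝ ∞ (fun x : ℝ => (x - a) ^ (α - 1)) (Ioi a) := fun x hx =>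
    ((contDiffAt_id.sub contDiffAt_const).rpow_const_of_ne
      (sub_pos.2 hx).ne').contDiffWithinAt
  exact h.congr fun x hx => rlKernel_of_pos (sub_pos.2 hx)

theorem IsTest.isOneSidedTest (hab : a < b) {φ : ℝ → ℝ} (h : IsTest a b φ) (s : Side) :
    IsOneSidedTest s a b φ := by
  obtain ⟨c, d, hc, hcd, hd, hs⟩ := h.exists_Icc hab
  cases s with
  | left =>
    refine ⟨h.smooth.contDiffOn, d, ⟨hc.trans_le hcd, hd⟩, fun x _ hx => ?_⟩
    by_contra hne
    exact (hs x hne).2.not_gt hx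
  | right =>
    refine ⟨h.smooth.contDiffOn, c, ⟨hc, hcd.trans_lt hd⟩, fun x _ hx => ?_⟩
    by_contra hne
    exact (hs x hne).1.not_gt hx

/-- Functions with vanishing left trace are approximated by one-sided test functions. -/
theorem IsWeakDeriv.exists_oneSided_approx_left (hα : α ∈ Ioo (0 : ℝ) 1) (hab : a < b)
    (hp1 : 1 < p) (hptop : p ≠ ⊤) (hαp : 1 < α * p.toReal) (h : IsWeakDeriv .left α a b u v)
    (hu : MemLp u p (volume.restrict (Ioo a b)))
    (hv : MemLp v p (volume.restrict (Ioo a b))) (hl : HasTrace .left a b u 0) :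
    ∃ φ ψ : ℕ → ℝ → ℝ, (∀ n, MemLp (φ n) p (volume.restrict (Ioo a b)) ∧
        MemLp (ψ n) p (volume.restrict (Ioo a b)) ∧ IsWeakDeriv .left α a b (φ n) (ψ n) ∧
        ∃ χ, IsOneSidedTest .left a b χ ∧ φ n =ᵐ[volume.restrict (Ioo a b)] χ) ∧
      Tendsto (fun n => eLpNorm (φ n - u) p (volume.restrict (Ioo a b))) atTop (nhds 0) ∧
      Tendsto (fun n => eLpNorm (ψ n - v) p (volume.restrict (Ioo a b))) atTop (nhds 0) := by
  obtain ⟨c, hc⟩ := h.exists_representation hα hab (hv.integrable hp1.le)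
  obtain ⟨g, hg1, hg2, hg0, d, hd, hgd⟩ := exists_smooth_cutoff (a := a) (b := b) α hab
  set F := fracIntegral .left α ((Ioo a b).indicator v) with hFdef
  have hF : Continuous F := continuous_fracIntegral_left_indicator hα hp1 hptop hαp hv
  set R : ℝ → ℝ := F + c • g with hR
  set v' : ℝ → ℝ := v + c • rlDeriv .left α g with hv'
  have hRc : Continuous R := hF.add (hg1.continuous.const_smul c)
  have hRd : IsWeakDeriv .left α a b R v' :=
    (isWeakDeriv_fracIntegral_left hα hp1 hptop hαp hv).add hα.2
      ((isWeakDeriv_left_of_contDiff hα hg1 hg2 hg0).smul c)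
  have hRp : MemLp R p (volume.restrict (Ioo a b)) := memLp_Ioo_of_continuous hRc
  have hvp : MemLp v' p (volume.restrict (Ioo a b)) :=
    hv.add ((memLp_Ioo_of_continuous (continuous_rlDeriv' .left hα.2 hg1 hg2)).const_smul c)
  have hRb : R b = 0 := by
    have htr := hl.unique hab (hasTrace_left_of_representation hα hp1 hptop hαp hv hc)
    rw [hR, Pi.add_apply, Pi.smul_apply, smul_eq_mul, hgd b hd.2.le le_rfl, add_comm]
    exact htr.symm
  obtain ⟨W, hW, hWv, hWd⟩ := hRd.exists_extension_left hα hab hp1 hptop hαp hvp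
    ⟨R, hRc.continuousOn, EventuallyEq.rfl, hRb⟩
    ⟨R, hRc.continuousOn, EventuallyEq.rfl, rfl⟩
  obtain ⟨φ, hφ, hφl, hφd⟩ := exists_test_approx hα hab hp1 hptop (memLp_indicator hRp)
    (integrable_indicator_of_memLp hp1.le hRp) (fun x hx => indicator_of_notMem hx R)
  obtain ⟨ψ, hψ, hψl⟩ := hφd .left W hW hWd
  have hind : (Ioo a b).indicator R =ᵐ[volume.restrict (Ioo a b)] R :=
    indicator_ae_eq_restrict measurableSet_Ioo
  refine ⟨fun n => φ n + (u + (-1 : ℝ) • R), fun n => ψ n + (v + (-1 : ℝ) • v'), fun n =>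
    ⟨(memLp_Ioo_of_continuous (hφ n).smooth.continuous).add (hu.add (hRp.const_smul _)),
      (hψ n).1.add (hv.add (hvp.const_smul _)),
      (hψ n).2.add hα.2 (h.add hα.2 (hRd.smul _)), ?_⟩, ?_, ?_⟩
  · refine ⟨φ n + c • ((fun x => rlKernel α (x - a)) + (-1 : ℝ) • g),
      ((hφ n).isOneSidedTest hab .left).add (IsOneSidedTest.smul c ⟨?_, d, hd, fun x hx hdx => ?_⟩),
      ?_⟩
    · exact ((contDiffOn_rlKernel_sub α a).mono fun x hx => hx.1).add
        (hg1.const_smul (-1 : ℝ)).contDiffOn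
    · simp only [Pi.add_apply, Pi.smul_apply, smul_eq_mul]
      rw [hgd x hdx.le hx.2.le]
      ring
    · filter_upwards [hc] with x hx
      simp only [Pi.add_apply, Pi.smul_apply, smul_eq_mul, hR, hx]
      ring
  · refine hφl.congr fun n => eLpNorm_congr_ae ?_
    filter_upwards [hind] with x hx
    simp only [Pi.sub_apply, Pi.add_apply, Pi.smul_apply, smul_eq_mul, hx]
    ring
  · refine hψl.congr fun n => eLpNorm_congr_ae ?_
    filter_upwards [hWv] with x hx
    simp only [Pi.sub_apply, Pi.add_apply, Pi.smul_apply, smul_eq_mul, hx]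
    ring

theorem IsOneSidedTest.neg {s : Side} {φ : ℝ → ℝ} (h : IsOneSidedTest s a b φ) :
    IsOneSidedTest s.opp (-b) (-a) fun x => φ (-x) := by
  have hm : ∀ x ∈ Ioo (-b) (-a), -x ∈ Ioo a b := fun x hx =>
    ⟨by linarith [hx.2], by linarith [hx.1]⟩
  cases s with
  | left =>
    obtain ⟨h1, c, hc, h2⟩ := h
    exact ⟨h1.comp contDiff_neg.contDiffOn hm, -c, ⟨neg_lt_neg hc.2, neg_lt_neg hc.1⟩,
      fun x hx hxc => h2 _ (hm x hx) (lt_neg.1 hxc)⟩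
  | right =>
    obtain ⟨h1, c, hc, h2⟩ := h
    exact ⟨h1.comp contDiff_neg.contDiffOn hm, -c, ⟨neg_lt_neg hc.2, neg_lt_neg hc.1⟩,
      fun x hx hxc => h2 _ (hm x hx) (neg_lt.1 hxc)⟩

theorem IsWeakDeriv.exists_oneSided_approx {s : Side} (hα : α ∈ Ioo (0 : ℝ) 1) (hab : a < b)
    (hp1 : 1 < p) (hptop : p ≠ ⊤) (hαp : 1 < α * p.toReal) (h : IsWeakDeriv s α a b u v)
    (hu : MemLp u p (volume.restrict (Ioo a b)))
    (hv : MemLp v p (volume.restrict (Ioo a b))) (hl : HasTrace s a b u 0) :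
    ∃ φ ψ : ℕ → ℝ → ℝ, (∀ n, MemLp (φ n) p (volume.restrict (Ioo a b)) ∧
        MemLp (ψ n) p (volume.restrict (Ioo a b)) ∧ IsWeakDeriv s α a b (φ n) (ψ n) ∧
        ∃ χ, IsOneSidedTest s a b χ ∧ φ n =ᵐ[volume.restrict (Ioo a b)] χ) ∧
      Tendsto (fun n => eLpNorm (φ n - u) p (volume.restrict (Ioo a b))) atTop (nhds 0) ∧
      Tendsto (fun n => eLpNorm (ψ n - v) p (volume.restrict (Ioo a b))) atTop (nhds 0) := by
  cases s with
  | left => exact h.exists_oneSided_approx_left hα hab hp1 hptop hαp hu hv hl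
  | right =>
    obtain ⟨φ, ψ, h1, h2, h3⟩ := (h.neg (hv.integrable hp1.le)).exists_oneSided_approx_left hα
      (neg_lt_neg hab) hp1 hptop hαp (memLp_neg hu) (memLp_neg hv) hl.neg
    have key : ∀ {f : ℕ → ℝ → ℝ} {g : ℝ → ℝ},
        (∀ n, MemLp (f n) p (volume.restrict (Ioo (-b) (-a)))) →
        MemLp g p (volume.restrict (Ioo a b)) →
        Tendsto (fun n => eLpNorm (f n - fun x => g (-x)) p (volume.restrict (Ioo (-b) (-a))))
          atTop (nhds 0) →
        Tendsto (fun n => eLpNorm ((fun x => f n (-x)) - g) p (volume.restrict (Ioo a b)))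
          atTop (nhds 0) := fun {f g} hf hg hlim => by
      refine hlim.congr fun n => ?_
      have := eLpNorm_neg_Ioo (p := p) ((hf n).sub (memLp_neg hg)).1
      simp only [Pi.sub_apply, neg_neg] at this
      exact this.symm
    refine ⟨fun n x => φ n (-x), fun n x => ψ n (-x), fun n => ?_,
      key (fun n => (h1 n).1) hu h2, key (fun n => (h1 n).2.1) hv h3⟩
    obtain ⟨m1, m2, m3, χ, hχ, hχe⟩ := h1 n
    have r1 := memLp_neg m1
    have r2 := memLp_neg m2
    have r3 := m3.neg (m2.integrable hp1.le)
    have r4 := hχ.neg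
    have r5 := ae_eq_neg_Ioo hχe
    simp only [neg_neg] at r1 r2 r3 r4 r5
    exact ⟨r1, r2, r3, _, r4, r5⟩

/-- Functions with vanishing traces are approximated by test functions in both one-sided norms. -/
theorem exists_test_approx_of_traces {v' : ℝ → ℝ} (hα : α ∈ Ioo (0 : ℝ) 1) (hab : a < b)
    (hp1 : 1 < p) (hptop : p ≠ ⊤) (hαp : 1 < α * p.toReal) (hu : MemLp u p (volume.restrict (Ioo a b)))
    (h : IsWeakDeriv .left α a b u v) (hv : MemLp v p (volume.restrict (Ioo a b)))
    (h' : IsWeakDeriv .right α a b u v') (hv' : MemLp v' p (volume.restrict (Ioo a b)))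
    (hl : HasTrace .left a b u 0) (hr : HasTrace .right a b u 0) :
    ∃ φ ψ ψ' : ℕ → ℝ → ℝ, (∀ n, IsTest a b (φ n)) ∧
      (∀ n, MemLp (ψ n) p (volume.restrict (Ioo a b)) ∧ IsWeakDeriv .left α a b (φ n) (ψ n)) ∧
      (∀ n, MemLp (ψ' n) p (volume.restrict (Ioo a b)) ∧ IsWeakDeriv .right α a b (φ n) (ψ' n)) ∧
      Tendsto (fun n => eLpNorm (φ n - u) p (volume.restrict (Ioo a b))) atTop (nhds 0) ∧
      Tendsto (fun n => eLpNorm (ψ n - v) p (volume.restrict (Ioo a b))) atTop (nhds 0) ∧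
      Tendsto (fun n => eLpNorm (ψ' n - v') p (volume.restrict (Ioo a b))) atTop (nhds 0) := by
  obtain ⟨W, hW, hWv, hWd⟩ := h.exists_extension hα hab hp1 hptop hαp hv hl hr
  obtain ⟨W', hW', hWv', hWd'⟩ := h'.exists_extension hα hab hp1 hptop hαp hv' hr hl
  obtain ⟨φ, hφ, hφl, hφd⟩ := exists_test_approx hα hab hp1 hptop (memLp_indicator hu)
    (integrable_indicator_of_memLp hp1.le hu) (fun x hx => indicator_of_notMem hx u)
  obtain ⟨ψ, hψ, hψl⟩ := hφd .left W hW hWd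
  obtain ⟨ψ', hψ', hψl'⟩ := hφd .right W' hW' hWd'
  have hind : (Ioo a b).indicator u =ᵐ[volume.restrict (Ioo a b)] u :=
    indicator_ae_eq_restrict measurableSet_Ioo
  exact ⟨φ, ψ, ψ', hφ, hψ, hψ',
    hφl.congr fun n => eLpNorm_congr_ae (EventuallyEq.rfl.sub hind),
    hψl.congr fun n => eLpNorm_congr_ae (EventuallyEq.rfl.sub hWv),
    hψl'.congr fun n => eLpNorm_congr_ae (EventuallyEq.rfl.sub hWv')⟩

end

/-! ### Completions of subspaces of Banach spaces -/

theorem isCompletion_of_topologicalClosure_eq {E : Type*} [NormedAddCommGroup E] [NormedSpace ℝ E]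
    [CompleteSpace E] {V W : Submodule ℝ E} (h : V.topologicalClosure = W) : IsCompletion V W := by
  refine ⟨h, ?_⟩
  have hVW : V ≤ W := h ▸ V.le_topologicalClosure
  have hWc : IsClosed (W : Set E) := h ▸ V.isClosed_topologicalClosure
  have : CompleteSpace W := hWc.completeSpace_coe
  have hd1 : DenseRange (UniformSpace.Completion.toComplₗᵢ (𝕜 := ℝ) (E := V)).toLinearMap :=
    UniformSpace.Completion.denseRange_coe
  have hd2 : DenseRange (Submodule.inclusion hVW) := by
    intro w
    have hw : (w : E) ∈ closure (V : Set E) := by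
      rw [← Submodule.topologicalClosure_coe, h]; exact w.2
    rw [closure_subtype]
    refine closure_mono ?_ hw
    exact fun v hv => ⟨⟨v, hVW hv⟩, ⟨⟨v, hv⟩, rfl⟩, rfl⟩
  have hn : ∀ v : V, ‖Submodule.inclusion hVW (LinearEquiv.refl ℝ V v)‖ =
      ‖(UniformSpace.Completion.toComplₗᵢ (𝕜 := ℝ) (E := V)).toLinearMap v‖ := fun v =>
    ((UniformSpace.Completion.toComplₗᵢ (𝕜 := ℝ) (E := V)).norm_map v).symm
  refine ⟨(LinearEquiv.refl ℝ V).extendOfIsometry _ _ hd1 hd2 hn, fun v => ?_⟩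
  exact congrArg Subtype.val
    (LinearEquiv.extendOfIsometry_eq (LinearEquiv.refl ℝ V) _ _ hd1 hd2 hn v)

/-! ### Completeness of the fractional Sobolev spaces -/

section

variable {s : Side} {α : ℝ} {p : ℝ≥0∞} [hp : Fact (1 ≤ p)] {a b : ℝ}

theorem continuous_setIntegral_mul (hab : a < b) (hp1 : 1 < p) {g : ℝ → ℝ} (hg : Continuous g) :
    Continuous fun f : LpI p a b => ∫ x in Ioo a b, f x * g x := by
  obtain ⟨M, hM⟩ := isCompact_Icc.exists_bound_of_continuousOn (hg.continuousOn (s := Icc a b))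
  have hM0 : 0 ≤ M := (norm_nonneg _).trans (hM a ⟨le_rfl, hab.le⟩)
  have hint : ∀ f : LpI p a b, Integrable (fun x => f x * g x) (volume.restrict (Ioo a b)) :=
    fun f => ((Lp.memLp f).integrable hp1.le).mul_bdd (c := M) hg.aestronglyMeasurable (by
      filter_upwards [ae_restrict_mem measurableSet_Ioo] with x hx
        using hM x (Ioo_subset_Icc_self hx))
  set D := (volume (Ioo a b) ^ (1 - 1 / p.toReal)).toReal
  refine (LipschitzWith.of_dist_le' (K := M * D) fun f f' => ?_).continuous
  rw [Real.dist_eq, ← integral_sub (hint f) (hint f'), dist_eq_norm, Lp.norm_def]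
  have h1 := integral_abs_le_toReal_eLpNorm hab hp1 (Lp.memLp (f - f'))
  have hi : Integrable (fun x => |(f - f') x|) (volume.restrict (Ioo a b)) :=
    ((Lp.memLp (f - f')).integrable hp1.le).abs
  calc |∫ x in Ioo a b, (f x * g x - f' x * g x)|
      ≤ ∫ x in Ioo a b, |f x * g x - f' x * g x| := abs_integral_le_integral_abs
    _ ≤ ∫ x in Ioo a b, M * |(f - f') x| := by
        refine integral_mono_ae ((hint f).sub (hint f')).abs (hi.const_mul M) ?_
        filter_upwards [ae_restrict_mem measurableSet_Ioo, Lp.coeFn_sub f f'] with x hx hx'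
        simp only [hx', Pi.sub_apply]
        rw [← sub_mul, abs_mul, mul_comm]
        exact mul_le_mul_of_nonneg_right (hM x (Ioo_subset_Icc_self hx)) (abs_nonneg _)
    _ = M * ∫ x in Ioo a b, |(f - f') x| := integral_const_mul _ _
    _ ≤ M * ((eLpNorm (f - f' : LpI p a b) p (volume.restrict (Ioo a b))).toReal * D) :=
        mul_le_mul_of_nonneg_left h1 hM0
    _ = _ := by ring

theorem isClosed_isWeakDeriv (s : Side) (hα : α < 1) (hab : a < b) (hp1 : 1 < p) :
    IsClosed {q : LpI p a b × LpI p a b | IsWeakDeriv s α a b q.1 q.2} := by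
  have e : {q : LpI p a b × LpI p a b | IsWeakDeriv s α a b q.1 q.2} =
      ⋂ (φ : ℝ → ℝ) (_ : IsTest a b φ), {q : LpI p a b × LpI p a b |
        ∫ x in Ioo a b, q.2 x * φ x = ∫ x in Ioo a b, q.1 x * rlDeriv s.opp α φ x} := by
    ext q
    simp only [mem_ofPred_eq, mem_iInter]
    have hq : ∀ f : LpI p a b, IntegrableOn f (Ioo a b) volume := fun f =>
      (Lp.memLp f).integrable hp1.le
    exact ⟨fun h => h.integral_eq, fun h => ⟨hq q.1, (hq q.2).locallyIntegrableOn, h⟩⟩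
  rw [e]
  refine isClosed_iInter fun φ => isClosed_iInter fun hφ => isClosed_eq ?_ ?_
  · exact (continuous_setIntegral_mul hab hp1 hφ.smooth.continuous).comp continuous_snd
  · exact (continuous_setIntegral_mul hab hp1 (continuous_rlDeriv _ hα hφ)).comp continuous_fst

variable [hα : Fact (α ∈ Ioo (0 : ℝ) 1)]

theorem FracSobolev.isometry_toProd : Isometry (FracSobolev.toProd s α p a b) :=
  AddMonoidHomClass.isometry_of_norm _ fun _ => rfl

theorem SymFracSobolev.isometry_toProd : Isometry (SymFracSobolev.toProd α p a b) :=
  AddMonoidHomClass.isometry_of_norm _ fun _ => rfl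

theorem FracSobolev.exists_of_isWeakDeriv {u v : LpI p a b} (h : IsWeakDeriv s α a b u v) :
    ∃ U : FracSobolev s α p a b, FracSobolev.toLp s α p a b U = u ∧
      FracSobolev.weakDeriv s α p a b U = v :=
  ⟨⟨u, v, h⟩, rfl, weakDeriv_unique (FracSobolev.isWeakDeriv _) h⟩

theorem FracSobolev.range_toProd : range (FracSobolev.toProd s α p a b) =
    {z | IsWeakDeriv s α a b z.fst z.snd} := by
  ext z
  constructor
  · rintro ⟨u, rfl⟩
    exact u.isWeakDeriv
  · intro h
    obtain ⟨U, h1, h2⟩ := FracSobolev.exists_of_isWeakDeriv h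
    refine ⟨U, ?_⟩
    change WithLp.toLp p (FracSobolev.toLp s α p a b U, FracSobolev.weakDeriv s α p a b U) = z
    rw [h1, h2]
    rfl

theorem FracSobolev.completeSpace (hab : a < b) (hp1 : 1 < p) :
    CompleteSpace (FracSobolev s α p a b) := by
  rw [completeSpace_iff_isComplete_range FracSobolev.isometry_toProd.isUniformInducing,
    FracSobolev.range_toProd]
  exact ((isClosed_isWeakDeriv s hα.out.2 hab hp1).preimage
    (WithLp.prod_continuous_ofLp p (LpI p a b) (LpI p a b))).isComplete

theorem FracSobolev.continuous_toLp : Continuous (FracSobolev.toLp s α p a b) :=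
  (WithLp.continuous_fst p (LpI p a b) (LpI p a b)).comp FracSobolev.isometry_toProd.continuous

theorem FracSobolev.continuous_weakDeriv : Continuous (FracSobolev.weakDeriv s α p a b) :=
  (WithLp.continuous_snd p (LpI p a b) (LpI p a b)).comp FracSobolev.isometry_toProd.continuous

theorem FracSobolev.tendsto_of_tendsto {ι : Type*} {l : Filter ι} {U : ι → FracSobolev s α p a b}
    {u : FracSobolev s α p a b}
    (h1 : Tendsto (fun i => FracSobolev.toLp s α p a b (U i)) l
      (nhds (FracSobolev.toLp s α p a b u)))
    (h2 : Tendsto (fun i => FracSobolev.weakDeriv s α p a b (U i)) l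
      (nhds (FracSobolev.weakDeriv s α p a b u))) : Tendsto U l (nhds u) := by
  rw [FracSobolev.isometry_toProd.isUniformInducing.isInducing.tendsto_nhds_iff]
  exact ((WithLp.prod_continuous_toLp p (LpI p a b) (LpI p a b)).tendsto _).comp
    (h1.prodMk_nhds h2)

theorem SymFracSobolev.range_toProd : range (SymFracSobolev.toProd α p a b) =
    {z | FracSobolev.toLp .left α p a b z.fst = FracSobolev.toLp .right α p a b z.snd} := by
  ext z
  constructor
  · rintro ⟨u, rfl⟩
    rfl
  · intro h
    have h : FracSobolev.toLp .left α p a b z.fst = FracSobolev.toLp .right α p a b z.snd := h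
    refine ⟨⟨FracSobolev.toLp .left α p a b z.fst, z.fst.2, h ▸ z.snd.2⟩, ?_⟩
    refine (WithLp.linearEquiv p ℝ
      (FracSobolev .left α p a b × FracSobolev .right α p a b)).injective (Prod.ext rfl ?_)
    exact Subtype.ext h

theorem SymFracSobolev.completeSpace (hab : a < b) (hp1 : 1 < p) :
    CompleteSpace (SymFracSobolev α p a b) := by
  have := FracSobolev.completeSpace (s := .left) (α := α) hab hp1
  have := FracSobolev.completeSpace (s := .right) (α := α) hab hp1
  rw [completeSpace_iff_isComplete_range SymFracSobolev.isometry_toProd.isUniformInducing,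
    SymFracSobolev.range_toProd]
  exact (isClosed_eq (FracSobolev.continuous_toLp.comp (WithLp.continuous_fst p _ _))
    (FracSobolev.continuous_toLp.comp (WithLp.continuous_snd p _ _))).isComplete

theorem SymFracSobolev.continuous_toSide (s : Side) :
    Continuous (SymFracSobolev.toSide s α p a b) := by
  cases s with
  | left => exact (WithLp.continuous_fst p _ _).comp SymFracSobolev.isometry_toProd.continuous
  | right => exact (WithLp.continuous_snd p _ _).comp SymFracSobolev.isometry_toProd.continuous

theorem SymFracSobolev.tendsto_of_tendsto {ι : Type*} {l : Filter ι}
    {U : ι → SymFracSobolev α p a b} {u : SymFracSobolev α p a b}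
    (h : ∀ s, Tendsto (fun i => SymFracSobolev.toSide s α p a b (U i)) l
      (nhds (SymFracSobolev.toSide s α p a b u))) : Tendsto U l (nhds u) := by
  rw [SymFracSobolev.isometry_toProd.isUniformInducing.isInducing.tendsto_nhds_iff]
  exact ((WithLp.prod_continuous_toLp p _ _).tendsto _).comp ((h .left).prodMk_nhds (h .right))

theorem SymFracSobolev.toLp_toSide (s : Side) (u : SymFracSobolev α p a b) :
    FracSobolev.toLp s α p a b (SymFracSobolev.toSide s α p a b u) =
      SymFracSobolev.toLp α p a b u := by
  cases s <;> rfl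

/-! ### Zero-trace spaces -/

theorem isClosed_zeroTrace (s : Side) (hab : a < b) (hp1 : 1 < p) (hptop : p ≠ ⊤)
    (hαp : 1 < α * p.toReal) : IsClosed (zeroTrace s α p a b : Set (FracSobolev s α p a b)) := by
  obtain ⟨K, hK0, hK⟩ := exists_trace_bound s hα.out hab hp1 hptop hαp
  have hK' : ∀ u : FracSobolev s α p a b, ∃ t, HasTrace s a b (FracSobolev.toLp s α p a b u) t ∧
      |t| ≤ K * (‖FracSobolev.toLp s α p a b u‖ + ‖FracSobolev.weakDeriv s α p a b u‖) := fun u =>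
    hK _ _ u.isWeakDeriv (Lp.memLp _) (Lp.memLp _)
  refine IsSeqClosed.isClosed fun w u hw hu => ?_
  obtain ⟨t, ht, -⟩ := hK' u
  have hb : ∀ n, |t| ≤ K * (‖FracSobolev.toLp s α p a b (u - w n)‖ +
      ‖FracSobolev.weakDeriv s α p a b (u - w n)‖) := fun n => by
    obtain ⟨t', ht', hb⟩ := hK' (u - w n)
    have h0 : HasTrace s a b (FracSobolev.toLp s α p a b (w n)) 0 := hw n
    have h1 := ht'.add h0
    rw [add_zero] at h1
    have h2 : HasTrace s a b (FracSobolev.toLp s α p a b u) t' := h1.congr (by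
      rw [map_sub]
      filter_upwards [Lp.coeFn_sub (FracSobolev.toLp s α p a b u)
        (FracSobolev.toLp s α p a b (w n))] with x hx
      rw [Pi.add_apply, hx, Pi.sub_apply, sub_add_cancel])
    rwa [ht.unique hab h2]
  have hlim : Tendsto (fun n => K * (‖FracSobolev.toLp s α p a b (u - w n)‖ +
      ‖FracSobolev.weakDeriv s α p a b (u - w n)‖)) atTop (nhds 0) := by
    have h0 : Tendsto (fun n => u - w n) atTop (nhds 0) := by
      simpa using hu.const_sub u
    have h1 := ((FracSobolev.continuous_toLp.tendsto (0 : FracSobolev s α p a b)).comp h0).norm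
    have h2 := ((FracSobolev.continuous_weakDeriv.tendsto (0 : FracSobolev s α p a b)).comp
      h0).norm
    have h3 := (h1.add h2).const_mul K
    simpa only [Function.comp_def, map_zero, norm_zero, add_zero, mul_zero] using h3
  have ht0 : t = 0 := abs_nonpos_iff.1 (ge_of_tendsto' hlim hb)
  rw [ht0] at ht
  exact ht

theorem IsOneSidedTest.hasTrace {φ : ℝ → ℝ} (h : IsOneSidedTest s a b φ) :
    HasTrace s a b φ 0 := by
  have key : ∀ {a b : ℝ} {φ : ℝ → ℝ}, IsOneSidedTest .left a b φ → HasTrace .left a b φ 0 := by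
    rintro a b φ ⟨h1, c, hc, h2⟩
    refine ⟨(Iio b).indicator φ, fun x hx => ?_, ?_, indicator_of_notMem self_notMem_Iio φ⟩
    · rcases hx.2.lt_or_eq with hxb | rfl
      · refine ContinuousAt.continuousWithinAt ?_
        refine (h1.continuousOn.continuousAt (Ioo_mem_nhds hx.1 hxb)).congr ?_
        filter_upwards [Iio_mem_nhds hxb] with y hy
        rw [indicator_of_mem hy]
      · have h0 : ContinuousWithinAt (fun _ : ℝ => (0 : ℝ)) (Side.left.dom a x) x :=
          continuousWithinAt_const
        refine h0.congr_of_eventuallyEq ?_ (indicator_of_notMem self_notMem_Iio φ)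
        filter_upwards [self_mem_nhdsWithin, mem_nhdsWithin_of_mem_nhds (Ioi_mem_nhds hc.2)]
          with y hy hyc
        by_cases hyx : y < x
        · rw [indicator_of_mem (mem_Iio.2 hyx), h2 y ⟨hy.1, hyx⟩ hyc]
        · exact indicator_of_notMem (notMem_Iio.2 (not_lt.1 hyx)) φ
    · filter_upwards [ae_restrict_mem measurableSet_Ioo] with x hx
      rw [indicator_of_mem (mem_Iio.2 hx.2)]
  cases s with
  | left => exact key h
  | right =>
    have h2 := (key h.neg).neg
    simp only [neg_neg] at h2
    exact h2

theorem oneSidedTest_le_zeroTrace (s : Side) (hab : a < b) :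
    oneSidedTest s α p hab ≤ zeroTrace s α p a b := by
  rintro u ⟨φ, hφ, he⟩
  exact hφ.hasTrace.congr he

theorem topologicalClosure_oneSidedTest (s : Side) (hab : a < b) (hp1 : 1 < p) (hptop : p ≠ ⊤)
    (hαp : 1 < α * p.toReal) :
    (oneSidedTest s α p hab).topologicalClosure = zeroTrace s α p a b := by
  refine le_antisymm (Submodule.topologicalClosure_minimal _ (oneSidedTest_le_zeroTrace s hab)
    (isClosed_zeroTrace s hab hp1 hptop hαp)) fun u hu => ?_
  obtain ⟨φ, ψ, h, hφ, hψ⟩ := u.isWeakDeriv.exists_oneSided_approx hα.out hab hp1 hptop hαp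
    (Lp.memLp _) (Lp.memLp _) hu
  have hex : ∀ n, ∃ U : FracSobolev s α p a b,
      FracSobolev.toLp s α p a b U = (h n).1.toLp (φ n) ∧
      FracSobolev.weakDeriv s α p a b U = (h n).2.1.toLp (ψ n) := fun n =>
    FracSobolev.exists_of_isWeakDeriv
      ((h n).2.2.1.congr (MemLp.coeFn_toLp _) (MemLp.coeFn_toLp _))
  choose U hU1 hU2 using hex
  refine mem_closure_of_tendsto (f := U) (b := atTop) (FracSobolev.tendsto_of_tendsto ?_ ?_)
    (Eventually.of_forall fun n => ?_)
  · simp only [hU1]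
    have := (Lp.tendsto_Lp_iff_tendsto_eLpNorm'' φ (fun n => (h n).1) _ (Lp.memLp _)).2 hφ
    rwa [Lp.toLp_coeFn] at this
  · simp only [hU2]
    have := (Lp.tendsto_Lp_iff_tendsto_eLpNorm'' ψ (fun n => (h n).2.1) _ (Lp.memLp _)).2 hψ
    rwa [Lp.toLp_coeFn] at this
  · obtain ⟨χ, hχ, hχe⟩ := (h n).2.2.2
    refine ⟨χ, hχ, ?_⟩
    rw [hU1]
    exact (MemLp.coeFn_toLp _).trans hχe

theorem isClosed_symZeroTrace (hab : a < b) (hp1 : 1 < p) (hptop : p ≠ ⊤)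
    (hαp : 1 < α * p.toReal) :
    IsClosed (symZeroTrace α p a b : Set (SymFracSobolev α p a b)) :=
  ((isClosed_zeroTrace .left hab hp1 hptop hαp).preimage
    (SymFracSobolev.continuous_toSide .left)).inter
    ((isClosed_zeroTrace .right hab hp1 hptop hαp).preimage
      (SymFracSobolev.continuous_toSide .right))

theorem symTest_le_symZeroTrace (hab : a < b) : symTest α p a b ≤ symZeroTrace α p a b := by
  rintro u ⟨φ, hφ, he⟩
  have key : ∀ s, HasTrace s a b
      (FracSobolev.toLp s α p a b (SymFracSobolev.toSide s α p a b u)) 0 := fun s => by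
    rw [SymFracSobolev.toLp_toSide]
    exact (hφ.isOneSidedTest hab s).hasTrace.congr he
  exact ⟨key .left, key .right⟩

theorem topologicalClosure_symTest (hab : a < b) (hp1 : 1 < p) (hptop : p ≠ ⊤)
    (hαp : 1 < α * p.toReal) :
    (symTest α p a b).topologicalClosure = symZeroTrace α p a b := by
  refine le_antisymm (Submodule.topologicalClosure_minimal _ (symTest_le_symZeroTrace hab)
    (isClosed_symZeroTrace hab hp1 hptop hαp)) fun u hu => ?_
  have hl : HasTrace .left a b (SymFracSobolev.toLp α p a b u) 0 := hu.1
  have hr : HasTrace .right a b (SymFracSobolev.toLp α p a b u) 0 := hu.2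
  set ul := SymFracSobolev.toSide .left α p a b u with hul
  set ur := SymFracSobolev.toSide .right α p a b u with hur
  have hdl : IsWeakDeriv .left α a b (SymFracSobolev.toLp α p a b u)
      (FracSobolev.weakDeriv .left α p a b ul) := ul.isWeakDeriv
  have hdr : IsWeakDeriv .right α a b (SymFracSobolev.toLp α p a b u)
      (FracSobolev.weakDeriv .right α p a b ur) := ur.isWeakDeriv
  obtain ⟨φ, ψ, ψ', hφ, hψ, hψ', l1, l2, l3⟩ := exists_test_approx_of_traces hα.out hab hp1 hptop
    hαp (Lp.memLp _) hdl (Lp.memLp _) hdr (Lp.memLp _) hl hr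
  have hφp : ∀ n, MemLp (φ n) p (volume.restrict (Ioo a b)) := fun n =>
    memLp_Ioo_of_continuous (hφ n).smooth.continuous
  have dl : ∀ n, IsWeakDeriv .left α a b ((hφp n).toLp (φ n)) ((hψ n).1.toLp (ψ n)) := fun n =>
    (hψ n).2.congr (MemLp.coeFn_toLp _) (MemLp.coeFn_toLp _)
  have dr : ∀ n, IsWeakDeriv .right α a b ((hφp n).toLp (φ n)) ((hψ' n).1.toLp (ψ' n)) := fun n =>
    (hψ' n).2.congr (MemLp.coeFn_toLp _) (MemLp.coeFn_toLp _)
  let U : ℕ → SymFracSobolev α p a b := fun n => ⟨(hφp n).toLp (φ n), ⟨_, dl n⟩, ⟨_, dr n⟩⟩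
  have hU : ∀ s n, FracSobolev.toLp s α p a b (SymFracSobolev.toSide s α p a b (U n)) =
      (hφp n).toLp (φ n) := fun s n => SymFracSobolev.toLp_toSide s (U n)
  have hUl : ∀ n, FracSobolev.weakDeriv .left α p a b (SymFracSobolev.toSide .left α p a b (U n)) =
      (hψ n).1.toLp (ψ n) := fun n => weakDeriv_unique (FracSobolev.isWeakDeriv _) (dl n)
  have hUr : ∀ n, FracSobolev.weakDeriv .right α p a b
      (SymFracSobolev.toSide .right α p a b (U n)) = (hψ' n).1.toLp (ψ' n) := fun n =>
    weakDeriv_unique (FracSobolev.isWeakDeriv _) (dr n)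
  refine mem_closure_of_tendsto (f := U) (b := atTop)
    (SymFracSobolev.tendsto_of_tendsto fun s => FracSobolev.tendsto_of_tendsto ?_ ?_)
    (Eventually.of_forall fun n => ⟨φ n, hφ n, MemLp.coeFn_toLp (hφp n)⟩)
  · simp only [hU, SymFracSobolev.toLp_toSide]
    have := (Lp.tendsto_Lp_iff_tendsto_eLpNorm'' φ hφp _ (Lp.memLp _)).2 l1
    rwa [Lp.toLp_coeFn] at this
  · cases s with
    | left =>
      simp only [hUl]
      have := (Lp.tendsto_Lp_iff_tendsto_eLpNorm'' ψ (fun n => (hψ n).1) _ (Lp.memLp _)).2 l2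
      rwa [Lp.toLp_coeFn] at this
    | right =>
      simp only [hUr]
      have := (Lp.tendsto_Lp_iff_tendsto_eLpNorm'' ψ' (fun n => (hψ' n).1) _ (Lp.memLp _)).2 l3
      rwa [Lp.toLp_coeFn] at this

end

end FracSob

end

theorem mainTheorem6 (a b : ℝ) (hab : a < b) (α : ℝ) [hα : Fact (α ∈ Set.Ioo (0 : ℝ) 1)]
    (p : ℝ≥0∞) [hp : Fact (1 ≤ p)] (hp1 : 1 < p) (hptop : p ≠ ⊤) (hαp : 1 < α * p.toReal) :
    (∀ s : FracSob.Side,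
      FracSob.IsCompletion (FracSob.oneSidedTest s α p hab) (FracSob.zeroTrace s α p a b)) ∧
    FracSob.IsCompletion (FracSob.symTest α p a b) (FracSob.symZeroTrace α p a b) := by
  have := FracSob.SymFracSobolev.completeSpace (α := α) hab hp1
  refine ⟨fun s => ?_, FracSob.isCompletion_of_topologicalClosure_eq
    (FracSob.topologicalClosure_symTest hab hp1 hptop hαp)⟩
  have := FracSob.FracSobolev.completeSpace (s := s) (α := α) hab hp1
  exact FracSob.isCompletion_of_topologicalClosure_eq
    (FracSob.topologicalClosure_oneSidedTest s hab hp1 hptop hαp)
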